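/- Let $\gamma>0$, $n_{\rm th}>0$, $\Delta_A\in\mathbb R$ with $|\Delta_A|/\gamma<\tfrac12\sqrt{2\sqrt3-3}\ (\simeq 0.34)$, and $\kappa\in\mathbb R\setminus\{0\}$. Let $a$ be the annihilation operator of a harmonic oscillator $A$, let $B$ be a qubit with $\sigma_-=|g\rangle\langle e|$, $\sigma_+=\sigma_-^\dagger$, $\sigma_z=|e\rangle\langle e|-|g\rangle\langle g|$, and write $\mathcal D[L](X)=LXL^\dagger-\tfrac12(L^\dagger LX+XL^\dagger L)$. Consider the damped oscillator coupled to the qubit by the Jaynes–Cummings interaction of strength $g=\epsilon\kappa$, i.e. the generator $\mathcal L_{\rm tot}=\mathcal L_A\otimes\mathcal I_B+\epsilon\mathcal L_{\rm int}$ with $$\mathcal L_A=-i\Delta_A[a^\dagger a,\cdot]+\gamma(1+n_{\rm th})\mathcal D[a]+\gamma n_{\rm th}\mathcal D[a^\dagger],\qquad \mathcal L_{\rm int}=-i\kappa[a^\dagger\otimes\sigma_-+a\otimes\sigma_+,\cdot].$$ (The usual normalisation $\epsilon=|g|/\gamma$ is the case $\kappa=\pm\gamma$.) Let $\bar\rho_A=r^{a^\dagger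 a}/{\rm tr}\,r^{a^\dagger a}$ with $r=n_{\rm th}/(1+n_{\rm th})$ be the thermal state. Given linear maps $G_1,G_2,\dots$ on $M_2(\mathbb C)$ (a gauge), an adiabatic elimination in the gauge $(G_n)$ is a pair of sequences of linear maps $\mathcal K_n$, from $M_2(\mathbb C)$ to operators on $A\otimes B$ whose matrix elements in the Fock basis decrease faster than every power of the occupation numbers, and $\mathcal L_{s,n}:M_2(\mathbb C)\to M_2(\mathbb C)$, $n\ge0$, such that $\mathcal K_0(X)=\bar\rho_A\otimes X$, $\mathcal L_{s,0}=0$, ${\rm tr}_A\circ\mathcal K_n=G_n$ for $n\ge1$, and the invariance condition $\mathcal K\circ\mathcal L_s=\mathcal L_{\rm tot}\circ\mathcal K$ holds at every order in $\epsilon$ for the formal series $\mathcal K=\sum\epsilon^n\mathcal K_n$, $\mathcal L_s=\sum\epsilon^n\mathcal L_{s,n}$. The partial-trace gauge is $G_n=0$ for all $n$; quantities in it carry the superscript $G=0$. A linear map on $M_2(\mathbb C)$ is a Kraus map if it is completely positive and trace preserving, and a Lindbladian if it has the form $-i[H,\cdot]+\sum_k\mathcal D[L_k]$ (finite sum) with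 $H$ Hermitian. With $n_+=n_{\rm th}$, $n_-=1+n_{\rm th}$, $\bar\gamma=\gamma+2i\Delta_A$ and $$b_\pm=\frac{2g^2n_\pm}{\bar\gamma}+\frac{8g^4n_\pm^2}{\bar\gamma^3}+\frac{8g^4n_+n_-(1+8i\gamma\Delta_A/|\bar\gamma|^2)}{\bar\gamma^*|\bar\gamma|^2},$$ put $\omega=\mathrm{Im}(b_-+b_+)$, $\gamma_\pm=2\,\mathrm{Re}\,b_\pm$, $1/T_1=\gamma_-+\gamma_+$, $1/T_2=1/(2T_1)+2\gamma_\phi$, where $$\gamma_\phi=-\frac{8g^4n_+n_-\bigl(3-6(2\Delta_A/\gamma)^2-(2\Delta_A/\gamma)^4\bigr)}{\gamma^3\bigl(1+(2\Delta_A/\gamma)^2\bigr)^3}$$ ($1/T_1$ and $1/T_2$ are notations for these real numbers). Then: 1. For every gauge $(G_n)$ there is exactly one adiabatic elimination. 2. With $G=\sum_{n\ge1}\epsilon^nG_n$, as formal power series in $\epsilon$, $\mathcal K^G=\mathcal K^{G=0}\circ(\mathcal I+G)$ and $(\mathcal I+G)\circ\mathcal L_s^G=\mathcal L_s^{G=0}\circ(\mathcal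 I+G)$. 3. For every $\epsilon>0$ the fourth-order partial-trace generator $\mathcal L:=\sum_{n\le4}\epsilon^n\mathcal L_{s,n}^{G=0}$ equals $$-\tfrac{i\omega}{2}[\sigma_z,\cdot]+\gamma_-\mathcal D[\sigma_-]+\gamma_+\mathcal D[\sigma_+]+\gamma_\phi\mathcal D[\sigma_z],\qquad\text{and}\quad\gamma_\phi<0.$$ For every linear map $G$ on $M_2(\mathbb C)$ with $\mathcal I+G$ invertible, $\mathcal L^G:=(\mathcal I+G)^{-1}\circ\mathcal L\circ(\mathcal I+G)$ is not a Lindbladian, and $e^{t\mathcal L^G}$ has, with multiplicities, the spectrum $\Lambda_t=\{1,e^{-t/T_2+ i\omega t},e^{-t/T_2-i\omega t},e^{-t/T_1}\}$ for all $t\in\mathbb R$. Moreover there is $t_0>0$ such that for all $0<t<t_0$: $2e^{-t/T_2}>1+e^{-t/T_1}$; no Kraus map has the spectrum $\Lambda_t$ (with multiplicities); and, for every such $G$, $e^{t\mathcal L^G}$ is not a Kraus map. 4. For every gauge $(G_n)$ and every $N\ge4$ there is $\epsilon_0>0$ such that for all $0<\epsilon<\epsilon_0$ the truncated generator $\sum_{n\le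 N}\epsilon^n\mathcal L_{s,n}^G$ is not a Lindbladian, and, for all sufficiently small $t>0$ (depending on $\epsilon$), its exponential $e^{t(\cdot)}$ is not a Kraus map. Hence no gauge choice turns the expansion up to fourth (or any higher) order into a Lindblad equation, contrary to the conjecture of Azouit, Chittaro, Sarlette and Rouchon. -/

import Mathlib

open scoped Kronecker ComplexOrder

noncomputable section

namespace AdiabaticElimination

/-- Operators on the qubit space `ℂ²`; index `0` is the excited state and index `1` the ground
state. -/
abbrev QubitOp := Matrix (Fin 2) (Fin 2) ℂ

/-- Superoperators on the qubit. -/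
abbrev QubitSuperOp := Module.End ℂ QubitOp

/-- Operators of the oscillator, given by their matrix elements in the Fock basis. -/
abbrev OscOp := Matrix ℕ ℕ ℂ

/-- Operators of the composite oscillator-qubit system, given by their matrix elements in the
product of the Fock basis and the qubit basis. -/
abbrev TotOp := Matrix (ℕ × Fin 2) (ℕ × Fin 2) ℂ

/-! ### Infinite matrices

Every product formed below has a factor with finitely many nonzero entries in each row and in each
column, so that all the sums in `opMul` are finite sums. -/

/-- The product of two (possibly infinite) matrices. -/
def opMul {ι : Type*} (M N : Matrix ι ι ℂ) : Matrix ι ι ℂ :=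
  fun i j => ∑' k, M i k * N k j

/-- The commutator `[H, X]`. -/
def opComm {ι : Type*} (H X : Matrix ι ι ℂ) : Matrix ι ι ℂ :=
  opMul H X - opMul X H

/-- The dissipator `L X L† - (L† L X + X L† L) / 2`. -/
def opDissipator {ι : Type*} (L X : Matrix ι ι ℂ) : Matrix ι ι ℂ :=
  opMul (opMul L X) L.conjTranspose
    - (1 / 2 : ℂ) • (opMul (opMul L.conjTranspose L) X + opMul X (opMul L.conjTranspose L))

/-- For finite matrices `opMul` is the usual product. -/
theorem opMul_eq_mul {ι : Type*} [Fintype ι] (M N : Matrix ι ι ℂ) : opMul M N = M * N := by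
  ext i j
  simp [opMul, Matrix.mul_apply, tsum_fintype]

/-- Matrix elements that decrease faster than any power of the occupation numbers. This is the
space of density-like operators on which every polynomial in `a` and `a†` acts from both sides. -/
def RapidlyDecreasing (X : TotOp) : Prop :=
  ∀ p : ℕ, ∃ C : ℝ, ∀ i j : ℕ × Fin 2,
    ((i.1 : ℝ) + 1) ^ p * ((j.1 : ℝ) + 1) ^ p * ‖X i j‖ ≤ C

/-- The partial trace over the oscillator. -/
def traceA (X : TotOp) : QubitOp :=
  fun s t => ∑' n : ℕ, X (n, s) (n, t)

/-! ### The damped oscillator coupled to a qubit -/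

/-- The annihilation operator, `a |n⟩ = √n |n - 1⟩`. -/
def annihilation : OscOp :=
  fun m n => if n = m + 1 then ((Real.sqrt n : ℝ) : ℂ) else 0

/-- The creation operator `a†`. -/
def creation : OscOp := annihilation.conjTranspose

/-- `σ₋`, which maps the excited state to the ground state. -/
def sigmaMinus : QubitOp := !![0, 0; 1, 0]

/-- `σ₊ = σ₋†`. -/
def sigmaPlus : QubitOp := !![0, 1; 0, 0]

/-- `σ_z`. -/
def sigmaZ : QubitOp := !![1, 0; 0, -1]

/-- `𝓛_A ⊗ 𝓘_B` with
`𝓛_A = -i Δ [a†a, ·] + γ (1 + n_th) D[a] + γ n_th D[a†]`. -/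
def oscLindbladian (γ Δ nth : ℝ) (X : TotOp) : TotOp :=
  (-Complex.I * (Δ : ℂ)) • opComm (opMul creation annihilation ⊗ₖ (1 : QubitOp)) X
    + ((γ * (1 + nth) : ℝ) : ℂ) • opDissipator (annihilation ⊗ₖ (1 : QubitOp)) X
    + ((γ * nth : ℝ) : ℂ) • opDissipator (creation ⊗ₖ (1 : QubitOp)) X

/-- The Jaynes-Cummings interaction `-i κ [a† ⊗ σ₋ + a ⊗ σ₊, ·]`. -/
def interaction (κ : ℝ) (X : TotOp) : TotOp :=
  (-Complex.I * (κ : ℂ)) •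
    opComm (creation ⊗ₖ sigmaMinus + annihilation ⊗ₖ sigmaPlus) X

/-- The thermal state `r^(a†a) / tr r^(a†a)` with `r = n_th / (1 + n_th)`. -/
def thermalState (nth : ℝ) : OscOp :=
  Matrix.diagonal fun n : ℕ =>
    (((nth / (1 + nth)) ^ n / ∑' k : ℕ, (nth / (1 + nth)) ^ k : ℝ) : ℂ)

/-! ### Adiabatic elimination -/

/-- `K = ∑ εⁿ Kₙ` and `Lₛ = ∑ εⁿ Lₛ,ₙ` form the adiabatic elimination of the oscillator in
`𝓛_tot = 𝓛_A + ε 𝓛_int`, in the gauge `G = ∑_{n ≥ 1} εⁿ Gₙ`: the invariance condition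
`K ∘ Lₛ = 𝓛_tot ∘ K` holds order by order in `ε`, the zeroth order is `K₀(X) = ρ̄_A ⊗ X` and
`Lₛ,₀ = 0`, and `tr_A ∘ Kₙ = Gₙ` for `n ≥ 1`. The value `G 0` plays no role. -/
structure IsAdiabaticElimination (γ Δ nth κ : ℝ) (G : ℕ → QubitSuperOp)
    (K : ℕ → QubitOp →ₗ[ℂ] TotOp) (L : ℕ → QubitSuperOp) : Prop where
  decay : ∀ n X, RapidlyDecreasing (K n X)
  K_zero : ∀ X, K 0 X = thermalState nth ⊗ₖ X
  L_zero : L 0 = 0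
  invariance_zero : ∀ X, K 0 (L 0 X) = oscLindbladian γ Δ nth (K 0 X)
  invariance_succ : ∀ n X,
    ∑ p ∈ Finset.HasAntidiagonal.antidiagonal (n + 1), K p.1 (L p.2 X)
      = oscLindbladian γ Δ nth (K (n + 1) X) + interaction κ (K n X)
  gauge : ∀ n X, traceA (K (n + 1) X) = G (n + 1) X

/-- The coefficients of the formal series `𝓘 + ∑_{n ≥ 1} εⁿ Gₙ`. -/
def onePlusGauge (G : ℕ → QubitSuperOp) : ℕ → QubitSuperOp
  | 0 => 1
  | n + 1 => G (n + 1)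

/-- The truncated generator `∑_{n ≤ N} εⁿ Lₛ,ₙ`. -/
def truncatedGenerator (L : ℕ → QubitSuperOp) (N : ℕ) (ε : ℝ) : QubitSuperOp :=
  ∑ n ∈ Finset.range (N + 1), ((ε : ℂ) ^ n) • L n

/-- `(𝓘 + G)⁻¹ ∘ L ∘ (𝓘 + G)`, for `𝓘 + G` invertible. -/
def gaugeTransform (G L : QubitSuperOp) : QubitSuperOp :=
  Ring.inverse (1 + G) * L * (1 + G)

/-! ### Lindbladians, semigroups and Kraus maps on the qubit -/

/-- `exp (t L)`. -/
def expSuper (L : QubitSuperOp) (t : ℝ) : QubitSuperOp :=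
  Matrix.toLin (Matrix.stdBasis ℂ (Fin 2) (Fin 2)) (Matrix.stdBasis ℂ (Fin 2) (Fin 2))
    (NormedSpace.exp ((t : ℂ) •
      LinearMap.toMatrix (Matrix.stdBasis ℂ (Fin 2) (Fin 2))
        (Matrix.stdBasis ℂ (Fin 2) (Fin 2)) L))

/-- `𝓘_k ⊗ Φ` maps positive semidefinite operators on `ℂᵏ ⊗ ℂ²` to such operators, for all `k`. -/
def IsCompletelyPositive (Φ : QubitSuperOp) : Prop :=
  ∀ (k : ℕ) (X : Matrix (Fin k × Fin 2) (Fin k × Fin 2) ℂ), X.PosSemidef →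
    Matrix.PosSemidef (Matrix.of fun i j : Fin k × Fin 2 =>
      Φ (Matrix.of fun s t => X (i.1, s) (j.1, t)) i.2 j.2)

/-- A Kraus map: completely positive and trace preserving. -/
def IsKrausMap (Φ : QubitSuperOp) : Prop :=
  IsCompletelyPositive Φ ∧ ∀ X : QubitOp, (Φ X).trace = X.trace

/-- `L = -i [H, ·] + ∑ₖ D[Jₖ]` with `H` Hermitian. -/
def IsLindbladian (L : QubitSuperOp) : Prop :=
  ∃ H : QubitOp, H.IsHermitian ∧ ∃ (r : ℕ) (J : Fin r → QubitOp),
    ∀ X, L X = (-Complex.I) • opComm H X + ∑ k, opDissipator (J k) X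

/-! ### The fourth-order coefficients -/

/-- `γ̄ = γ + 2 i Δ`. -/
def gammaBar (γ Δ : ℝ) : ℂ := (γ : ℂ) + 2 * Complex.I * (Δ : ℂ)

/-- The complex rate
`2 g² n / γ̄ + 8 g⁴ n² / γ̄³ + 8 g⁴ n₊ n₋ (1 + 8 i γ Δ / |γ̄|²) / (γ̄* |γ̄|²)`,
with `n₊ = n_th` and `n₋ = 1 + n_th`; it is `b₊` for `n = n₊` and `b₋` for `n = n₋`. -/
def bCoeff (γ Δ nth g n : ℝ) : ℂ :=
  2 * (g : ℂ) ^ 2 * (n : ℂ) / gammaBar γ Δ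
    + 8 * (g : ℂ) ^ 4 * (n : ℂ) ^ 2 / gammaBar γ Δ ^ 3
    + 8 * (g : ℂ) ^ 4 * (nth : ℂ) * (1 + (nth : ℂ))
        * (1 + 8 * Complex.I * (γ : ℂ) * (Δ : ℂ) / (‖gammaBar γ Δ‖ : ℂ) ^ 2)
        / ((starRingEnd ℂ) (gammaBar γ Δ) * (‖gammaBar γ Δ‖ : ℂ) ^ 2)

/-- The frequency `ω_B = Im (b₋ + b₊)`. -/
def omegaB (γ Δ nth g : ℝ) : ℝ :=
  (bCoeff γ Δ nth g (1 + nth) + bCoeff γ Δ nth g nth).im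

/-- The rate `γ₋ = 2 Re b₋`. -/
def gammaMinus (γ Δ nth g : ℝ) : ℝ := 2 * (bCoeff γ Δ nth g (1 + nth)).re

/-- The rate `γ₊ = 2 Re b₊`. -/
def gammaPlus (γ Δ nth g : ℝ) : ℝ := 2 * (bCoeff γ Δ nth g nth).re

/-- The dephasing coefficient `γ_φ`. -/
def gammaPhi (γ Δ nth g : ℝ) : ℝ :=
  -(8 * g ^ 4 * nth * (1 + nth) * (3 - 6 * (2 * Δ / γ) ^ 2 - (2 * Δ / γ) ^ 4))
    / (γ ^ 3 * (1 + (2 * Δ / γ) ^ 2) ^ 3)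

/-- The rate `1 / T₁ = γ₋ + γ₊`. -/
def rateOne (γ Δ nth g : ℝ) : ℝ := gammaMinus γ Δ nth g + gammaPlus γ Δ nth g

/-- The rate `1 / T₂ = 1 / (2 T₁) + 2 γ_φ`. -/
def rateTwo (γ Δ nth g : ℝ) : ℝ := rateOne γ Δ nth g / 2 + 2 * gammaPhi γ Δ nth g

/-- The monic polynomial with the roots
`1, exp (-t/T₂ + i ω_B t), exp (-t/T₂ - i ω_B t), exp (-t/T₁)`. -/
def spectrumPoly (γ Δ nth g t : ℝ) : Polynomial ℂ :=
  (Polynomial.X - Polynomial.C 1)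
    * (Polynomial.X - Polynomial.C
        (Complex.exp (-(t : ℂ) * (rateTwo γ Δ nth g : ℂ)
          + Complex.I * (omegaB γ Δ nth g : ℂ) * (t : ℂ))))
    * (Polynomial.X - Polynomial.C
        (Complex.exp (-(t : ℂ) * (rateTwo γ Δ nth g : ℂ)
          - Complex.I * (omegaB γ Δ nth g : ℂ) * (t : ℂ))))
    * (Polynomial.X - Polynomial.C
        (Complex.exp (-(t : ℂ) * (rateOne γ Δ nth g : ℂ))))

end AdiabaticElimination

end

/-! Put z = γ/2 - iΔ and w = γ/2 + iΔ. The superoperators `Dz` = [·, a] and `Dw` = [a†, ·] together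
with the "derivatives" `dZ`, `dW` form two commuting Heisenberg pairs in which the thermal state is
the vacuum and the oscillator generator is -z `Dz` `dZ` - w `Dw` `dW`. Hence Dzʲ Dwᵏ (ρ̄ ⊗ X) is an
eigenoperator with eigenvalue -(zj + wk), nonzero unless j = k = 0. The interaction preserves the
span of these operators, so every order of the invariance condition is solvable there. Taking the
partial trace fixes the next term of the generator; the next term of K is then unique, because
rapidly decreasing elements of the kernel are products ρ̄ ⊗ X
(`eq_thermalTensor_of_oscGen_eq_zero`), which the gauge condition fixes. The gauge law follows: K⁰ ∘
(1 + G) solves the problem in the gauge G, so it is the solution.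

The obstruction is spectral. Lindbladians, and limits of difference quotients of Kraus maps, satisfy
`CondPos`. A real eigenvalue μ of the action on Bloch vectors has a traceless hermitian eigenvector;
after a unitary rotation this is a multiple of σ_z, and conditional positivity gives tr L ≤ 2μ
(`CondPos.trace_le`). With μ = -1/T₁ this is 1/T₂ ≥ 1/(2T₁), which fails when γ_φ < 0. For a single
Kraus map the determinant plays the part of the trace (`IsKrausMap.norm_eigenvalue_le`). Spectra do
not change under similarity, so no G helps.

A truncated generator in a general gauge is similar to the fourth-order partial-trace one only up to
an error. After division by ε² the error is O(ε³). The characteristic polynomial at half the trace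
is a smooth similarity invariant; under `CondPos` with negative trace it is nonnegative
(`CondPos.charpoly_nonneg`), while for the rescaled partial-trace generator it is at most -kε². The
error cannot restore the sign (`eventually_not_condPos`). -/

namespace AdiabaticElimination

/-! ### Ladder operators acting from either side -/

/-- Left multiplication by `a`. -/
noncomputable def aL : Module.End ℂ TotOp where
  toFun X := fun i j => ((Real.sqrt ((i.1 : ℝ) + 1) : ℝ) : ℂ) * X (i.1 + 1, i.2) j
  map_add' _ _ := funext₂ fun _ _ => mul_add _ _ _
  map_smul' _ _ := funext₂ fun _ _ => mul_left_comm _ _ _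

/-- Left multiplication by `a†`. -/
noncomputable def adL : Module.End ℂ TotOp where
  toFun X := fun i j => ((Real.sqrt (i.1 : ℝ) : ℝ) : ℂ) * X (i.1 - 1, i.2) j
  map_add' _ _ := funext₂ fun _ _ => mul_add _ _ _
  map_smul' _ _ := funext₂ fun _ _ => mul_left_comm _ _ _

/-- Right multiplication by `a`. -/
noncomputable def aR : Module.End ℂ TotOp where
  toFun X := fun i j => ((Real.sqrt (j.1 : ℝ) : ℝ) : ℂ) * X i (j.1 - 1, j.2)
  map_add' _ _ := funext₂ fun _ _ => mul_add _ _ _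
  map_smul' _ _ := funext₂ fun _ _ => mul_left_comm _ _ _

/-- Right multiplication by `a†`. -/
noncomputable def adR : Module.End ℂ TotOp where
  toFun X := fun i j => ((Real.sqrt ((j.1 : ℝ) + 1) : ℝ) : ℂ) * X i (j.1 + 1, j.2)
  map_add' _ _ := funext₂ fun _ _ => mul_add _ _ _
  map_smul' _ _ := funext₂ fun _ _ => mul_left_comm _ _ _

/-- Left multiplication by a qubit operator. -/
noncomputable def sL (S : QubitOp) : Module.End ℂ TotOp where
  toFun X := fun i j => ∑ s, S i.2 s * X (i.1, s) j
  map_add' X Y := funext₂ fun i j => by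
    change _ = (∑ s, S i.2 s * X (i.1, s) j) + ∑ s, S i.2 s * Y (i.1, s) j
    simp only [Matrix.add_apply, mul_add, Finset.sum_add_distrib]
  map_smul' c X := funext₂ fun i j => by
    simp only [Matrix.smul_apply, smul_eq_mul, RingHom.id_apply]
    change _ = c * (∑ s, S i.2 s * X (i.1, s) j)
    simp only [Finset.mul_sum, mul_left_comm]

/-- Right multiplication by a qubit operator. -/
noncomputable def sR (S : QubitOp) : Module.End ℂ TotOp where
  toFun X := fun i j => ∑ s, X i (j.1, s) * S s j.2
  map_add' X Y := funext₂ fun i j => by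
    change _ = (∑ s, X i (j.1, s) * S s j.2) + ∑ s, Y i (j.1, s) * S s j.2
    simp only [Matrix.add_apply, add_mul, Finset.sum_add_distrib]
  map_smul' c X := funext₂ fun i j => by
    simp only [Matrix.smul_apply, smul_eq_mul, RingHom.id_apply]
    change _ = c * (∑ s, X i (j.1, s) * S s j.2)
    simp only [Finset.mul_sum, mul_assoc]

theorem aL_apply (X : TotOp) (i j) :
    aL X i j = ((Real.sqrt ((i.1 : ℝ) + 1) : ℝ) : ℂ) * X (i.1 + 1, i.2) j := rfl

theorem adL_apply (X : TotOp) (i j) :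
    adL X i j = ((Real.sqrt (i.1 : ℝ) : ℝ) : ℂ) * X (i.1 - 1, i.2) j := rfl

theorem aR_apply (X : TotOp) (i j) :
    aR X i j = ((Real.sqrt (j.1 : ℝ) : ℝ) : ℂ) * X i (j.1 - 1, j.2) := rfl

theorem adR_apply (X : TotOp) (i j) :
    adR X i j = ((Real.sqrt ((j.1 : ℝ) + 1) : ℝ) : ℂ) * X i (j.1 + 1, j.2) := rfl

theorem sL_apply (S : QubitOp) (X : TotOp) (i j) :
    sL S X i j = ∑ s, S i.2 s * X (i.1, s) j := rfl

theorem sR_apply (S : QubitOp) (X : TotOp) (i j) :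
    sR S X i j = ∑ s, X i (j.1, s) * S s j.2 := rfl

theorem sL_one : sL 1 = 1 := by
  refine LinearMap.ext fun X => ?_
  ext ⟨i, s⟩ j
  fin_cases s <;> simp [sL_apply]

theorem sR_one : sR 1 = 1 := by
  refine LinearMap.ext fun X => ?_
  ext i ⟨j, s⟩
  fin_cases s <;> simp [sR_apply]

theorem annihilation_apply (m n : ℕ) :
    annihilation m n = if n = m + 1 then ((Real.sqrt n : ℝ) : ℂ) else 0 := rfl

theorem creation_apply (m n : ℕ) :
    creation m n = if m = n + 1 then ((Real.sqrt m : ℝ) : ℂ) else 0 := by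
  simp only [creation, Matrix.conjTranspose_apply, annihilation_apply]
  split_ifs <;> simp

/-- Each row of a has a single nonzero entry, so the infinite sum reduces to the sum over the qubit
index. -/
theorem hasSum_annihilation_left (S : QubitOp) (X : TotOp) (i j) :
    HasSum (fun k => (annihilation ⊗ₖ S) i k * X k j) (aL (sL S X) i j) := by
  have h := hasSum_sum_of_ne_finset_zero (L := .unconditional _)
    (f := fun k => (annihilation ⊗ₖ S) i k * X k j) (s := {i.1 + 1} ×ˢ Finset.univ)
    (by
      rintro ⟨k, s⟩ hk
      have : k ≠ i.1 + 1 := fun h => hk (by simp [h])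
      simp [annihilation_apply, Matrix.kroneckerMap_apply, this])
  convert h using 1
  simp [aL_apply, sL_apply, annihilation_apply, Matrix.kroneckerMap_apply]
  ring

theorem hasSum_creation_left (S : QubitOp) (X : TotOp) (i j) :
    HasSum (fun k => (creation ⊗ₖ S) i k * X k j) (adL (sL S X) i j) := by
  obtain ⟨i, t⟩ := i
  have h := hasSum_sum_of_ne_finset_zero (L := .unconditional _)
    (f := fun k => (creation ⊗ₖ S) (i, t) k * X k j) (s := {i - 1} ×ˢ Finset.univ)
    (by
      rintro ⟨k, s⟩ hk
      have hk : k ≠ i - 1 := fun h => hk (by simp [h])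
      have : i ≠ k + 1 := by omega
      simp [creation_apply, Matrix.kroneckerMap_apply, this])
  convert h using 1
  -- For i = 0 the truncated `i - 1` is 0 rather than an absent index; the factor √0 in `adL`
  -- reproduces the vanishing row of a†.
  rcases i with _ | i
  · simp [adL_apply, creation_apply, Matrix.kroneckerMap_apply]
  · simp [adL_apply, sL_apply, creation_apply, Matrix.kroneckerMap_apply]
    ring

theorem hasSum_annihilation_right (S : QubitOp) (X : TotOp) (i j) :
    HasSum (fun k => X i k * (annihilation ⊗ₖ S) k j) (aR (sR S X) i j) := by
  obtain ⟨j, t⟩ := j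
  have h := hasSum_sum_of_ne_finset_zero (L := .unconditional _)
    (f := fun k => X i k * (annihilation ⊗ₖ S) k (j, t)) (s := {j - 1} ×ˢ Finset.univ)
    (by
      rintro ⟨k, s⟩ hk
      have hk : k ≠ j - 1 := fun h => hk (by simp [h])
      have : j ≠ k + 1 := by omega
      simp [annihilation_apply, Matrix.kroneckerMap_apply, this])
  convert h using 1
  rcases j with _ | j
  · simp [aR_apply, annihilation_apply, Matrix.kroneckerMap_apply]
  · simp [aR_apply, sR_apply, annihilation_apply, Matrix.kroneckerMap_apply]
    ring

theorem hasSum_creation_right (S : QubitOp) (X : TotOp) (i j) :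
    HasSum (fun k => X i k * (creation ⊗ₖ S) k j) (adR (sR S X) i j) := by
  have h := hasSum_sum_of_ne_finset_zero (L := .unconditional _)
    (f := fun k => X i k * (creation ⊗ₖ S) k j) (s := {j.1 + 1} ×ˢ Finset.univ)
    (by
      rintro ⟨k, s⟩ hk
      have : k ≠ j.1 + 1 := fun h => hk (by simp [h])
      simp [creation_apply, Matrix.kroneckerMap_apply, this])
  convert h using 1
  simp [adR_apply, sR_apply, creation_apply, Matrix.kroneckerMap_apply]
  ring

theorem opMul_annihilation_left (X : TotOp) :
    opMul (annihilation ⊗ₖ (1 : QubitOp)) X = aL X := by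
  ext i j
  exact (hasSum_annihilation_left 1 X i j).tsum_eq.trans (by rw [sL_one, Module.End.one_apply])

theorem opMul_creation_left (X : TotOp) : opMul (creation ⊗ₖ (1 : QubitOp)) X = adL X := by
  ext i j
  exact (hasSum_creation_left 1 X i j).tsum_eq.trans (by rw [sL_one, Module.End.one_apply])

theorem opMul_annihilation_right (X : TotOp) :
    opMul X (annihilation ⊗ₖ (1 : QubitOp)) = aR X := by
  ext i j
  exact (hasSum_annihilation_right 1 X i j).tsum_eq.trans (by rw [sR_one, Module.End.one_apply])

theorem opMul_creation_right (X : TotOp) : opMul X (creation ⊗ₖ (1 : QubitOp)) = adR X := by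
  ext i j
  exact (hasSum_creation_right 1 X i j).tsum_eq.trans (by rw [sR_one, Module.End.one_apply])

/-- Infinite products are not associative in general. A ladder operator on the outer side only
shifts and rescales rows or columns, so it passes through the sum without any summability
assumption. -/
theorem opMul_aL (X Y : TotOp) : opMul (aL X) Y = aL (opMul X Y) := by
  ext i j
  simp only [opMul, aL_apply, mul_assoc, tsum_mul_left]

theorem opMul_adL (X Y : TotOp) : opMul (adL X) Y = adL (opMul X Y) := by
  ext i j
  simp only [opMul, adL_apply, mul_assoc, tsum_mul_left]

theorem opMul_aR (X Y : TotOp) : opMul X (aR Y) = aR (opMul X Y) := by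
  ext i j
  simp only [opMul, aR_apply, mul_left_comm _ (Complex.ofReal _), tsum_mul_left]

theorem opMul_adR (X Y : TotOp) : opMul X (adR Y) = adR (opMul X Y) := by
  ext i j
  simp only [opMul, adR_apply, mul_left_comm _ (Complex.ofReal _), tsum_mul_left]

theorem conjTranspose_annihilation_kronecker :
    (annihilation ⊗ₖ (1 : QubitOp)).conjTranspose = creation ⊗ₖ (1 : QubitOp) := by
  rw [Matrix.conjTranspose_kronecker, Matrix.conjTranspose_one, creation]

theorem conjTranspose_creation_kronecker :
    (creation ⊗ₖ (1 : QubitOp)).conjTranspose = annihilation ⊗ₖ (1 : QubitOp) := by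
  rw [← conjTranspose_annihilation_kronecker, Matrix.conjTranspose_conjTranspose]

theorem number_kronecker :
    opMul creation annihilation ⊗ₖ (1 : QubitOp) = adL (annihilation ⊗ₖ (1 : QubitOp)) := by
  ext ⟨i, s⟩ ⟨j, t⟩
  have h : opMul creation annihilation i j = ((Real.sqrt (i : ℝ) : ℝ) : ℂ) *
      annihilation (i - 1) j := by
    rw [opMul, tsum_eq_single (i - 1)]
    · rcases i with _ | i <;> simp [creation_apply]
    · intro k hk
      have : i ≠ k + 1 := by omega
      simp [creation_apply, this]
  simp [Matrix.kroneckerMap_apply, adL_apply, h, mul_assoc]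

theorem adL_annihilation_kronecker :
    adL (annihilation ⊗ₖ (1 : QubitOp)) = aR (creation ⊗ₖ (1 : QubitOp)) := by
  rw [← opMul_creation_left, opMul_annihilation_right]

theorem aL_creation_kronecker :
    aL (creation ⊗ₖ (1 : QubitOp)) = adR (annihilation ⊗ₖ (1 : QubitOp)) := by
  rw [← opMul_annihilation_left, opMul_creation_right]

/-! ### The two generators as polynomials in ladder superoperators -/

theorem oscLindbladian_eq (γ Δ nth : ℝ) (X : TotOp) :
    oscLindbladian γ Δ nth X =
      ((-Complex.I * (Δ : ℂ)) • (adL * aL - aR * adR)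
        + ((γ * (1 + nth) : ℝ) : ℂ) • (aL * adR - (1 / 2 : ℂ) • (adL * aL + aR * adR))
        + ((γ * nth : ℝ) : ℂ) • (adL * aR - (1 / 2 : ℂ) • (aL * adL + adR * aR)) :
          Module.End ℂ TotOp) X := by
  simp only [oscLindbladian, opComm, opDissipator, conjTranspose_annihilation_kronecker,
    conjTranspose_creation_kronecker, number_kronecker]
  rw [opMul_adL, opMul_annihilation_left, opMul_creation_right, opMul_creation_left,
    opMul_annihilation_right, opMul_creation_left, opMul_annihilation_left,
    opMul_adL, opMul_aL, adL_annihilation_kronecker, aL_creation_kronecker, opMul_aR,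
    opMul_adR, opMul_annihilation_left, opMul_creation_left, opMul_creation_right,
    opMul_annihilation_right]
  have h (Y : TotOp) : adR (aL Y) = aL (adR Y) := by
    ext i j; simp only [aL_apply, adR_apply]; ring
  have h' (Y : TotOp) : aR (adL Y) = adL (aR Y) := by
    ext i j; simp only [adL_apply, aR_apply]; ring
  simp [h, h']

theorem interaction_eq (κ : ℝ) (X : TotOp) :
    interaction κ X = ((-Complex.I * (κ : ℂ)) •
      (adL * sL sigmaMinus + aL * sL sigmaPlus - adR * sR sigmaMinus - aR * sR sigmaPlus) :
        Module.End ℂ TotOp) X := by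
  have h1 : opMul (creation ⊗ₖ sigmaMinus + annihilation ⊗ₖ sigmaPlus) X
      = adL (sL sigmaMinus X) + aL (sL sigmaPlus X) := by
    ext i j
    have := ((hasSum_creation_left sigmaMinus X i j).add
      (hasSum_annihilation_left sigmaPlus X i j)).tsum_eq
    simpa only [opMul, Matrix.add_apply, add_mul] using this
  have h2 : opMul X (creation ⊗ₖ sigmaMinus + annihilation ⊗ₖ sigmaPlus)
      = adR (sR sigmaMinus X) + aR (sR sigmaPlus X) := by
    ext i j
    have := ((hasSum_creation_right sigmaMinus X i j).add
      (hasSum_annihilation_right sigmaPlus X i j)).tsum_eq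
    simpa only [opMul, Matrix.add_apply, mul_add] using this
  simp [interaction, opComm, h1, h2, sub_add_eq_sub_sub]

end AdiabaticElimination

namespace AdiabaticElimination

/-! ### Commutation relations -/

theorem aL_mul_adL : aL * adL = adL * aL + 1 := by
  refine LinearMap.ext fun X => ?_
  ext ⟨i, s⟩ j
  have h1 : ((Real.sqrt ((i : ℝ) + 1) : ℝ) : ℂ) * ((Real.sqrt ((i : ℝ) + 1) : ℝ) : ℂ) = i + 1 := by
    rw [← Complex.ofReal_mul, Real.mul_self_sqrt (by positivity)]; simp
  have h2 : ((Real.sqrt (i : ℝ) : ℝ) : ℂ) * ((Real.sqrt (i : ℝ) : ℝ) : ℂ) = i := by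
    rw [← Complex.ofReal_mul, Real.mul_self_sqrt (by positivity)]; simp
  rcases i with _ | i
  · simp [aL_apply, adL_apply]
  · simp only [Module.End.mul_apply, LinearMap.add_apply, Module.End.one_apply, Matrix.add_apply,
      aL_apply, adL_apply, Nat.add_sub_cancel, ← mul_assoc]
    push_cast at *
    rw [h1, h2]
    ring

/-- Right multiplication reverses the order of composition, so here `aR` plays the raising and `adR`
the lowering operator. -/
theorem adR_mul_aR : adR * aR = aR * adR + 1 := by
  refine LinearMap.ext fun X => ?_
  ext i ⟨j, t⟩
  have h1 : ((Real.sqrt ((j : ℝ) + 1) : ℝ) : ℂ) * ((Real.sqrt ((j : ℝ) + 1) : ℝ) : ℂ) = j + 1 := by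
    rw [← Complex.ofReal_mul, Real.mul_self_sqrt (by positivity)]; simp
  have h2 : ((Real.sqrt (j : ℝ) : ℝ) : ℂ) * ((Real.sqrt (j : ℝ) : ℝ) : ℂ) = j := by
    rw [← Complex.ofReal_mul, Real.mul_self_sqrt (by positivity)]; simp
  rcases j with _ | j
  · simp [aR_apply, adR_apply]
  · simp only [Module.End.mul_apply, LinearMap.add_apply, Module.End.one_apply, Matrix.add_apply,
      aR_apply, adR_apply, Nat.add_sub_cancel, ← mul_assoc]
    push_cast at *
    rw [h1, h2]
    ring

theorem aR_mul_aL : aR * aL = aL * aR :=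
  LinearMap.ext fun _ => funext₂ fun _ _ => mul_left_comm _ _ _

theorem adR_mul_aL : adR * aL = aL * adR :=
  LinearMap.ext fun _ => funext₂ fun _ _ => mul_left_comm _ _ _

theorem aR_mul_adL : aR * adL = adL * aR :=
  LinearMap.ext fun _ => funext₂ fun _ _ => mul_left_comm _ _ _

theorem adR_mul_adL : adR * adL = adL * adR :=
  LinearMap.ext fun _ => funext₂ fun _ _ => mul_left_comm _ _ _

theorem sL_mul_aL (S : QubitOp) : sL S * aL = aL * sL S := by
  refine LinearMap.ext fun X => ?_
  ext i j
  simp [sL_apply, aL_apply]; ring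

theorem sL_mul_adL (S : QubitOp) : sL S * adL = adL * sL S := by
  refine LinearMap.ext fun X => ?_
  ext i j
  simp [sL_apply, adL_apply]; ring

theorem sL_mul_aR (S : QubitOp) : sL S * aR = aR * sL S := by
  refine LinearMap.ext fun X => ?_
  ext i j
  simp [sL_apply, aR_apply]; ring

theorem sL_mul_adR (S : QubitOp) : sL S * adR = adR * sL S := by
  refine LinearMap.ext fun X => ?_
  ext i j
  simp [sL_apply, adR_apply]; ring

theorem sR_mul_aL (S : QubitOp) : sR S * aL = aL * sR S := by
  refine LinearMap.ext fun X => ?_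
  ext i j
  simp [sR_apply, aL_apply]; ring

theorem sR_mul_adL (S : QubitOp) : sR S * adL = adL * sR S := by
  refine LinearMap.ext fun X => ?_
  ext i j
  simp [sR_apply, adL_apply]; ring

theorem sR_mul_aR (S : QubitOp) : sR S * aR = aR * sR S := by
  refine LinearMap.ext fun X => ?_
  ext i j
  simp [sR_apply, aR_apply]; ring

theorem sR_mul_adR (S : QubitOp) : sR S * adR = adR * sR S := by
  refine LinearMap.ext fun X => ?_
  ext i j
  simp [sR_apply, adR_apply]; ring

/-- `X ↦ [X, a]`. -/
noncomputable def Dz : Module.End ℂ TotOp := aR - aL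

/-- `X ↦ [a†, X]`. -/
noncomputable def Dw : Module.End ℂ TotOp := adL - adR

/-- The operator that differentiates with respect to powers of `Dz` and kills the thermal state
of mean occupation `ν`. -/
noncomputable def dZ (ν : ℝ) : Module.End ℂ TotOp := adR - (ν : ℂ) • Dw

/-- The operator that differentiates with respect to powers of `Dw` and kills the thermal state
of mean occupation `ν`. -/
noncomputable def dW (ν : ℝ) : Module.End ℂ TotOp := aL - (ν : ℂ) • Dz

theorem Dw_mul_Dz : Dw * Dz = Dz * Dw := by
  simp only [Dw, Dz, mul_sub, sub_mul, aL_mul_adL, adR_mul_aR, aR_mul_adL, adR_mul_aL]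
  abel

/-- Subtracting a multiple of `Dw` does not disturb the canonical relation, since `Dw` commutes with
`Dz`. This freedom is what allows `dZ` to be chosen so that it kills the thermal state. -/
theorem dZ_mul_Dz (ν : ℝ) : dZ ν * Dz = Dz * dZ ν + 1 := by
  simp only [dZ, Dw, Dz, mul_sub, sub_mul, smul_mul_assoc, mul_smul_comm, aL_mul_adL, adR_mul_aR,
    aR_mul_adL, adR_mul_aL]
  module

theorem dZ_mul_Dw (ν : ℝ) : dZ ν * Dw = Dw * dZ ν := by
  simp only [dZ, Dw, mul_sub, sub_mul, smul_mul_assoc, mul_smul_comm, adR_mul_adL]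
  module

theorem dW_mul_Dw (ν : ℝ) : dW ν * Dw = Dw * dW ν + 1 := by
  simp only [dW, Dw, Dz, mul_sub, sub_mul, smul_mul_assoc, mul_smul_comm, aL_mul_adL, adR_mul_aR,
    aR_mul_adL, adR_mul_aL]
  module

theorem dW_mul_Dz (ν : ℝ) : dW ν * Dz = Dz * dW ν := by
  simp only [dW, Dz, mul_sub, sub_mul, smul_mul_assoc, mul_smul_comm, aR_mul_aL]
  module

theorem dW_mul_dZ (ν : ℝ) : dW ν * dZ ν = dZ ν * dW ν := by
  simp only [dW, dZ, Dw, Dz, mul_sub, sub_mul, smul_mul_assoc, mul_smul_comm, aL_mul_adL,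
    adR_mul_aR, aR_mul_adL, adR_mul_aL]
  module

/-- The decay rate `γ / 2 - i Δ` of `[ρ̄, a]`. -/
noncomputable def rateZ (γ Δ : ℝ) : ℂ := (γ : ℂ) / 2 - Complex.I * (Δ : ℂ)

/-- The decay rate `γ / 2 + i Δ` of `[a†, ρ̄]`. -/
noncomputable def rateW (γ Δ : ℝ) : ℂ := (γ : ℂ) / 2 + Complex.I * (Δ : ℂ)

/-- The oscillator generator as a linear map. -/
noncomputable def oscGen (γ Δ ν : ℝ) : Module.End ℂ TotOp :=
  (-rateZ γ Δ) • (Dz * dZ ν) + (-rateW γ Δ) • (Dw * dW ν)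

/-- The normal form: the dissipative generator is a combination of the number operators of two
independent Heisenberg pairs, so its eigenvalues can be read off. -/
theorem oscLindbladian_eq_oscGen (γ Δ ν : ℝ) (X : TotOp) :
    oscLindbladian γ Δ ν X = oscGen γ Δ ν X := by
  rw [oscLindbladian_eq]
  congr 1
  simp only [oscGen, rateZ, rateW, dZ, dW, Dw, Dz, mul_sub, sub_mul, mul_smul_comm,
    aL_mul_adL, adR_mul_aR, aR_mul_adL, adR_mul_aL]
  push_cast
  module

/-- `X ↦ ν σ₊ X - (1 + ν) X σ₊`. -/
noncomputable def alphaTot (ν : ℝ) : Module.End ℂ TotOp :=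
  (ν : ℂ) • sL sigmaPlus - (1 + ν : ℂ) • sR sigmaPlus

/-- `X ↦ (1 + ν) σ₋ X - ν X σ₋`. -/
noncomputable def betaTot (ν : ℝ) : Module.End ℂ TotOp :=
  (1 + ν : ℂ) • sL sigmaMinus - (ν : ℂ) • sR sigmaMinus

/-- The commutator with a qubit operator. -/
noncomputable def commTot (S : QubitOp) : Module.End ℂ TotOp := sL S - sR S

/-- The Jaynes-Cummings interaction as a linear map. -/
noncomputable def intGen (κ ν : ℝ) : Module.End ℂ TotOp :=
  (-Complex.I * (κ : ℂ)) • (Dz * alphaTot ν + Dw * betaTot ν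
    + dZ ν * commTot sigmaMinus + dW ν * commTot sigmaPlus)

/-- Substitute `aL` = `dW` + ν `Dz`, `aR` = `dW` + (1 + ν) `Dz`, `adR` = `dZ` + ν `Dw`, `adL` = `dZ`
+ (1 + ν) `Dw`. The terms with `Dz` or `Dw` in front vanish under the partial trace; the derivatives
come with plain commutators. -/
theorem interaction_eq_intGen (κ ν : ℝ) (X : TotOp) : interaction κ X = intGen κ ν X := by
  rw [interaction_eq, intGen]
  congr 2
  simp only [dZ, dW, Dw, Dz, alphaTot, betaTot, commTot, mul_sub, sub_mul, smul_mul_assoc,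
    mul_smul_comm]
  module

/-! ### Rapidly decreasing matrices -/

theorem RapidlyDecreasing.transpose {X : TotOp} (h : RapidlyDecreasing X) :
    RapidlyDecreasing X.transpose := fun p => by
  obtain ⟨C, hC⟩ := h p
  exact ⟨C, fun i j => by rw [Matrix.transpose_apply, mul_comm (_ ^ p)]; exact hC j i⟩

theorem RapidlyDecreasing.add {X Y : TotOp} (hX : RapidlyDecreasing X)
    (hY : RapidlyDecreasing Y) : RapidlyDecreasing (X + Y) := fun p => by
  obtain ⟨C, hC⟩ := hX p
  obtain ⟨D, hD⟩ := hY p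
  refine ⟨C + D, fun i j => ?_⟩
  refine le_trans ?_ (add_le_add (hC i j) (hD i j))
  rw [← mul_add]
  gcongr
  exact norm_add_le _ _

theorem RapidlyDecreasing.smul {X : TotOp} (c : ℂ) (hX : RapidlyDecreasing X) :
    RapidlyDecreasing (c • X) := fun p => by
  obtain ⟨C, hC⟩ := hX p
  refine ⟨‖c‖ * C, fun i j => ?_⟩
  rw [Matrix.smul_apply, norm_smul, mul_left_comm]
  exact mul_le_mul_of_nonneg_left (hC i j) (norm_nonneg c)

/-- The space of rapidly decreasing matrices. -/
def rapid : Submodule ℂ TotOp where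
  carrier := {X | RapidlyDecreasing X}
  add_mem' := RapidlyDecreasing.add
  zero_mem' := fun _ => ⟨0, fun _ _ => by simp⟩
  smul_mem' c _ h := h.smul c

theorem aL_mem_rapid {X : TotOp} (h : X ∈ rapid) : aL X ∈ rapid := fun p => by
  -- One extra power of decay pays for the factor √(i + 1).
  obtain ⟨C, hC⟩ := h (p + 1)
  refine ⟨C, fun i j => le_trans ?_ (hC (i.1 + 1, i.2) j)⟩
  have h1 : Real.sqrt ((i.1 : ℝ) + 1) ≤ (i.1 : ℝ) + 1 :=
    (Real.sqrt_le_left (by positivity)).mpr (by nlinarith [(Nat.cast_nonneg i.1 : (0 : ℝ) ≤ i.1)])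
  rw [aL_apply, norm_mul, Complex.norm_real, Real.norm_of_nonneg (Real.sqrt_nonneg _)]
  push_cast
  calc ((i.1 : ℝ) + 1) ^ p * ((j.1 : ℝ) + 1) ^ p * (Real.sqrt ((i.1 : ℝ) + 1)
        * ‖X (i.1 + 1, i.2) j‖)
      ≤ ((i.1 : ℝ) + 1) ^ p * ((j.1 : ℝ) + 1) ^ p * (((i.1 : ℝ) + 1) * ‖X (i.1 + 1, i.2) j‖) := by
        gcongr
    _ = ((i.1 : ℝ) + 1) ^ (p + 1) * ((j.1 : ℝ) + 1) ^ p * ‖X (i.1 + 1, i.2) j‖ := by ring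
    _ ≤ ((i.1 : ℝ) + 1 + 1) ^ (p + 1) * ((j.1 : ℝ) + 1) ^ (p + 1) * ‖X (i.1 + 1, i.2) j‖ := by
        gcongr
        · linarith
        · linarith [(Nat.cast_nonneg j.1 : (0 : ℝ) ≤ j.1)]
        · omega

theorem adL_mem_rapid {X : TotOp} (h : X ∈ rapid) : adL X ∈ rapid := fun p => by
  obtain ⟨C, hC⟩ := h (p + 1)
  -- The factor 2ᵖ comes from the index shift: i + 2 ≤ 2 (i + 1).
  refine ⟨2 ^ p * C, ?_⟩
  rintro ⟨i, s⟩ j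
  rcases i with _ | i
  · have := hC (0, s) j
    simp only [adL_apply, Nat.cast_zero, Real.sqrt_zero, Complex.ofReal_zero, zero_mul, norm_zero,
      mul_zero]
    exact mul_nonneg (by positivity) (le_trans (by positivity) this)
  · refine le_trans ?_ (mul_le_mul_of_nonneg_left (hC (i, s) j) (by positivity))
    have h1 : Real.sqrt ((i : ℝ) + 1) ≤ (i : ℝ) + 1 :=
      (Real.sqrt_le_left (by positivity)).mpr (by nlinarith [(Nat.cast_nonneg i : (0 : ℝ) ≤ i)])
    rw [adL_apply, norm_mul, Complex.norm_real, Real.norm_of_nonneg (Real.sqrt_nonneg _)]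
    simp only [Nat.add_sub_cancel]
    push_cast
    calc ((i : ℝ) + 1 + 1) ^ p * ((j.1 : ℝ) + 1) ^ p * (Real.sqrt ((i : ℝ) + 1) * ‖X (i, s) j‖)
        ≤ (2 * ((i : ℝ) + 1)) ^ p * ((j.1 : ℝ) + 1) ^ (p + 1)
            * (((i : ℝ) + 1) * ‖X (i, s) j‖) := by
          gcongr
          · linarith
          · linarith [(Nat.cast_nonneg j.1 : (0 : ℝ) ≤ j.1)]
          · omega
      _ = 2 ^ p * (((i : ℝ) + 1) ^ (p + 1) * ((j.1 : ℝ) + 1) ^ (p + 1) * ‖X (i, s) j‖) := by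
          rw [mul_pow]; ring

theorem aR_mem_rapid {X : TotOp} (h : X ∈ rapid) : aR X ∈ rapid :=
  RapidlyDecreasing.transpose (adL_mem_rapid (RapidlyDecreasing.transpose h))

theorem adR_mem_rapid {X : TotOp} (h : X ∈ rapid) : adR X ∈ rapid :=
  RapidlyDecreasing.transpose (aL_mem_rapid (RapidlyDecreasing.transpose h))

theorem sL_mem_rapid (S : QubitOp) {X : TotOp} (h : X ∈ rapid) : sL S X ∈ rapid := fun p => by
  obtain ⟨C, hC⟩ := h p
  refine ⟨∑ s, ∑ t, ‖S t s‖ * C, fun i j => ?_⟩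
  rw [sL_apply]
  refine (mul_le_mul_of_nonneg_left (norm_sum_le _ _) (by positivity)).trans ?_
  rw [Finset.mul_sum]
  refine Finset.sum_le_sum fun s _ => ?_
  have hC0 : 0 ≤ C := le_trans (by positivity) (hC i j)
  refine le_trans ?_ (Finset.single_le_sum (f := fun t => ‖S t s‖ * C)
    (fun t _ => by positivity) (Finset.mem_univ i.2))
  rw [norm_mul, mul_left_comm]
  exact mul_le_mul_of_nonneg_left (hC (i.1, s) j) (norm_nonneg _)

theorem sR_mem_rapid (S : QubitOp) {X : TotOp} (h : X ∈ rapid) : sR S X ∈ rapid := by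
  have : sR S X = Matrix.transpose (sL S.transpose X.transpose) := by
    ext i j
    simp [sL_apply, sR_apply, mul_comm]
  rw [this]
  exact RapidlyDecreasing.transpose (sL_mem_rapid _ (RapidlyDecreasing.transpose h))

theorem Dz_mem_rapid {X : TotOp} (h : X ∈ rapid) : Dz X ∈ rapid :=
  rapid.sub_mem (aR_mem_rapid h) (aL_mem_rapid h)

theorem Dw_mem_rapid {X : TotOp} (h : X ∈ rapid) : Dw X ∈ rapid :=
  rapid.sub_mem (adL_mem_rapid h) (adR_mem_rapid h)

theorem dZ_mem_rapid (ν : ℝ) {X : TotOp} (h : X ∈ rapid) : dZ ν X ∈ rapid :=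
  rapid.sub_mem (adR_mem_rapid h) (rapid.smul_mem _ (Dw_mem_rapid h))

theorem dW_mem_rapid (ν : ℝ) {X : TotOp} (h : X ∈ rapid) : dW ν X ∈ rapid :=
  rapid.sub_mem (aL_mem_rapid h) (rapid.smul_mem _ (Dz_mem_rapid h))

theorem alphaTot_mem_rapid (ν : ℝ) {X : TotOp} (h : X ∈ rapid) : alphaTot ν X ∈ rapid :=
  rapid.sub_mem (rapid.smul_mem _ (sL_mem_rapid _ h)) (rapid.smul_mem _ (sR_mem_rapid _ h))

theorem betaTot_mem_rapid (ν : ℝ) {X : TotOp} (h : X ∈ rapid) : betaTot ν X ∈ rapid :=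
  rapid.sub_mem (rapid.smul_mem _ (sL_mem_rapid _ h)) (rapid.smul_mem _ (sR_mem_rapid _ h))

/-! ### The partial trace on rapidly decreasing matrices -/

theorem summable_of_mem_rapid {X : TotOp} (h : X ∈ rapid) (s t : Fin 2) :
    Summable fun n : ℕ => X (n, s) (n, t) := by
  obtain ⟨C, hC⟩ := h 1
  have h2 : Summable fun n : ℕ => C * (1 / ((n + 1 : ℕ) : ℝ) ^ 2) :=
    ((summable_nat_add_iff 1).mpr (Real.summable_one_div_nat_pow.mpr one_lt_two)).mul_left C
  refine Summable.of_norm_bounded h2 fun n => ?_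
  have := hC (n, s) (n, t)
  have hn : (0 : ℝ) < (n : ℝ) + 1 := by positivity
  push_cast
  rw [mul_one_div, le_div_iff₀ (by positivity)]
  simp only [pow_one] at this
  nlinarith

theorem traceA_add {X Y : TotOp} (hX : X ∈ rapid) (hY : Y ∈ rapid) :
    traceA (X + Y) = traceA X + traceA Y := by
  ext s t
  exact (summable_of_mem_rapid hX s t).tsum_add (summable_of_mem_rapid hY s t)

theorem traceA_smul (c : ℂ) (X : TotOp) : traceA (c • X) = c • traceA X := by
  ext s t
  exact tsum_mul_left

/-- A linear map that extends the partial trace of rapidly decreasing matrices. -/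
theorem exists_linear_traceA :
    ∃ τ : TotOp →ₗ[ℂ] QubitOp, ∀ X ∈ rapid, τ X = traceA X := by
  let f : rapid →ₗ[ℂ] QubitOp :=
    { toFun := fun X => traceA X
      map_add' := fun X Y => traceA_add X.2 Y.2
      map_smul' := fun c X => traceA_smul c X }
  obtain ⟨τ, hτ⟩ := f.exists_extend
  exact ⟨τ, fun X hX => congrArg (fun g => g ⟨X, hX⟩) hτ⟩

/-- The partial trace as a linear map; it has a meaning for rapidly decreasing matrices only. -/
noncomputable def trLin : TotOp →ₗ[ℂ] QubitOp := exists_linear_traceA.choose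

theorem trLin_apply {X : TotOp} (h : X ∈ rapid) : trLin X = traceA X :=
  exists_linear_traceA.choose_spec X h

/-- Cyclicity of the trace: the diagonal series of X a and a X have the same terms up to a shift by
one, the extra term at n = 0 carrying √0. The decay of X makes both series converge. -/
theorem trLin_Dz {X : TotOp} (h : X ∈ rapid) : trLin (Dz X) = 0 := by
  have h1 := aR_mem_rapid h
  have h2 := aL_mem_rapid h
  rw [Dz, LinearMap.sub_apply, map_sub, trLin_apply h1, trLin_apply h2, sub_eq_zero]
  ext s t
  rw [traceA, (summable_of_mem_rapid h1 s t).tsum_eq_zero_add]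
  simp [traceA, aR_apply, aL_apply]

theorem trLin_Dw {X : TotOp} (h : X ∈ rapid) : trLin (Dw X) = 0 := by
  have h1 := adL_mem_rapid h
  have h2 := adR_mem_rapid h
  rw [Dw, LinearMap.sub_apply, map_sub, trLin_apply h1, trLin_apply h2, sub_eq_zero]
  ext s t
  rw [traceA, (summable_of_mem_rapid h1 s t).tsum_eq_zero_add]
  simp [traceA, adR_apply, adL_apply]

theorem trLin_oscGen (γ Δ ν : ℝ) {X : TotOp} (h : X ∈ rapid) : trLin (oscGen γ Δ ν X) = 0 := by
  simp [oscGen, trLin_Dz (dZ_mem_rapid ν h), trLin_Dw (dW_mem_rapid ν h)]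

/-! ### The thermal state -/

/-- `X ↦ ρ̄ ⊗ X` as a linear map. -/
noncomputable def thermalTensor (ν : ℝ) : QubitOp →ₗ[ℂ] TotOp where
  toFun X := thermalState ν ⊗ₖ X
  map_add' := Matrix.kronecker_add _
  map_smul' c X := Matrix.kronecker_smul c _ X

theorem thermalTensor_apply (ν : ℝ) (X : QubitOp) (i j : ℕ × Fin 2) :
    thermalTensor ν X i j = if i.1 = j.1 then
      (((ν / (1 + ν)) ^ i.1 / ∑' k : ℕ, (ν / (1 + ν)) ^ k : ℝ) : ℂ) * X i.2 j.2 else 0 := by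
  change thermalState ν i.1 j.1 * X i.2 j.2 = _
  rw [thermalState, Matrix.diagonal_apply]
  split_ifs <;> simp

theorem ratio_mem {ν : ℝ} (hν : 0 < ν) : 0 < ν / (1 + ν) ∧ ν / (1 + ν) < 1 :=
  ⟨by positivity, by rw [div_lt_one (by positivity)]; linarith⟩

theorem tsum_ratio_pos {ν : ℝ} (hν : 0 < ν) : 0 < ∑' k : ℕ, (ν / (1 + ν)) ^ k := by
  obtain ⟨h0, h1⟩ := ratio_mem hν
  rw [tsum_geometric_of_lt_one h0.le h1]
  exact inv_pos.mpr (sub_pos.mpr h1)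

theorem dW_thermalTensor {ν : ℝ} (hν : 0 < ν) (X : QubitOp) :
    dW ν (thermalTensor ν X) = 0 := by
  -- Detailed balance, (1 + ν) r = ν, is exactly what makes the two neighbouring thermal weights
  -- cancel.
  have hr : ((ν : ℂ) + 1) * (ν / (1 + ν)) = ν := by
    have : (1 + ν : ℂ) ≠ 0 := by exact_mod_cast (by positivity : (1 + ν) ≠ 0)
    field_simp; ring
  ext ⟨i, s⟩ ⟨j, t⟩
  simp only [dW, Dz, LinearMap.sub_apply, LinearMap.smul_apply, Matrix.sub_apply,
    Matrix.smul_apply, aL_apply, aR_apply, thermalTensor_apply, Matrix.zero_apply, smul_eq_mul]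
  rcases j with _ | j
  · simp
  · by_cases h : i = j
    · subst h
      simp only [Nat.add_sub_cancel, if_true, pow_succ]
      push_cast
      linear_combination (Real.sqrt ((i : ℝ) + 1) : ℂ) * (((ν : ℂ) / (1 + ν)) ^ i
        / ∑' k : ℕ, ((ν : ℂ) / (1 + ν)) ^ k) * X s t * hr
    · simp [h]

theorem dZ_thermalTensor {ν : ℝ} (hν : 0 < ν) (X : QubitOp) :
    dZ ν (thermalTensor ν X) = 0 := by
  have hr : ((ν : ℂ) + 1) * (ν / (1 + ν)) = ν := by
    have : (1 + ν : ℂ) ≠ 0 := by exact_mod_cast (by positivity : (1 + ν) ≠ 0)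
    field_simp; ring
  ext ⟨i, s⟩ ⟨j, t⟩
  simp only [dZ, Dw, LinearMap.sub_apply, LinearMap.smul_apply, Matrix.sub_apply,
    Matrix.smul_apply, adL_apply, adR_apply, thermalTensor_apply, Matrix.zero_apply, smul_eq_mul]
  rcases i with _ | i
  · simp
  · by_cases h : i = j
    · subst h
      simp only [Nat.add_sub_cancel, if_true, pow_succ]
      push_cast
      linear_combination (Real.sqrt ((i : ℝ) + 1) : ℂ) * (((ν : ℂ) / (1 + ν)) ^ i
        / ∑' k : ℕ, ((ν : ℂ) / (1 + ν)) ^ k) * X s t * hr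
    · simp [h]

theorem thermalTensor_mem_rapid {ν : ℝ} (hν : 0 < ν) (X : QubitOp) :
    thermalTensor ν X ∈ rapid := fun p => by
  obtain ⟨h0, h1⟩ := ratio_mem hν
  have hs := tsum_ratio_pos hν
  set r := ν / (1 + ν)
  -- Both indices agree on the diagonal, hence the power 2p. The bound is used at n = i + 1, which
  -- leaves a spare factor r and explains C / r below.
  have hlim : Filter.Tendsto (fun n : ℕ => (n : ℝ) ^ (2 * p) * r ^ n) Filter.atTop (nhds 0) :=
    tendsto_pow_const_mul_const_pow_of_abs_lt_one _ (by rwa [abs_of_pos h0])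
  obtain ⟨C, hC⟩ := ((Filter.tendsto_add_atTop_iff_nat 1).mpr hlim).bddAbove_range
  have hC0 : 0 ≤ C := le_trans (by positivity) (hC ⟨0, rfl⟩)
  refine ⟨C / r / (∑' k : ℕ, r ^ k) * ∑ s, ∑ t, ‖X s t‖, ?_⟩
  rintro ⟨i, s⟩ ⟨j, t⟩
  rw [thermalTensor_apply]
  split_ifs with h
  · obtain rfl : i = j := h
    have h2 : ‖X s t‖ ≤ ∑ s, ∑ t, ‖X s t‖ :=
      (Finset.single_le_sum (f := fun t => ‖X s t‖) (fun _ _ => norm_nonneg _)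
        (Finset.mem_univ t)).trans
        (Finset.single_le_sum (f := fun s => ∑ t, ‖X s t‖)
          (fun _ _ => Finset.sum_nonneg fun _ _ => norm_nonneg _) (Finset.mem_univ s))
    have h3 : ((i : ℝ) + 1) ^ (2 * p) * r ^ i ≤ C / r := by
      rw [le_div_iff₀ h0, mul_assoc, ← pow_succ]
      have := hC ⟨i, rfl⟩
      push_cast at this
      exact this
    rw [norm_mul, Complex.norm_real, Real.norm_of_nonneg (by positivity)]
    calc ((i : ℝ) + 1) ^ p * ((i : ℝ) + 1) ^ p * (r ^ i / (∑' k : ℕ, r ^ k) * ‖X s t‖)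
        = (((i : ℝ) + 1) ^ (2 * p) * r ^ i) / (∑' k : ℕ, r ^ k) * ‖X s t‖ := by ring
      _ ≤ _ := by gcongr
  · rw [norm_zero, mul_zero]
    positivity

theorem trLin_thermalTensor {ν : ℝ} (hν : 0 < ν) (X : QubitOp) :
    trLin (thermalTensor ν X) = X := by
  rw [trLin_apply (thermalTensor_mem_rapid hν X)]
  ext s t
  simp only [traceA, thermalTensor_apply, if_true]
  rw [tsum_mul_right, ← Complex.ofReal_tsum, tsum_div_const, div_self (tsum_ratio_pos hν).ne',
    Complex.ofReal_one, one_mul]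

theorem oscGen_thermalTensor (γ Δ : ℝ) {ν : ℝ} (hν : 0 < ν) (X : QubitOp) :
    oscGen γ Δ ν (thermalTensor ν X) = 0 := by
  simp [oscGen, dZ_thermalTensor hν, dW_thermalTensor hν]

end AdiabaticElimination

namespace AdiabaticElimination

/-! ### The kernel of the oscillator generator -/

/-- A summable solution of a birth-death type inequality with strict damping vanishes. -/
theorem eq_zero_of_damped {u a m : ℕ → ℝ} {A B : ℝ} (hA : 0 < A) (hB : 0 ≤ B)
    (hu : ∀ k, 0 ≤ u k) (ha0 : a 0 = 0) (ham : ∀ k, a k < m k)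
    (hs1 : Summable fun k => a k * u k) (hs2 : Summable fun k => a (k + 1) * u k)
    (hs3 : Summable fun k => m k * u k) (hs4 : Summable fun k => m (k + 1) * u k)
    (h : ∀ k, (A * m k + B * m (k + 1)) * u k
      ≤ A * (a (k + 1) * u (k + 1)) + B * (a k * u (k - 1))) (k : ℕ) : u k = 0 := by
  -- At k = 0 the truncated `k - 1` produces u 0, which is harmless because a 0 = 0.
  have hs5 : Summable fun k => a k * u (k - 1) := by
    rw [← summable_nat_add_iff 1]; simpa using hs2
  have e1 : ∑' k, a (k + 1) * u (k + 1) = ∑' k, a k * u k := by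
    rw [hs1.tsum_eq_zero_add]; simp [ha0]
  have e2 : ∑' k, a k * u (k - 1) = ∑' k, a (k + 1) * u k := by
    rw [hs5.tsum_eq_zero_add]; simp [ha0]
  have hs1' : Summable fun k => a (k + 1) * u (k + 1) := (summable_nat_add_iff 1).mpr hs1
  -- Summing the inequality over k and shifting indices turns the gain terms into the loss terms
  -- with m replaced by the smaller a. A sum of nonnegative terms is then at most 0, so each term
  -- vanishes.
  have key : ∑' k, (A * (m k * u k) + B * (m (k + 1) * u k))
      ≤ ∑' k, (A * (a (k + 1) * u (k + 1)) + B * (a k * u (k - 1))) := by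
    refine Summable.tsum_le_tsum (fun k => le_trans (le_of_eq (by ring)) (h k)) ?_ ?_
    · exact (hs3.mul_left A).add (hs4.mul_left B)
    · exact (hs1'.mul_left A).add (hs5.mul_left B)
  have hsum : Summable fun k => A * (m k * u k - a k * u k)
      + B * (m (k + 1) * u k - a (k + 1) * u k) :=
    ((hs3.sub hs1).mul_left A).add ((hs4.sub hs2).mul_left B)
  have hle : ∑' k, (A * (m k * u k - a k * u k) + B * (m (k + 1) * u k - a (k + 1) * u k)) ≤ 0 := by
    rw [((hs3.mul_left A)).tsum_add (hs4.mul_left B),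
      (hs1'.mul_left A).tsum_add (hs5.mul_left B)] at key
    rw [((hs3.sub hs1).mul_left A).tsum_add ((hs4.sub hs2).mul_left B)]
    simp only [tsum_mul_left, hs3.tsum_sub hs1, hs4.tsum_sub hs2, e1, e2] at key ⊢
    linarith
  have hnn : ∀ k, 0 ≤ A * (m k * u k - a k * u k) + B * (m (k + 1) * u k - a (k + 1) * u k) := by
    intro k
    rw [← sub_mul, ← sub_mul]
    have := ham k
    have := ham (k + 1)
    have := hu k
    exact add_nonneg (mul_nonneg hA.le (mul_nonneg (by linarith) this))
      (mul_nonneg hB (mul_nonneg (by linarith) this))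
  have hz := (hsum.le_tsum k fun j _ => hnn j).trans hle
  rw [← sub_mul, ← sub_mul] at hz
  have h1 := ham k
  have h2 := ham (k + 1)
  have h3 := hu k
  by_contra hne
  have h4 : 0 < u k := lt_of_le_of_ne h3 (Ne.symm hne)
  have := mul_pos hA (mul_pos (sub_pos.mpr h1) h4)
  have := mul_nonneg hB (mul_pos (sub_pos.mpr h2) h4).le
  linarith

theorem sqrt_mul_sqrt_lt {x y : ℝ} (hx : 0 ≤ x) (hy : 0 ≤ y) (h : x ≠ y) :
    Real.sqrt x * Real.sqrt y < (x + y) / 2 := by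
  have h1 := Real.sq_sqrt hx
  have h2 := Real.sq_sqrt hy
  have h3 : Real.sqrt x - Real.sqrt y ≠ 0 := fun h0 => h (by
    rw [← h1, ← h2, sub_eq_zero.mp h0])
  nlinarith [sq_pos_of_ne_zero h3]

/-- The generator couples only entries with the same i - j, which reduces the kernel equation to
independent birth-death chains. -/
theorem oscGen_apply (γ Δ ν : ℝ) (X : TotOp) (i j : ℕ) (s t : Fin 2) :
    oscGen γ Δ ν X (i, s) (j, t) =
      ((γ * (1 + ν) : ℝ) : ℂ) * ((Real.sqrt ((i : ℝ) + 1) * Real.sqrt ((j : ℝ) + 1) : ℝ) : ℂ)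
          * X (i + 1, s) (j + 1, t)
        + ((γ * ν : ℝ) : ℂ) * ((Real.sqrt (i : ℝ) * Real.sqrt (j : ℝ) : ℝ) : ℂ)
          * X (i - 1, s) (j - 1, t)
        - (((γ * (1 + ν) * ((i + j) / 2) + γ * ν * ((i + j) / 2 + 1) : ℝ) : ℂ)
          + Complex.I * (Δ * ((i : ℂ) - j))) * X (i, s) (j, t) := by
  have h1 (x : ℕ) : ((Real.sqrt ((x : ℝ) + 1) : ℝ) : ℂ) * ((Real.sqrt ((x : ℝ) + 1) : ℝ) : ℂ)
      = x + 1 := by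
    rw [← Complex.ofReal_mul, Real.mul_self_sqrt (by positivity)]; simp
  have hL : (aL * adL) X (i, s) (j, t) = ((i : ℂ) + 1) * X (i, s) (j, t) := by
    simp only [Module.End.mul_apply, aL_apply, adL_apply, Nat.add_sub_cancel, ← mul_assoc]
    push_cast
    rw [h1]
  have hR : (adR * aR) X (i, s) (j, t) = ((j : ℂ) + 1) * X (i, s) (j, t) := by
    simp only [Module.End.mul_apply, aR_apply, adR_apply, Nat.add_sub_cancel, ← mul_assoc]
    push_cast
    rw [h1]
  have hL' : (adL * aL) X (i, s) (j, t) = (i : ℂ) * X (i, s) (j, t) := by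
    rw [aL_mul_adL] at hL
    simp only [LinearMap.add_apply, Matrix.add_apply, Module.End.one_apply] at hL
    linear_combination hL
  have hR' : (aR * adR) X (i, s) (j, t) = (j : ℂ) * X (i, s) (j, t) := by
    rw [adR_mul_aR] at hR
    simp only [LinearMap.add_apply, Matrix.add_apply, Module.End.one_apply] at hR
    linear_combination hR
  rw [← oscLindbladian_eq_oscGen, oscLindbladian_eq]
  simp only [LinearMap.add_apply, LinearMap.sub_apply, LinearMap.smul_apply, Matrix.add_apply,
    Matrix.sub_apply, Matrix.smul_apply, smul_eq_mul, hL, hR, hL', hR']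
  simp only [Module.End.mul_apply, aL_apply, adL_apply, aR_apply, adR_apply]
  push_cast
  ring

theorem summable_mul_norm_of_mem_rapid {X : TotOp} (h : X ∈ rapid) (i j : ℕ) (s t : Fin 2)
    {c : ℕ → ℝ} {D : ℝ} (hc0 : ∀ k, 0 ≤ c k) (hc : ∀ k, c k ≤ D * ((k : ℝ) + 1)) :
    Summable fun k : ℕ => c k * ‖X (i + k, s) (j + k, t)‖ := by
  obtain ⟨C, hC⟩ := h 2
  have h2 : Summable fun n : ℕ => D * C * (1 / ((n + 1 : ℕ) : ℝ) ^ 3) :=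
    ((summable_nat_add_iff 1).mpr
      (Real.summable_one_div_nat_pow.mpr (by norm_num : 1 < 3))).mul_left _
  have hD : 0 ≤ D := by have := (hc0 0).trans (hc 0); simpa using this
  refine Summable.of_nonneg_of_le (fun k => mul_nonneg (hc0 k) (norm_nonneg _)) (fun k => ?_) h2
  have h3 := hC (i + k, s) (j + k, t)
  have hk : (0 : ℝ) < (k : ℝ) + 1 := by positivity
  push_cast at h3 ⊢
  rw [mul_one_div, le_div_iff₀ (by positivity)]
  have h4 : ((k : ℝ) + 1) ^ 2 * ((k : ℝ) + 1) ^ 2 * ‖X (i + k, s) (j + k, t)‖ ≤ C := by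
    refine le_trans ?_ h3
    gcongr <;> simp
  calc c k * ‖X (i + k, s) (j + k, t)‖ * ((k : ℝ) + 1) ^ 3
      ≤ D * ((k : ℝ) + 1) * ‖X (i + k, s) (j + k, t)‖ * ((k : ℝ) + 1) ^ 3 := by
        gcongr; exact hc k
    _ = D * (((k : ℝ) + 1) ^ 2 * ((k : ℝ) + 1) ^ 2 * ‖X (i + k, s) (j + k, t)‖) := by ring
    _ ≤ D * C := by gcongr

/-- Along a chain i - j = const ≠ 0 the gain coefficients are geometric means √(ij) and the loss
coefficients arithmetic means (i + j)/2, strictly larger. The moduli therefore satisfy the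
hypotheses of `eq_zero_of_damped`; starting the chain at the edge gives a 0 = 0. -/
theorem offDiagonal_eq_zero {γ Δ ν : ℝ} (hγ : 0 < γ) (hν : 0 < ν) {X : TotOp} (hX : X ∈ rapid)
    (h0 : oscGen γ Δ ν X = 0) (i j : ℕ) (s t : Fin 2) (hij : i ≠ j) (hmin : i = 0 ∨ j = 0)
    (k : ℕ) : X (i + k, s) (j + k, t) = 0 := by
  set A := γ * (1 + ν) with hAdef
  set B := γ * ν with hBdef
  have hA : 0 < A := by positivity
  have hB : 0 < B := by positivity
  let u : ℕ → ℝ := fun k => ‖X (i + k, s) (j + k, t)‖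
  let a : ℕ → ℝ := fun k => Real.sqrt ((i : ℝ) + k) * Real.sqrt ((j : ℝ) + k)
  let m : ℕ → ℝ := fun k => ((i : ℝ) + k + (j + k)) / 2
  have ham : ∀ k, a k < m k := fun k =>
    sqrt_mul_sqrt_lt (by positivity) (by positivity) (by simpa using hij)
  have ha : ∀ k, 0 ≤ a k := fun k => by positivity
  have hm : ∀ k, m k ≤ ((i : ℝ) + j + 1) * ((k : ℝ) + 1) := fun k => by
    simp only [m]
    have : (0 : ℝ) ≤ i := Nat.cast_nonneg i
    have : (0 : ℝ) ≤ j := Nat.cast_nonneg j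
    have : (0 : ℝ) ≤ k := Nat.cast_nonneg k
    nlinarith [mul_nonneg (add_nonneg ‹(0 : ℝ) ≤ i› ‹(0 : ℝ) ≤ j›) ‹(0 : ℝ) ≤ k›]
  have hm' : ∀ k, m (k + 1) ≤ (2 * ((i : ℝ) + j + 1)) * ((k : ℝ) + 1) := fun k => by
    refine (hm (k + 1)).trans ?_
    push_cast
    have : (0 : ℝ) ≤ k := Nat.cast_nonneg k
    have h : (0 : ℝ) ≤ (i : ℝ) + j + 1 := by positivity
    nlinarith [mul_nonneg h this]
  have hu : u k = 0 := by
    refine eq_zero_of_damped (a := a) (m := m) hA hB.le (fun k => norm_nonneg _) ?_ ham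
      (summable_mul_norm_of_mem_rapid hX i j s t ha fun k => (ham k).le.trans (hm k))
      (summable_mul_norm_of_mem_rapid hX i j s t (fun k => ha _)
        fun k => (ham (k + 1)).le.trans (hm' k))
      (summable_mul_norm_of_mem_rapid hX i j s t (fun k => (ha k).trans (ham k).le) hm)
      (summable_mul_norm_of_mem_rapid hX i j s t (fun k => (ha _).trans (ham _).le) hm') ?_ k
    · simp only [a]
      rcases hmin with h | h <;> simp [h]
    · intro k
      have he := congrFun (congrFun h0 (i + k, s)) (j + k, t)
      rw [oscGen_apply, Matrix.zero_apply, sub_eq_zero, ← hAdef, ← hBdef] at he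
      have hu1 : u (k + 1) = ‖X (i + k + 1, s) (j + k + 1, t)‖ := rfl
      have ha1 : a (k + 1) = Real.sqrt (((i + k : ℕ) : ℝ) + 1) * Real.sqrt (((j + k : ℕ) : ℝ) + 1) := by
        simp only [a]; push_cast; simp only [add_assoc]
      have ha2 : a k = Real.sqrt ((i + k : ℕ) : ℝ) * Real.sqrt ((j + k : ℕ) : ℝ) := by
        simp only [a]; push_cast; rfl
      have hx : a k * u (k - 1) = a k * ‖X (i + k - 1, s) (j + k - 1, t)‖ := by
        rcases k with _ | k
        · have : a 0 = 0 := by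
            simp only [a]
            rcases hmin with h | h <;> simp [h]
          simp [this]
        · rfl
      -- The detuning contributes only an imaginary part to the loss coefficient, so it can only
      -- increase its modulus.
      have hc : A * m k + B * m (k + 1) ≤
          ‖((A * ((((i + k : ℕ) : ℝ) + ((j + k : ℕ) : ℝ)) / 2)
            + B * ((((i + k : ℕ) : ℝ) + ((j + k : ℕ) : ℝ)) / 2 + 1) : ℝ) : ℂ)
            + Complex.I * (Δ * (((i + k : ℕ) : ℂ) - ((j + k : ℕ) : ℂ)))‖ := by
        refine le_trans (le_of_eq ?_) (Complex.re_le_norm _)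
        simp [m]
        left
        ring
      calc (A * m k + B * m (k + 1)) * u k ≤ _ := mul_le_mul_of_nonneg_right hc (norm_nonneg _)
        _ = ‖_‖ := (norm_mul _ _).symm
        _ = _ := by rw [← he]
        _ ≤ _ := norm_add_le _ _
        _ = A * (a (k + 1) * u (k + 1)) + B * (a k * u (k - 1)) := by
          rw [hx, hu1, ha1, ha2]
          simp only [norm_mul, Complex.norm_real, Real.norm_of_nonneg hA.le,
            Real.norm_of_nonneg hB.le, Real.norm_of_nonneg (Real.sqrt_nonneg _), mul_assoc]
  exact norm_eq_zero.mp hu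

/-- On the diagonal the equation says that the net current between neighbouring levels is constant.
No current enters below level 0, so it vanishes everywhere, which is detailed balance. -/
theorem diagonal_succ {γ Δ ν : ℝ} (hγ : 0 < γ) {X : TotOp}
    (h0 : oscGen γ Δ ν X = 0) (s t : Fin 2) (k : ℕ) :
    ((1 + ν : ℝ) : ℂ) * X (k + 1, s) (k + 1, t) = (ν : ℂ) * X (k, s) (k, t) := by
  have hγ' : (γ : ℂ) ≠ 0 := by exact_mod_cast hγ.ne'
  have h2 (x : ℝ) (hx : 0 ≤ x) : ((Real.sqrt x * Real.sqrt x : ℝ) : ℂ) = x := by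
    rw [Real.mul_self_sqrt hx]
  induction k with
  | zero =>
    have he := congrFun (congrFun h0 (0, s)) (0, t)
    rw [oscGen_apply, Matrix.zero_apply, h2 _ (by positivity), h2 _ (by positivity)] at he
    apply mul_left_cancel₀ hγ'
    push_cast at he ⊢
    simp only [zero_add] at he ⊢
    linear_combination he
  | succ k ih =>
    have he := congrFun (congrFun h0 (k + 1, s)) (k + 1, t)
    rw [oscGen_apply, Matrix.zero_apply, h2 _ (by positivity), h2 _ (by positivity)] at he
    have hk : ((k : ℂ) + 1 + 1) ≠ 0 := by exact_mod_cast (by positivity : ((k : ℝ) + 1 + 1) ≠ 0)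
    apply mul_left_cancel₀ hγ'
    apply mul_left_cancel₀ hk
    simp only [Nat.add_sub_cancel] at he
    push_cast at he ih ⊢
    linear_combination he + (γ : ℂ) * (k + 1) * ih

/-- The kernel of the oscillator generator consists of the products with the thermal state. -/
theorem eq_thermalTensor_of_oscGen_eq_zero {γ Δ ν : ℝ} (hγ : 0 < γ) (hν : 0 < ν) {X : TotOp}
    (hX : X ∈ rapid) (h0 : oscGen γ Δ ν X = 0) : X = thermalTensor ν (trLin X) := by
  have hd : ∀ (s t : Fin 2) (k : ℕ),
      X (k, s) (k, t) = (((ν / (1 + ν)) ^ k : ℝ) : ℂ) * X (0, s) (0, t) := by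
    intro s t k
    have hne : (1 + ν : ℂ) ≠ 0 := by exact_mod_cast (by positivity : (1 + ν) ≠ 0)
    induction k with
    | zero => simp
    | succ k ih =>
      have := diagonal_succ hγ h0 s t k
      rw [ih] at this
      apply mul_left_cancel₀ hne
      push_cast at this ⊢
      rw [this, pow_succ]
      field_simp
  have hs : ((∑' k : ℕ, (ν / (1 + ν)) ^ k : ℝ) : ℂ) ≠ 0 := by
    exact_mod_cast (tsum_ratio_pos hν).ne'
  ext ⟨i, s⟩ ⟨j, t⟩
  rw [thermalTensor_apply]
  split_ifs with h
  · obtain rfl : i = j := h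
    have ht : trLin X s t = ((∑' k : ℕ, (ν / (1 + ν)) ^ k : ℝ) : ℂ) * X (0, s) (0, t) := by
      rw [trLin_apply hX, traceA, Complex.ofReal_tsum, ← tsum_mul_right]
      exact tsum_congr fun k => hd s t k
    change X (i, s) (i, t) = _ * trLin X s t
    rw [ht, hd]
    push_cast at hs ⊢
    field_simp
  · change i ≠ j at h
    rcases Nat.lt_or_ge i j with hlt | hge
    · have := offDiagonal_eq_zero hγ hν hX h0 0 (j - i) s t (by omega) (Or.inl rfl) i
      rwa [zero_add, Nat.sub_add_cancel hlt.le] at this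
    · have := offDiagonal_eq_zero hγ hν hX h0 (i - j) 0 s t (by omega) (Or.inr rfl) j
      rwa [zero_add, Nat.sub_add_cancel hge] at this

/-- The difference lies in the kernel and has zero partial trace, hence is ρ̄ ⊗ 0. Every later
uniqueness argument goes through this statement. -/
theorem oscGen_injective {γ Δ ν : ℝ} (hγ : 0 < γ) (hν : 0 < ν) {X Y : TotOp}
    (hX : X ∈ rapid) (hY : Y ∈ rapid) (h : oscGen γ Δ ν X = oscGen γ Δ ν Y)
    (ht : trLin X = trLin Y) : X = Y := by
  have := eq_thermalTensor_of_oscGen_eq_zero hγ hν (rapid.sub_mem hX hY)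
    (by rw [map_sub, h, sub_self])
  rwa [map_sub, ht, sub_self, map_zero, sub_eq_zero] at this

end AdiabaticElimination

namespace AdiabaticElimination

/-! ### Cauchy products and recursive sequences -/

open Finset Finset.HasAntidiagonal in
-- Associativity of the Cauchy product, stated for a function of three indices because the factors
-- K, L, G are maps between different spaces.
theorem sum_antidiagonal_assoc {M : Type*} [AddCommMonoid M] (f : ℕ → ℕ → ℕ → M) (n : ℕ) :
    ∑ p ∈ antidiagonal n, ∑ q ∈ antidiagonal p.1, f q.1 q.2 p.2
      = ∑ p ∈ antidiagonal n, ∑ q ∈ antidiagonal p.2, f p.1 q.1 q.2 := by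
  simp only [sum_sigma']
  apply sum_nbij' (fun ⟨⟨_i, j⟩, ⟨k, l⟩⟩ ↦ ⟨(k, l + j), (l, j)⟩)
    (fun ⟨⟨i, _j⟩, ⟨k, l⟩⟩ ↦ ⟨(i + k, l), (i, k)⟩) <;> grind [Finset.HasAntidiagonal.mem_antidiagonal]

/-- A sequence in which every term is computed from all the preceding ones. -/
theorem exists_seq_of_step {α : Type*} (a : α) (F : ℕ → (ℕ → α) → α)
    (hF : ∀ n f g, (∀ m ≤ n, f m = g m) → F n f = F n g) :
    ∃ f : ℕ → α, f 0 = a ∧ ∀ n, f (n + 1) = F n f := by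
  let s : ℕ → ℕ → α := fun n => Nat.rec (fun _ => a)
    (fun n g => Function.update g (n + 1) (F n g)) n
  have hs : ∀ n, s (n + 1) = Function.update (s n) (n + 1) (F n (s n)) := fun n => rfl
  have hst : ∀ m n, m ≤ n → s n m = s m m := by
    intro m n hmn
    induction n, hmn using Nat.le_induction with
    | base => rfl
    | succ n hmn ih => rw [hs, Function.update_of_ne (by omega), ih]
  refine ⟨fun n => s n n, rfl, fun n => ?_⟩
  change s (n + 1) (n + 1) = _
  rw [hs, Function.update_self]
  exact hF n _ _ fun m hm => hst m n hm

/-! ### Eliminations in terms of linear maps -/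

section Elimination

variable {γ Δ ν κ : ℝ} {G : ℕ → QubitSuperOp} {K : ℕ → QubitOp →ₗ[ℂ] TotOp}
  {L : ℕ → QubitSuperOp}

theorem IsAdiabaticElimination.mem_rapid (h : IsAdiabaticElimination γ Δ ν κ G K L) (n : ℕ)
    (X : QubitOp) : K n X ∈ rapid := h.decay n X

theorem IsAdiabaticElimination.zero_eq (h : IsAdiabaticElimination γ Δ ν κ G K L) :
    K 0 = thermalTensor ν := LinearMap.ext h.K_zero

theorem IsAdiabaticElimination.trLin_eq (hν : 0 < ν)
    (h : IsAdiabaticElimination γ Δ ν κ G K L) (n : ℕ) (X : QubitOp) :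
    trLin (K n X) = onePlusGauge G n X := by
  rcases n with _ | n
  · rw [h.zero_eq, trLin_thermalTensor hν]; rfl
  · rw [trLin_apply (h.mem_rapid _ _), h.gauge]; rfl

theorem IsAdiabaticElimination.oscGen_succ (h : IsAdiabaticElimination γ Δ ν κ G K L) (n : ℕ)
    (X : QubitOp) : oscGen γ Δ ν (K (n + 1) X)
      = ∑ p ∈ Finset.HasAntidiagonal.antidiagonal (n + 1), K p.1 (L p.2 X) - intGen κ ν (K n X) := by
  rw [← oscLindbladian_eq_oscGen, ← interaction_eq_intGen, eq_sub_iff_add_eq]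
  exact (h.invariance_succ n X).symm

/-- The solvability condition: the partial trace annihilates the range of the oscillator generator
on rapidly decreasing operators, so tracing the invariance condition expresses the next generator
through earlier data. -/
theorem IsAdiabaticElimination.generator_succ (hν : 0 < ν)
    (h : IsAdiabaticElimination γ Δ ν κ G K L) (n : ℕ) (X : QubitOp) :
    L (n + 1) X = trLin (intGen κ ν (K n X))
      - ∑ p ∈ Finset.HasAntidiagonal.antidiagonal n, G (p.1 + 1) (L p.2 X) := by
  have h1 := congrArg trLin (h.oscGen_succ n X)
  rw [trLin_oscGen _ _ _ (h.mem_rapid _ _), Finset.Nat.sum_antidiagonal_succ, map_sub, map_add,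
    h.trLin_eq hν, map_sum] at h1
  have h2 : ∀ p ∈ Finset.HasAntidiagonal.antidiagonal n, trLin (K (p.1 + 1) (L p.2 X)) = G (p.1 + 1) (L p.2 X) :=
    fun p _ => h.trLin_eq hν _ _
  rw [Finset.sum_congr rfl h2] at h1
  change 0 = L (n + 1) X + _ - _ at h1
  rw [eq_sub_iff_add_eq, ← sub_eq_zero]
  exact h1.symm

/-- Inductively, the solvability condition fixes the generator; then the image of the next K under
`oscGen` and its partial trace are both known, and `oscGen_injective` applies. -/
theorem IsAdiabaticElimination.unique (hγ : 0 < γ) (hν : 0 < ν)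
    {K' : ℕ → QubitOp →ₗ[ℂ] TotOp} {L' : ℕ → QubitSuperOp}
    (h : IsAdiabaticElimination γ Δ ν κ G K L) (h' : IsAdiabaticElimination γ Δ ν κ G K' L') :
    K = K' ∧ L = L' := by
  suffices H : ∀ n, K n = K' n ∧ L n = L' n from
    ⟨funext fun n => (H n).1, funext fun n => (H n).2⟩
  intro n
  induction n using Nat.strong_induction_on with
  | _ n ih =>
    rcases n with _ | n
    · exact ⟨h.zero_eq.trans h'.zero_eq.symm, h.L_zero.trans h'.L_zero.symm⟩
    · have hL : L (n + 1) = L' (n + 1) := by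
        refine LinearMap.ext fun X => ?_
        rw [h.generator_succ hν, h'.generator_succ hν, (ih n n.lt_succ_self).1]
        congr 1
        refine Finset.sum_congr rfl fun p hp => ?_
        rw [(ih p.2 (by have := Finset.HasAntidiagonal.mem_antidiagonal.mp hp; omega)).2]
      refine ⟨LinearMap.ext fun X => ?_, hL⟩
      refine oscGen_injective (Δ := Δ) hγ hν (h.mem_rapid _ _) (h'.mem_rapid _ _) ?_
        ((h.trLin_eq hν _ _).trans (h'.trLin_eq hν _ _).symm)
      rw [h.oscGen_succ, h'.oscGen_succ, (ih n n.lt_succ_self).1]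
      congr 1
      refine Finset.sum_congr rfl fun ⟨i, j⟩ hp => ?_
      have hij : i + j = n + 1 := Finset.HasAntidiagonal.mem_antidiagonal.mp hp
      -- The term with j = 0 contains the unknown K of index n + 1, but there L 0 = 0.
      rcases Nat.eq_zero_or_pos j with rfl | hj
      · simp [h.L_zero, h'.L_zero]
      · change K i (L j X) = K' i (L' j X)
        rw [(ih i (by omega)).1]
        rcases Nat.lt_or_ge j (n + 1) with hj' | hj'
        · rw [(ih j hj').2]
        · obtain rfl : j = n + 1 := by omega
          rw [hL]

/-- The gauge transformation of an elimination in the partial-trace gauge. -/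
theorem IsAdiabaticElimination.exists_gauge (hν : 0 < ν)
    (h : IsAdiabaticElimination γ Δ ν κ (fun _ => 0) K L) (G : ℕ → QubitSuperOp) :
    ∃ L' : ℕ → QubitSuperOp, IsAdiabaticElimination γ Δ ν κ G
        (fun n => ∑ p ∈ Finset.HasAntidiagonal.antidiagonal n, K p.1 ∘ₗ onePlusGauge G p.2) L' ∧
      ∀ n, ∑ p ∈ Finset.HasAntidiagonal.antidiagonal n, onePlusGauge G p.1 * L' p.2
        = ∑ p ∈ Finset.HasAntidiagonal.antidiagonal n, L p.1 * onePlusGauge G p.2 := by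
  -- The equation (1 + G) L' = L (1 + G) is solved recursively for L', which is possible because the
  -- series 1 + G has constant term 1.
  obtain ⟨L', hL'0, hL'⟩ := exists_seq_of_step (0 : QubitSuperOp)
    (fun n f => ∑ p ∈ Finset.HasAntidiagonal.antidiagonal (n + 1), L p.1 * onePlusGauge G p.2
      - ∑ p ∈ Finset.HasAntidiagonal.antidiagonal n, onePlusGauge G (p.1 + 1) * f p.2)
    (fun n f g hfg => by
      congr 1
      refine Finset.sum_congr rfl fun p hp => ?_
      rw [hfg p.2 (by have := Finset.HasAntidiagonal.mem_antidiagonal.mp hp; omega)])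
  have hcomm : ∀ n, ∑ p ∈ Finset.HasAntidiagonal.antidiagonal n, onePlusGauge G p.1 * L' p.2
      = ∑ p ∈ Finset.HasAntidiagonal.antidiagonal n, L p.1 * onePlusGauge G p.2 := by
    intro n
    rcases n with _ | n
    · simp [hL'0, h.L_zero]
    · rw [Finset.Nat.sum_antidiagonal_succ, hL' n]
      simp [onePlusGauge]
  refine ⟨L', ⟨fun n X => ?_, fun X => ?_, hL'0, fun X => ?_, fun n X => ?_, fun n X => ?_⟩, hcomm⟩
  · simp only [LinearMap.sum_apply]
    exact rapid.sum_mem fun p _ => h.mem_rapid _ _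
  · simpa [onePlusGauge] using h.K_zero X
  · have := h.invariance_zero X
    simp only [h.L_zero] at this
    simpa [onePlusGauge, hL'0] using this
  -- As formal series, K (1 + G) L' = K L (1 + G); the invariance of the original pair is then
  -- applied to (1 + G) X.
  · have e1 : ∑ p ∈ Finset.HasAntidiagonal.antidiagonal (n + 1),
        (∑ q ∈ Finset.HasAntidiagonal.antidiagonal p.1, K q.1 ∘ₗ onePlusGauge G q.2) (L' p.2 X)
        = ∑ p ∈ Finset.HasAntidiagonal.antidiagonal (n + 1),
          (∑ q ∈ Finset.HasAntidiagonal.antidiagonal p.1, K q.1 ∘ₗ L q.2) (onePlusGauge G p.2 X) := by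
      simp only [LinearMap.sum_apply, LinearMap.comp_apply]
      rw [sum_antidiagonal_assoc fun i j k => K i (onePlusGauge G j (L' k X)),
        sum_antidiagonal_assoc fun i j k => K i (L j (onePlusGauge G k X))]
      refine Finset.sum_congr rfl fun p _ => ?_
      simp only [← map_sum]
      congr 1
      have := congrArg (fun A : QubitSuperOp => A X) (hcomm p.2)
      simpa only [LinearMap.sum_apply, Module.End.mul_apply] using this
    refine e1.trans ?_
    rw [oscLindbladian_eq_oscGen γ Δ ν, interaction_eq_intGen κ ν, Finset.Nat.sum_antidiagonal_succ]
    simp only [LinearMap.sum_apply, LinearMap.comp_apply, map_sum]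
    rw [Finset.Nat.sum_antidiagonal_succ (f := fun p => oscGen γ Δ ν (K p.1 (onePlusGauge G p.2 X))),
      add_assoc, ← Finset.sum_add_distrib, h.zero_eq, oscGen_thermalTensor _ _ hν]
    congr 1
    · simp [h.L_zero]
    · refine Finset.sum_congr rfl fun p _ => ?_
      rw [h.oscGen_succ, sub_add_cancel]
  · have hr : ∑ p ∈ Finset.HasAntidiagonal.antidiagonal (n + 1), K p.1 (onePlusGauge G p.2 X) ∈ rapid :=
      rapid.sum_mem fun p _ => h.mem_rapid _ _
    simp only [LinearMap.sum_apply, LinearMap.comp_apply]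
    rw [← trLin_apply hr, map_sum, Finset.Nat.sum_antidiagonal_succ, h.trLin_eq hν]
    have h2 : ∀ p ∈ Finset.HasAntidiagonal.antidiagonal n, trLin (K (p.1 + 1) (onePlusGauge G p.2 X)) = 0 :=
      fun p _ => h.trLin_eq hν _ _
    rw [Finset.sum_congr rfl h2]
    simp [onePlusGauge]

end Elimination

/-! ### Eigenoperators of the oscillator generator -/

/-- `Dzʲ Dwᵏ (ρ̄ ⊗ X)`. -/
noncomputable def eigenOp (ν : ℝ) (j k : ℕ) : QubitOp →ₗ[ℂ] TotOp :=
  (Dz ^ j * Dw ^ k) ∘ₗ thermalTensor ν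

theorem eigenOp_zero (ν : ℝ) (X : QubitOp) : eigenOp ν 0 0 X = thermalTensor ν X := by
  simp [eigenOp]

theorem Dz_eigenOp (ν : ℝ) (j k : ℕ) (X : QubitOp) :
    Dz (eigenOp ν j k X) = eigenOp ν (j + 1) k X := by
  simp only [eigenOp, LinearMap.comp_apply, ← Module.End.mul_apply, ← mul_assoc, pow_succ']

theorem Dw_eigenOp (ν : ℝ) (j k : ℕ) (X : QubitOp) :
    Dw (eigenOp ν j k X) = eigenOp ν j (k + 1) X := by
  have h : Dw * Dz ^ j = Dz ^ j * Dw := (Commute.pow_right (show Commute Dw Dz from Dw_mul_Dz) j)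
  simp only [eigenOp, LinearMap.comp_apply, ← Module.End.mul_apply, ← mul_assoc, pow_succ', h]

theorem mul_pow_of_mul_eq {R : Type*} [Ring R] {a b : R} (h : a * b = b * a + 1) (j : ℕ) :
    a * b ^ j = b ^ j * a + j • b ^ (j - 1) := by
  induction j with
  | zero => simp
  | succ j ih =>
    rw [pow_succ, ← mul_assoc, ih, add_mul, mul_assoc, h, Nat.add_sub_cancel, succ_nsmul,
      smul_mul_assoc]
    rcases j with _ | j
    · simp
    · rw [Nat.add_sub_cancel, ← pow_succ, mul_add, mul_one]
      simp only [mul_assoc]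
      abel

/-- Moving `dZ` to the right differentiates the power of `Dz`, and the remaining term hits the
thermal state, the vacuum of `dZ`. For j = 0 the truncated `j - 1` comes with coefficient 0. -/
theorem dZ_eigenOp {ν : ℝ} (hν : 0 < ν) (j k : ℕ) (X : QubitOp) :
    dZ ν (eigenOp ν j k X) = (j : ℂ) • eigenOp ν (j - 1) k X := by
  have h : dZ ν * Dw ^ k = Dw ^ k * dZ ν :=
    (Commute.pow_right (show Commute (dZ ν) Dw from dZ_mul_Dw ν) k)
  have h2 : dZ ν * (Dz ^ j * Dw ^ k)
      = Dz ^ j * Dw ^ k * dZ ν + j • (Dz ^ (j - 1) * Dw ^ k) := by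
    rw [← mul_assoc, mul_pow_of_mul_eq (dZ_mul_Dz ν), add_mul, mul_assoc, h, mul_assoc,
      smul_mul_assoc]
  rw [eigenOp, LinearMap.comp_apply, ← Module.End.mul_apply, h2, LinearMap.add_apply,
    Module.End.mul_apply, dZ_thermalTensor hν, map_zero, zero_add, LinearMap.smul_apply,
    ← Nat.cast_smul_eq_nsmul ℂ]
  rfl

theorem dW_eigenOp {ν : ℝ} (hν : 0 < ν) (j k : ℕ) (X : QubitOp) :
    dW ν (eigenOp ν j k X) = (k : ℂ) • eigenOp ν j (k - 1) X := by
  have h : dW ν * Dz ^ j = Dz ^ j * dW ν :=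
    (Commute.pow_right (show Commute (dW ν) Dz from dW_mul_Dz ν) j)
  have h2 : dW ν * (Dz ^ j * Dw ^ k)
      = Dz ^ j * Dw ^ k * dW ν + k • (Dz ^ j * Dw ^ (k - 1)) := by
    rw [← mul_assoc, h, mul_assoc, mul_pow_of_mul_eq (dW_mul_Dw ν), mul_add, mul_smul_comm,
      mul_assoc]
  rw [eigenOp, LinearMap.comp_apply, ← Module.End.mul_apply, h2, LinearMap.add_apply,
    Module.End.mul_apply, dW_thermalTensor hν, map_zero, zero_add, LinearMap.smul_apply,
    ← Nat.cast_smul_eq_nsmul ℂ]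
  rfl

theorem sL_thermalTensor (ν : ℝ) (S X : QubitOp) :
    sL S (thermalTensor ν X) = thermalTensor ν (S * X) := by
  ext ⟨i, s⟩ ⟨j, t⟩
  simp only [sL_apply, thermalTensor_apply, Matrix.mul_apply]
  split_ifs
  · rw [Finset.mul_sum]; exact Finset.sum_congr rfl fun _ _ => mul_left_comm _ _ _
  · simp

theorem sR_thermalTensor (ν : ℝ) (S X : QubitOp) :
    sR S (thermalTensor ν X) = thermalTensor ν (X * S) := by
  ext ⟨i, s⟩ ⟨j, t⟩
  simp only [sR_apply, thermalTensor_apply, Matrix.mul_apply]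
  split_ifs
  · rw [Finset.mul_sum]; exact Finset.sum_congr rfl fun _ _ => mul_assoc _ _ _
  · simp

theorem sL_eigenOp (ν : ℝ) (S : QubitOp) (j k : ℕ) (X : QubitOp) :
    sL S (eigenOp ν j k X) = eigenOp ν j k (S * X) := by
  have hz : Commute (sL S) Dz := by
    simp only [Commute, SemiconjBy, Dz, mul_sub, sub_mul, sL_mul_aR, sL_mul_aL]
  have hw : Commute (sL S) Dw := by
    simp only [Commute, SemiconjBy, Dw, mul_sub, sub_mul, sL_mul_adR, sL_mul_adL]
  have h := ((hz.pow_right j).mul_right (hw.pow_right k)).eq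
  rw [eigenOp, LinearMap.comp_apply, ← Module.End.mul_apply, h, Module.End.mul_apply,
    sL_thermalTensor]
  rfl

theorem sR_eigenOp (ν : ℝ) (S : QubitOp) (j k : ℕ) (X : QubitOp) :
    sR S (eigenOp ν j k X) = eigenOp ν j k (X * S) := by
  have hz : Commute (sR S) Dz := by
    simp only [Commute, SemiconjBy, Dz, mul_sub, sub_mul, sR_mul_aR, sR_mul_aL]
  have hw : Commute (sR S) Dw := by
    simp only [Commute, SemiconjBy, Dw, mul_sub, sub_mul, sR_mul_adR, sR_mul_adL]
  have h := ((hz.pow_right j).mul_right (hw.pow_right k)).eq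
  rw [eigenOp, LinearMap.comp_apply, ← Module.End.mul_apply, h, Module.End.mul_apply,
    sR_thermalTensor]
  rfl

theorem eigenOp_mem_rapid {ν : ℝ} (hν : 0 < ν) (j k : ℕ) (X : QubitOp) :
    eigenOp ν j k X ∈ rapid := by
  induction j with
  | zero =>
    induction k with
    | zero => rw [eigenOp_zero]; exact thermalTensor_mem_rapid hν X
    | succ k ih => rw [← Dw_eigenOp]; exact Dw_mem_rapid ih
  | succ j ih => rw [← Dz_eigenOp]; exact Dz_mem_rapid ih

theorem trLin_eigenOp {ν : ℝ} (hν : 0 < ν) (j k : ℕ) (X : QubitOp) :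
    trLin (eigenOp ν j k X) = if j = 0 ∧ k = 0 then X else 0 := by
  rcases j with _ | j
  · rcases k with _ | k
    · simp [eigenOp_zero, trLin_thermalTensor hν]
    · rw [← Dw_eigenOp, trLin_Dw (eigenOp_mem_rapid hν _ _ _)]; simp
  · rw [← Dz_eigenOp, trLin_Dz (eigenOp_mem_rapid hν _ _ _)]; simp

theorem oscGen_eigenOp (γ Δ : ℝ) {ν : ℝ} (hν : 0 < ν) (j k : ℕ) (X : QubitOp) :
    oscGen γ Δ ν (eigenOp ν j k X)
      = (-(rateZ γ Δ * j + rateW γ Δ * k)) • eigenOp ν j k X := by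
  simp only [oscGen, LinearMap.add_apply, LinearMap.smul_apply,
    Module.End.mul_apply, dZ_eigenOp hν, dW_eigenOp hν, map_smul, Dz_eigenOp, Dw_eigenOp]
  rcases j with _ | j <;> rcases k with _ | k <;> simp <;> module

/-- `X ↦ ν σ₊ X - (1 + ν) X σ₊`. -/
noncomputable def alphaOp (ν : ℝ) : QubitSuperOp :=
  (ν : ℂ) • LinearMap.mulLeft ℂ sigmaPlus - (1 + ν : ℂ) • LinearMap.mulRight ℂ sigmaPlus

/-- `X ↦ (1 + ν) σ₋ X - ν X σ₋`. -/
noncomputable def betaOp (ν : ℝ) : QubitSuperOp :=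
  (1 + ν : ℂ) • LinearMap.mulLeft ℂ sigmaMinus - (ν : ℂ) • LinearMap.mulRight ℂ sigmaMinus

theorem intGen_eigenOp (κ : ℝ) {ν : ℝ} (hν : 0 < ν) (j k : ℕ) (X : QubitOp) :
    intGen κ ν (eigenOp ν j k X) = (-Complex.I * (κ : ℂ)) •
      (eigenOp ν (j + 1) k (alphaOp ν X) + eigenOp ν j (k + 1) (betaOp ν X)
        + (j : ℂ) • eigenOp ν (j - 1) k (sigmaMinus * X - X * sigmaMinus)
        + (k : ℂ) • eigenOp ν j (k - 1) (sigmaPlus * X - X * sigmaPlus)) := by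
  have h1 : alphaTot ν (eigenOp ν j k X) = eigenOp ν j k (alphaOp ν X) := by
    simp only [alphaTot, alphaOp, LinearMap.sub_apply, LinearMap.smul_apply, sL_eigenOp,
      sR_eigenOp, map_sub, map_smul, LinearMap.mulLeft_apply, LinearMap.mulRight_apply]
  have h2 : betaTot ν (eigenOp ν j k X) = eigenOp ν j k (betaOp ν X) := by
    simp only [betaTot, betaOp, LinearMap.sub_apply, LinearMap.smul_apply, sL_eigenOp,
      sR_eigenOp, map_sub, map_smul, LinearMap.mulLeft_apply, LinearMap.mulRight_apply]
  have h3 (S : QubitOp) : commTot S (eigenOp ν j k X) = eigenOp ν j k (S * X - X * S) := by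
    simp only [commTot, LinearMap.sub_apply, sL_eigenOp, sR_eigenOp, map_sub]
  simp only [intGen, LinearMap.add_apply, LinearMap.smul_apply, Module.End.mul_apply, h1, h2, h3,
    Dz_eigenOp, Dw_eigenOp, dZ_eigenOp hν, dW_eigenOp hν]

/-! ### Existence in the partial-trace gauge -/

/-- The span of the eigenoperators of the oscillator generator. -/
noncomputable def eigenSpan (ν : ℝ) : Submodule ℂ TotOp :=
  Submodule.span ℂ {Y | ∃ j k X, eigenOp ν j k X = Y}

theorem eigenOp_mem_eigenSpan (ν : ℝ) (j k : ℕ) (X : QubitOp) :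
    eigenOp ν j k X ∈ eigenSpan ν := Submodule.subset_span ⟨j, k, X, rfl⟩

theorem eigenSpan_le_rapid {ν : ℝ} (hν : 0 < ν) : eigenSpan ν ≤ rapid := by
  refine Submodule.span_le.mpr ?_
  rintro _ ⟨j, k, X, rfl⟩
  exact eigenOp_mem_rapid hν j k X

theorem intGen_mem_eigenSpan (κ : ℝ) {ν : ℝ} (hν : 0 < ν) {Y : TotOp} (hY : Y ∈ eigenSpan ν) :
    intGen κ ν Y ∈ eigenSpan ν := by
  refine (Submodule.span_le (p := (eigenSpan ν).comap (intGen κ ν))).mpr ?_ hY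
  rintro _ ⟨j, k, X, rfl⟩
  rw [SetLike.mem_coe, Submodule.mem_comap, intGen_eigenOp κ hν]
  exact Submodule.smul_mem _ _ (Submodule.add_mem _ (Submodule.add_mem _ (Submodule.add_mem _
    (eigenOp_mem_eigenSpan _ _ _ _) (eigenOp_mem_eigenSpan _ _ _ _))
    (Submodule.smul_mem _ _ (eigenOp_mem_eigenSpan _ _ _ _)))
    (Submodule.smul_mem _ _ (eigenOp_mem_eigenSpan _ _ _ _)))

/-- The real part is γ (j + k) / 2: every eigenoperator other than ρ̄ ⊗ X is damped. -/
theorem rate_ne_zero {γ : ℝ} (hγ : 0 < γ) (Δ : ℝ) {j k : ℕ} (h : ¬ (j = 0 ∧ k = 0)) :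
    rateZ γ Δ * j + rateW γ Δ * k ≠ 0 := by
  intro h0
  have hre := congrArg Complex.re h0
  simp [rateZ, rateW] at hre
  have : (0 : ℝ) < (j : ℝ) + k := by
    have : 0 < j + k := by omega
    exact_mod_cast this
  nlinarith

/-- On the span of eigenoperators the generator is inverted by division by the eigenvalue; removing
the thermal part disposes of the eigenvalue 0. -/
theorem exists_oscGen_eq {γ Δ ν : ℝ} (hγ : 0 < γ) (hν : 0 < ν) {Y : TotOp}
    (hY : Y ∈ eigenSpan ν) : ∃ Z ∈ eigenSpan ν, trLin Z = 0 ∧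
      oscGen γ Δ ν Z = Y - thermalTensor ν (trLin Y) := by
  induction hY using Submodule.span_induction with
  | mem Y h =>
    obtain ⟨j, k, X, rfl⟩ := h
    by_cases h : j = 0 ∧ k = 0
    · obtain ⟨rfl, rfl⟩ := h
      exact ⟨0, Submodule.zero_mem _, map_zero _, by simp [eigenOp_zero, trLin_thermalTensor hν]⟩
    · refine ⟨(-(rateZ γ Δ * j + rateW γ Δ * k))⁻¹ • eigenOp ν j k X,
        Submodule.smul_mem _ _ (eigenOp_mem_eigenSpan _ _ _ _), ?_, ?_⟩
      · rw [map_smul, trLin_eigenOp hν, if_neg h, smul_zero]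
      · rw [map_smul, oscGen_eigenOp _ _ hν, smul_smul,
          inv_mul_cancel₀ (neg_ne_zero.mpr (rate_ne_zero hγ Δ h)), one_smul, trLin_eigenOp hν,
          if_neg h, map_zero, sub_zero]
  | zero => exact ⟨0, Submodule.zero_mem _, map_zero _, by simp⟩
  | add Y Y' _ _ h h' =>
    obtain ⟨Z, hZ, hZ0, hZ1⟩ := h
    obtain ⟨Z', hZ', hZ0', hZ1'⟩ := h'
    refine ⟨Z + Z', Submodule.add_mem _ hZ hZ', by rw [map_add, hZ0, hZ0', add_zero], ?_⟩
    rw [map_add, hZ1, hZ1', map_add, map_add]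
    abel
  | smul c Y _ h =>
    obtain ⟨Z, hZ, hZ0, hZ1⟩ := h
    refine ⟨c • Z, Submodule.smul_mem _ _ hZ, by rw [map_smul, hZ0, smul_zero], ?_⟩
    rw [map_smul, hZ1, map_smul, map_smul, smul_sub]

/-- The traceless solution is unique, so it depends linearly on the right-hand side. Outside the
span the extension is arbitrary and is never evaluated. -/
theorem exists_linear_inverse {γ Δ ν : ℝ} (hγ : 0 < γ) (hν : 0 < ν) :
    ∃ R : TotOp →ₗ[ℂ] TotOp, ∀ Y ∈ eigenSpan ν, R Y ∈ eigenSpan ν ∧ trLin (R Y) = 0 ∧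
      oscGen γ Δ ν (R Y) = Y - thermalTensor ν (trLin Y) := by
  have H : ∀ Y : eigenSpan ν, ∃ Z ∈ eigenSpan ν, trLin Z = 0 ∧
      oscGen γ Δ ν Z = Y - thermalTensor ν (trLin (Y : TotOp)) :=
    fun Y => exists_oscGen_eq hγ hν Y.2
  choose f hf hf0 hf1 using H
  have hr : ∀ Y, f Y ∈ rapid := fun Y => eigenSpan_le_rapid hν (hf Y)
  let g : eigenSpan ν →ₗ[ℂ] TotOp :=
    { toFun := f
      map_add' := fun Y Y' => by
        refine oscGen_injective hγ hν (Δ := Δ) (hr _) (rapid.add_mem (hr _) (hr _)) ?_ ?_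
        · rw [map_add, hf1, hf1, hf1, Submodule.coe_add, map_add, map_add]
          abel
        · rw [map_add, hf0, hf0, hf0, add_zero]
      map_smul' := fun c Y => by
        refine oscGen_injective hγ hν (Δ := Δ) (hr _) (rapid.smul_mem _ (hr _)) ?_ ?_
        · rw [RingHom.id_apply, map_smul, hf1, hf1, Submodule.coe_smul, map_smul, map_smul,
            smul_sub]
        · rw [RingHom.id_apply, map_smul, hf0, hf0, smul_zero] }
  obtain ⟨R, hR⟩ := g.exists_extend
  refine ⟨R, fun Y hY => ?_⟩
  have : R Y = f ⟨Y, hY⟩ := congrArg (fun g => g ⟨Y, hY⟩) hR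
  rw [this]
  exact ⟨hf _, hf0 _, hf1 _⟩

/-- The recursion never leaves the span of eigenoperators, where the inverse is available. This span
consists of rapidly decreasing operators, so the decay condition comes for free. -/
theorem exists_elimination_zero {γ Δ ν : ℝ} (hγ : 0 < γ) (hν : 0 < ν) (κ : ℝ) :
    ∃ K L, IsAdiabaticElimination γ Δ ν κ (fun _ => 0) K L := by
  obtain ⟨R, hR⟩ := exists_linear_inverse (Δ := Δ) hγ hν
  let M : ℕ → (ℕ → (QubitOp →ₗ[ℂ] TotOp) × QubitSuperOp) → QubitOp →ₗ[ℂ] TotOp := fun n f =>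
    -- The case distinction drops the term (n, 0), which would refer to the entry of index n + 1
    -- being defined. Nothing is lost, since the generator of order 0 is 0.
    ∑ p ∈ Finset.HasAntidiagonal.antidiagonal n, if p.2 = 0 then 0 else (f (p.1 + 1)).1 ∘ₗ (f p.2).2
  obtain ⟨f, hf0, hf⟩ := exists_seq_of_step
    ((thermalTensor ν, 0) : (QubitOp →ₗ[ℂ] TotOp) × QubitSuperOp)
    (fun n f => (R ∘ₗ (M n f - intGen κ ν ∘ₗ (f n).1), trLin ∘ₗ intGen κ ν ∘ₗ (f n).1))
    (fun n f g hfg => by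
      have : M n f = M n g := by
        refine Finset.sum_congr rfl fun p hp => ?_
        have hp := Finset.HasAntidiagonal.mem_antidiagonal.mp hp
        split_ifs with h0
        · rfl
        · rw [hfg _ (by omega), hfg p.2 (by omega)]
      simp only [this, hfg n le_rfl])
  have hM : ∀ n X, M n f X = ∑ p ∈ Finset.HasAntidiagonal.antidiagonal n, (f (p.1 + 1)).1 ((f p.2).2 X) := by
    intro n X
    simp only [M, LinearMap.sum_apply]
    refine Finset.sum_congr rfl fun p _ => ?_
    split_ifs with h0
    · simp [h0, hf0]
    · rfl
  have hmem : ∀ n X, (f n).1 X ∈ eigenSpan ν := by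
    intro n
    induction n using Nat.strong_induction_on with
    | _ n ih =>
      intro X
      rcases n with _ | n
      · rw [hf0]
        exact eigenOp_zero ν X ▸ eigenOp_mem_eigenSpan ν 0 0 X
      · rw [hf]
        refine (hR _ ?_).1
        refine Submodule.sub_mem _ ?_ (intGen_mem_eigenSpan κ hν (ih n n.lt_succ_self X))
        simp only [M, LinearMap.sum_apply]
        refine Submodule.sum_mem _ fun p hp => ?_
        have hp := Finset.HasAntidiagonal.mem_antidiagonal.mp hp
        split_ifs with h0
        · exact Submodule.zero_mem _
        · exact ih _ (by omega) _
  have hMmem : ∀ n X, M n f X ∈ eigenSpan ν := fun n X => by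
    rw [hM]
    exact Submodule.sum_mem _ fun p _ => hmem _ _
  have hY : ∀ n X, (M n f - intGen κ ν ∘ₗ (f n).1) X ∈ eigenSpan ν := fun n X =>
    Submodule.sub_mem _ (hMmem n X) (intGen_mem_eigenSpan κ hν (hmem n X))
  have htr : ∀ n X, trLin ((f (n + 1)).1 X) = 0 := fun n X => by
    rw [hf]
    exact (hR _ (hY n X)).2.1
  refine ⟨fun n => (f n).1, fun n => (f n).2, fun n X => eigenSpan_le_rapid hν (hmem n X),
    fun X => by rw [hf0]; rfl, by rw [hf0], fun X => ?_, fun n X => ?_, fun n X => ?_⟩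
  · rw [oscLindbladian_eq_oscGen γ Δ ν, hf0, oscGen_thermalTensor _ _ hν]
    simp
  · rw [oscLindbladian_eq_oscGen γ Δ ν, interaction_eq_intGen κ ν]
    have h1 := (hR _ (hY n X)).2.2
    have h2 : oscGen γ Δ ν ((f (n + 1)).1 X)
        = oscGen γ Δ ν (R ((M n f - intGen κ ν ∘ₗ (f n).1) X)) := by rw [hf]; rfl
    have h3 : trLin ((M n f - intGen κ ν ∘ₗ (f n).1) X) = -((f (n + 1)).2 X) := by
      rw [LinearMap.sub_apply, map_sub, hM, map_sum, Finset.sum_eq_zero fun p _ => htr _ _, hf]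
      simp
    rw [h2, h1, h3, LinearMap.sub_apply, hM, Finset.Nat.sum_antidiagonal_succ, map_neg, hf0]
    simp only [LinearMap.comp_apply]
    abel
  · rw [← trLin_apply (eigenSpan_le_rapid hν (hmem _ _)), htr]
    rfl

theorem existsUnique_elimination {γ Δ ν : ℝ} (hγ : 0 < γ) (hν : 0 < ν) (κ : ℝ)
    (G : ℕ → QubitSuperOp) :
    ∃! p : (ℕ → QubitOp →ₗ[ℂ] TotOp) × (ℕ → QubitSuperOp),
      IsAdiabaticElimination γ Δ ν κ G p.1 p.2 := by
  obtain ⟨K, L, h⟩ := exists_elimination_zero (Δ := Δ) hγ hν κ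
  obtain ⟨L', h', -⟩ := h.exists_gauge hν G
  refine ⟨(_, L'), h', fun p hp => ?_⟩
  exact Prod.ext (hp.unique hγ hν h').1 (hp.unique hγ hν h').2

theorem gauge_change {γ Δ ν κ : ℝ} (hγ : 0 < γ) (hν : 0 < ν) {G : ℕ → QubitSuperOp}
    {K₀ K : ℕ → QubitOp →ₗ[ℂ] TotOp} {L₀ L : ℕ → QubitSuperOp}
    (h₀ : IsAdiabaticElimination γ Δ ν κ (fun _ => 0) K₀ L₀)
    (h : IsAdiabaticElimination γ Δ ν κ G K L) (n : ℕ) :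
    K n = ∑ p ∈ Finset.HasAntidiagonal.antidiagonal n, K₀ p.1 ∘ₗ onePlusGauge G p.2 ∧
      ∑ p ∈ Finset.HasAntidiagonal.antidiagonal n, onePlusGauge G p.1 * L p.2
        = ∑ p ∈ Finset.HasAntidiagonal.antidiagonal n, L₀ p.1 * onePlusGauge G p.2 := by
  obtain ⟨L', h', hcomm⟩ := h₀.exists_gauge hν G
  obtain ⟨rfl, rfl⟩ := h.unique hγ hν h'
  exact ⟨rfl, hcomm n⟩

end AdiabaticElimination

namespace AdiabaticElimination

/-! ### The expansion up to fourth order -/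

theorem trLin_sL (S : QubitOp) {X : TotOp} (h : X ∈ rapid) :
    trLin (sL S X) = S * trLin X := by
  rw [trLin_apply h, trLin_apply (sL_mem_rapid S h)]
  ext s t
  simp only [traceA, sL_apply, Matrix.mul_apply]
  rw [Summable.tsum_finsetSum fun u _ => (summable_of_mem_rapid h u t).mul_left _]
  simp only [tsum_mul_left]

theorem trLin_sR (S : QubitOp) {X : TotOp} (h : X ∈ rapid) :
    trLin (sR S X) = trLin X * S := by
  rw [trLin_apply h, trLin_apply (sR_mem_rapid S h)]
  ext s t
  simp only [traceA, sR_apply, Matrix.mul_apply]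
  rw [Summable.tsum_finsetSum fun u _ => (summable_of_mem_rapid h s u).mul_right _]
  simp only [tsum_mul_right]

theorem commTot_comm_dZ (ν : ℝ) (S : QubitOp) : dZ ν * commTot S = commTot S * dZ ν := by
  simp only [dZ, Dw, commTot, mul_sub, sub_mul, smul_mul_assoc, mul_smul_comm, sL_mul_adR,
    sL_mul_adL, sR_mul_adR, sR_mul_adL]
  module

theorem commTot_comm_dW (ν : ℝ) (S : QubitOp) : dW ν * commTot S = commTot S * dW ν := by
  simp only [dW, Dz, commTot, mul_sub, sub_mul, smul_mul_assoc, mul_smul_comm, sL_mul_aR,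
    sL_mul_aL, sR_mul_aR, sR_mul_aL]
  module

theorem trLin_commTot (S : QubitOp) {X : TotOp} (h : X ∈ rapid) :
    trLin (commTot S X) = S * trLin X - trLin X * S := by
  rw [commTot, LinearMap.sub_apply, map_sub, trLin_sL S h, trLin_sR S h]

/-- The next generator depends on K only through the two first moments `trLin (dZ ν Y)` and `trLin
(dW ν Y)`. -/
theorem trLin_intGen (κ ν : ℝ) {Y : TotOp} (h : Y ∈ rapid) :
    trLin (intGen κ ν Y) = (-Complex.I * (κ : ℂ)) •
      ((sigmaMinus * trLin (dZ ν Y) - trLin (dZ ν Y) * sigmaMinus)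
        + (sigmaPlus * trLin (dW ν Y) - trLin (dW ν Y) * sigmaPlus)) := by
  rw [intGen, commTot_comm_dZ, commTot_comm_dW]
  simp only [LinearMap.add_apply, LinearMap.smul_apply, Module.End.mul_apply, map_add, map_smul,
    trLin_Dz (alphaTot_mem_rapid ν h), trLin_Dw (betaTot_mem_rapid ν h),
    trLin_commTot _ (dZ_mem_rapid ν h), trLin_commTot _ (dW_mem_rapid ν h), zero_add]

/-- The first moments are left eigenvectors of the oscillator generator. Thus the moments of the
third-order K follow from the invariance condition without computing that K. -/
theorem trLin_dZ_oscGen (γ Δ ν : ℝ) {Y : TotOp} (h : Y ∈ rapid) :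
    trLin (dZ ν (oscGen γ Δ ν Y)) = -rateZ γ Δ • trLin (dZ ν Y) := by
  have e : dZ ν * oscGen γ Δ ν = oscGen γ Δ ν * dZ ν - rateZ γ Δ • dZ ν := by
    have h1 : dZ ν * (Dz * dZ ν) = Dz * dZ ν * dZ ν + dZ ν := by
      rw [← mul_assoc, dZ_mul_Dz, add_mul, one_mul]
    have h2 : dZ ν * (Dw * dW ν) = Dw * dW ν * dZ ν := by
      rw [← mul_assoc, dZ_mul_Dw, mul_assoc, ← dW_mul_dZ, mul_assoc]
    simp only [oscGen, mul_add, add_mul, mul_smul_comm, smul_mul_assoc, h1, h2]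
    module
  rw [← Module.End.mul_apply, e, LinearMap.sub_apply, map_sub, Module.End.mul_apply,
    trLin_oscGen _ _ _ (dZ_mem_rapid ν h), zero_sub, LinearMap.smul_apply, map_smul, neg_smul]

theorem trLin_dW_oscGen (γ Δ ν : ℝ) {Y : TotOp} (h : Y ∈ rapid) :
    trLin (dW ν (oscGen γ Δ ν Y)) = -rateW γ Δ • trLin (dW ν Y) := by
  have e : dW ν * oscGen γ Δ ν = oscGen γ Δ ν * dW ν - rateW γ Δ • dW ν := by
    have h1 : dW ν * (Dw * dW ν) = Dw * dW ν * dW ν + dW ν := by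
      rw [← mul_assoc, dW_mul_Dw, add_mul, one_mul]
    have h2 : dW ν * (Dz * dZ ν) = Dz * dZ ν * dW ν := by
      rw [← mul_assoc, dW_mul_Dz, mul_assoc, dW_mul_dZ, mul_assoc]
    simp only [oscGen, mul_add, add_mul, mul_smul_comm, smul_mul_assoc, h1, h2]
    module
  rw [← Module.End.mul_apply, e, LinearMap.sub_apply, map_sub, Module.End.mul_apply,
    trLin_oscGen _ _ _ (dW_mem_rapid ν h), zero_sub, LinearMap.smul_apply, map_smul, neg_smul]

theorem rateZ_ne_zero {γ : ℝ} (hγ : 0 < γ) (Δ : ℝ) : rateZ γ Δ ≠ 0 := by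
  simpa using rate_ne_zero hγ Δ (j := 1) (k := 0) (by simp)

theorem rateW_ne_zero {γ : ℝ} (hγ : 0 < γ) (Δ : ℝ) : rateW γ Δ ≠ 0 := by
  simpa using rate_ne_zero hγ Δ (j := 0) (k := 1) (by simp)

theorem rateZ_add_rateW_ne_zero {γ : ℝ} (hγ : 0 < γ) (Δ : ℝ) : rateZ γ Δ + rateW γ Δ ≠ 0 := by
  simpa using rate_ne_zero hγ Δ (j := 1) (k := 1) (by simp)

/-- The commutator of qubit operators. -/
def qComm (S X : QubitOp) : QubitOp := S * X - X * S

/-- The second-order generator, up to a factor. -/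
noncomputable def secondOrder (z w : ℂ) (ν : ℝ) (X : QubitOp) : QubitOp :=
  z⁻¹ • qComm sigmaMinus (alphaOp ν X) + w⁻¹ • qComm sigmaPlus (betaOp ν X)

/-- The coefficient of `Dz Dw` in the second-order elimination, up to a factor. -/
noncomputable def mixedOrder (z w : ℂ) (ν : ℝ) (X : QubitOp) : QubitOp :=
  (z + w)⁻¹ • (w⁻¹ • alphaOp ν (betaOp ν X) + z⁻¹ • betaOp ν (alphaOp ν X))

theorem mixedOrder_zero (z w : ℂ) (ν : ℝ) : mixedOrder z w ν 0 = 0 := by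
  simp [mixedOrder]

section FourthOrder

variable {γ Δ ν κ : ℝ} {K : ℕ → QubitOp →ₗ[ℂ] TotOp} {L : ℕ → QubitSuperOp}

theorem IsAdiabaticElimination.generator_succ_zero (hν : 0 < ν)
    (h : IsAdiabaticElimination γ Δ ν κ (fun _ => 0) K L) (n : ℕ) (X : QubitOp) :
    L (n + 1) X = trLin (intGen κ ν (K n X)) := by
  simp [h.generator_succ hν]

/-- Allows a proposed explicit term of K to be verified by substitution. -/
theorem IsAdiabaticElimination.eq_of_oscGen_eq (hγ : 0 < γ) (hν : 0 < ν)
    (h : IsAdiabaticElimination γ Δ ν κ (fun _ => 0) K L) (n : ℕ) (X : QubitOp) {Y : TotOp}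
    (hY : Y ∈ rapid) (hY0 : trLin Y = 0)
    (hYeq : oscGen γ Δ ν Y
      = ∑ p ∈ Finset.HasAntidiagonal.antidiagonal (n + 1), K p.1 (L p.2 X)
        - intGen κ ν (K n X)) : K (n + 1) X = Y := by
  refine oscGen_injective hγ hν (Δ := Δ) (h.mem_rapid _ _) hY ((h.oscGen_succ n X).trans hYeq.symm)
    ?_
  rw [hY0, h.trLin_eq hν]
  rfl

theorem IsAdiabaticElimination.zero_eq_eigenOp
    (h : IsAdiabaticElimination γ Δ ν κ (fun _ => 0) K L) (X : QubitOp) :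
    K 0 X = eigenOp ν 0 0 X := by
  rw [eigenOp_zero, h.zero_eq]

/-- The interaction changes j + k by ±1, so odd orders never reach j = k = 0 and contribute nothing
to the generator. -/
theorem IsAdiabaticElimination.generator_one (hν : 0 < ν)
    (h : IsAdiabaticElimination γ Δ ν κ (fun _ => 0) K L) : L 1 = 0 := by
  refine LinearMap.ext fun X => ?_
  rw [h.generator_succ_zero hν, h.zero_eq_eigenOp, intGen_eigenOp κ hν]
  simp [trLin_eigenOp hν]

theorem IsAdiabaticElimination.one_eq (hγ : 0 < γ) (hν : 0 < ν)
    (h : IsAdiabaticElimination γ Δ ν κ (fun _ => 0) K L) (X : QubitOp) :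
    K 1 X = (-Complex.I * (κ : ℂ)) • ((rateZ γ Δ)⁻¹ • eigenOp ν 1 0 (alphaOp ν X)
      + (rateW γ Δ)⁻¹ • eigenOp ν 0 1 (betaOp ν X)) := by
  refine h.eq_of_oscGen_eq hγ hν 0 X ?_ ?_ ?_
  · exact rapid.smul_mem _ (rapid.add_mem (rapid.smul_mem _ (eigenOp_mem_rapid hν _ _ _))
      (rapid.smul_mem _ (eigenOp_mem_rapid hν _ _ _)))
  · simp [trLin_eigenOp hν]
  · simp only [Finset.Nat.sum_antidiagonal_succ, Finset.HasAntidiagonal.antidiagonal_zero,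
      Finset.sum_singleton, zero_add, h.generator_one hν, h.L_zero, LinearMap.zero_apply, map_zero,
      h.zero_eq_eigenOp, intGen_eigenOp κ hν, map_smul, map_add, oscGen_eigenOp γ Δ hν]
    have hz := rateZ_ne_zero hγ Δ
    have hw := rateW_ne_zero hγ Δ
    push_cast
    match_scalars <;> field_simp <;> ring

theorem IsAdiabaticElimination.generator_two (hγ : 0 < γ) (hν : 0 < ν)
    (h : IsAdiabaticElimination γ Δ ν κ (fun _ => 0) K L) (X : QubitOp) :
    L 2 X = (-Complex.I * (κ : ℂ)) ^ 2 • secondOrder (rateZ γ Δ) (rateW γ Δ) ν X := by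
  rw [h.generator_succ_zero hν, h.one_eq hγ hν]
  simp only [map_smul, map_add, intGen_eigenOp κ hν, trLin_eigenOp hν, secondOrder, qComm]
  simp only [Nat.cast_one, Nat.cast_zero, Nat.add_eq_zero_iff, one_ne_zero, false_and, and_false,
    if_false, and_self, if_true, zero_smul, add_zero, zero_add, one_smul]
  match_scalars <;> ring

theorem IsAdiabaticElimination.two_eq (hγ : 0 < γ) (hν : 0 < ν)
    (h : IsAdiabaticElimination γ Δ ν κ (fun _ => 0) K L) (X : QubitOp) :
    K 2 X = (-Complex.I * (κ : ℂ)) ^ 2 •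
      ((2 * rateZ γ Δ ^ 2)⁻¹ • eigenOp ν 2 0 (alphaOp ν (alphaOp ν X))
        + eigenOp ν 1 1 (mixedOrder (rateZ γ Δ) (rateW γ Δ) ν X)
        + (2 * rateW γ Δ ^ 2)⁻¹ • eigenOp ν 0 2 (betaOp ν (betaOp ν X))) := by
  refine h.eq_of_oscGen_eq hγ hν 1 X ?_ ?_ ?_
  · exact rapid.smul_mem _ (rapid.add_mem (rapid.add_mem
      (rapid.smul_mem _ (eigenOp_mem_rapid hν _ _ _)) (eigenOp_mem_rapid hν _ _ _))
      (rapid.smul_mem _ (eigenOp_mem_rapid hν _ _ _)))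
  · simp [trLin_eigenOp hν]
  · have hz := rateZ_ne_zero hγ Δ
    have hw := rateW_ne_zero hγ Δ
    have hzw := rateZ_add_rateW_ne_zero hγ Δ
    simp only [Finset.Nat.sum_antidiagonal_succ, Finset.HasAntidiagonal.antidiagonal_zero,
      Finset.sum_singleton, zero_add, h.generator_one hν, h.L_zero, LinearMap.zero_apply, map_zero,
      h.zero_eq_eigenOp, h.generator_two hγ hν, h.one_eq hγ hν, intGen_eigenOp κ hν, map_smul,
      map_add, oscGen_eigenOp γ Δ hν, secondOrder, mixedOrder, qComm]
    simp only [Nat.cast_one, Nat.cast_zero, Nat.cast_ofNat, Nat.sub_self, zero_smul, add_zero,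
      one_smul, Nat.reduceAdd]
    match_scalars <;> field_simp <;> ring

theorem IsAdiabaticElimination.generator_three (hγ : 0 < γ) (hν : 0 < ν)
    (h : IsAdiabaticElimination γ Δ ν κ (fun _ => 0) K L) : L 3 = 0 := by
  refine LinearMap.ext fun X => ?_
  rw [h.generator_succ_zero hν, h.two_eq hγ hν]
  simp [intGen_eigenOp κ hν, trLin_eigenOp hν]

/-- Only the first moments of the third-order K are needed. Applying `dZ` or `dW` and the partial
trace to the third-order invariance condition gives them in terms of the second-order data. -/
theorem IsAdiabaticElimination.generator_four (hγ : 0 < γ) (hν : 0 < ν)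
    (h : IsAdiabaticElimination γ Δ ν κ (fun _ => 0) K L) (X : QubitOp) :
    L 4 X = (-Complex.I * (κ : ℂ)) ^ 4 •
      (qComm sigmaMinus ((rateZ γ Δ)⁻¹ •
          (qComm sigmaPlus (mixedOrder (rateZ γ Δ) (rateW γ Δ) ν X)
            + (rateZ γ Δ ^ 2)⁻¹ • qComm sigmaMinus (alphaOp ν (alphaOp ν X))
            - (rateZ γ Δ)⁻¹ • alphaOp ν (secondOrder (rateZ γ Δ) (rateW γ Δ) ν X)))
        + qComm sigmaPlus ((rateW γ Δ)⁻¹ •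
          (qComm sigmaMinus (mixedOrder (rateZ γ Δ) (rateW γ Δ) ν X)
            + (rateW γ Δ ^ 2)⁻¹ • qComm sigmaPlus (betaOp ν (betaOp ν X))
            - (rateW γ Δ)⁻¹ • betaOp ν (secondOrder (rateZ γ Δ) (rateW γ Δ) ν X)))) := by
  have hz := rateZ_ne_zero hγ Δ
  have hw := rateW_ne_zero hγ Δ
  have h3 := h.oscGen_succ 2 X
  simp only [Finset.Nat.sum_antidiagonal_succ, Finset.HasAntidiagonal.antidiagonal_zero,
    Finset.sum_singleton, zero_add, h.generator_one hν, h.L_zero, h.generator_three hγ hν,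
    LinearMap.zero_apply, map_zero, h.generator_two hγ hν, h.two_eq hγ hν, h.one_eq hγ hν,
    add_zero, smul_zero, Nat.reduceAdd, mixedOrder_zero, intGen_eigenOp κ hν, map_smul, map_add] at h3
  have hZ := congrArg (fun Y => trLin (dZ ν Y)) h3
  have hW := congrArg (fun Y => trLin (dW ν Y)) h3
  simp only [trLin_dZ_oscGen _ _ _ (h.mem_rapid _ _), trLin_dW_oscGen _ _ _ (h.mem_rapid _ _),
    map_smul, map_add, map_sub, dZ_eigenOp hν, dW_eigenOp hν, trLin_eigenOp hν] at hZ hW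
  simp only [Nat.cast_one, Nat.cast_zero, Nat.cast_ofNat, one_ne_zero,
    false_and, and_false, if_false, Nat.sub_self, and_self, if_true, zero_smul, add_zero, zero_add,
    one_smul, smul_zero, Nat.reduceSub, OfNat.ofNat_ne_zero] at hZ hW
  have hZ' : trLin (dZ ν (K 3 X)) = (-Complex.I * (κ : ℂ)) ^ 3 • ((rateZ γ Δ)⁻¹ •
      (qComm sigmaPlus (mixedOrder (rateZ γ Δ) (rateW γ Δ) ν X)
        + (rateZ γ Δ ^ 2)⁻¹ • qComm sigmaMinus (alphaOp ν (alphaOp ν X))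
        - (rateZ γ Δ)⁻¹ • alphaOp ν (secondOrder (rateZ γ Δ) (rateW γ Δ) ν X))) := by
    apply smul_right_injective _ (neg_ne_zero.mpr hz)
    refine hZ.trans ?_
    simp only [qComm]
    match_scalars <;> field_simp
  have hW' : trLin (dW ν (K 3 X)) = (-Complex.I * (κ : ℂ)) ^ 3 • ((rateW γ Δ)⁻¹ •
      (qComm sigmaMinus (mixedOrder (rateZ γ Δ) (rateW γ Δ) ν X)
        + (rateW γ Δ ^ 2)⁻¹ • qComm sigmaPlus (betaOp ν (betaOp ν X))
        - (rateW γ Δ)⁻¹ • betaOp ν (secondOrder (rateZ γ Δ) (rateW γ Δ) ν X))) := by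
    apply smul_right_injective _ (neg_ne_zero.mpr hw)
    refine hW.trans ?_
    simp only [qComm]
    match_scalars <;> field_simp
  rw [h.generator_succ_zero hν, trLin_intGen κ ν (h.mem_rapid _ _), hZ', hW']
  have hs (S Y : QubitOp) (c : ℂ) : S * (c • Y) - (c • Y) * S = c • qComm S Y := by
    rw [qComm, mul_smul_comm, smul_mul_assoc, smul_sub]
  rw [hs, hs, ← smul_add, smul_smul]
  congr 1
  ring

end FourthOrder

end AdiabaticElimination

namespace AdiabaticElimination

/-! ### The explicit fourth-order generator -/

theorem alphaOp_of (ν : ℝ) (a b c d : ℂ) : alphaOp ν !![a, b; c, d] =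
    !![(ν : ℂ) * c, (ν : ℂ) * d - (1 + ν) * a; 0, -((1 + ν) * c)] := by
  ext i j
  fin_cases i <;> fin_cases j <;>
    simp [alphaOp, sigmaPlus]

theorem betaOp_of (ν : ℝ) (a b c d : ℂ) : betaOp ν !![a, b; c, d] =
    !![-((ν : ℂ) * b), 0; (1 + ν) * a - (ν : ℂ) * d, (1 + ν) * b] := by
  ext i j
  fin_cases i <;> fin_cases j <;>
    simp [betaOp, sigmaMinus]

theorem qComm_sigmaMinus_of (a b c d : ℂ) :
    qComm sigmaMinus !![a, b; c, d] = !![-b, 0; a - d, b] := by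
  ext i j
  fin_cases i <;> fin_cases j <;> simp [qComm, sigmaMinus]

theorem qComm_sigmaPlus_of (a b c d : ℂ) :
    qComm sigmaPlus !![a, b; c, d] = !![c, d - a; 0, -c] := by
  ext i j
  fin_cases i <;> fin_cases j <;> simp [qComm, sigmaPlus]

theorem lindbladForm_of (ω gm gp gφ : ℝ) (a b c d : ℂ) :
    (-Complex.I * ((ω / 2 : ℝ) : ℂ)) • opComm sigmaZ !![a, b; c, d]
        + (gm : ℂ) • opDissipator sigmaMinus !![a, b; c, d]
        + (gp : ℂ) • opDissipator sigmaPlus !![a, b; c, d]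
        + (gφ : ℂ) • opDissipator sigmaZ !![a, b; c, d]
      = !![-(gm * a) + gp * d, (-Complex.I * ω - (gm + gp) / 2 - 2 * gφ) * b;
          (Complex.I * ω - (gm + gp) / 2 - 2 * gφ) * c, gm * a - gp * d] := by
  have h1 : sigmaMinus.conjTranspose = sigmaPlus := by
    ext i j; fin_cases i <;> fin_cases j <;> simp [sigmaMinus, sigmaPlus]
  have h2 : sigmaPlus.conjTranspose = sigmaMinus := by
    rw [← h1, Matrix.conjTranspose_conjTranspose]
  have h3 : sigmaZ.conjTranspose = sigmaZ := by
    ext i j; fin_cases i <;> fin_cases j <;> simp [sigmaZ]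
  simp only [opComm, opDissipator, opMul_eq_mul, h1, h2, h3]
  ext i j
  fin_cases i <;> fin_cases j <;>
    simp [sigmaMinus, sigmaPlus, sigmaZ] <;> ring

theorem gammaBar_eq (γ Δ : ℝ) : gammaBar γ Δ = 2 * rateW γ Δ := by
  simp only [gammaBar, rateW]; ring

theorem conj_rateW (γ Δ : ℝ) : (starRingEnd ℂ) (rateW γ Δ) = rateZ γ Δ := by
  simp [rateW, rateZ, sub_eq_add_neg, Complex.conj_ofNat]

theorem conj_rateZ (γ Δ : ℝ) : (starRingEnd ℂ) (rateZ γ Δ) = rateW γ Δ := by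
  rw [← conj_rateW, Complex.conj_conj]

theorem norm_gammaBar_sq (γ Δ : ℝ) :
    (‖gammaBar γ Δ‖ : ℂ) ^ 2 = 4 * (rateZ γ Δ * rateW γ Δ) := by
  rw [← Complex.mul_conj', gammaBar_eq, map_mul, conj_rateW, Complex.conj_ofNat]
  ring

theorem gamma_eq (γ Δ : ℝ) : (γ : ℂ) = rateZ γ Δ + rateW γ Δ := by
  simp only [rateZ, rateW]; ring

theorem I_mul_delta_eq (γ Δ : ℝ) : Complex.I * (Δ : ℂ) = (rateW γ Δ - rateZ γ Δ) / 2 := by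
  simp only [rateZ, rateW]; ring

/-- The rate `b₊` or `b₋` in terms of the decay rates of the oscillator. -/
noncomputable def bRate (z w : ℂ) (ν g n : ℝ) : ℂ :=
  (g : ℂ) ^ 2 * n / w + (g : ℂ) ^ 4 * (n : ℂ) ^ 2 / w ^ 3
    + (g : ℂ) ^ 4 * ν * (1 + ν) * (z * w + w ^ 2 - z ^ 2) / (z ^ 3 * w ^ 2)

theorem bCoeff_eq {γ : ℝ} (hγ : 0 < γ) (Δ ν g n : ℝ) :
    bCoeff γ Δ ν g n = bRate (rateZ γ Δ) (rateW γ Δ) ν g n := by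
  have hz := rateZ_ne_zero hγ Δ
  have hw := rateW_ne_zero hγ Δ
  have e : 8 * Complex.I * (γ : ℂ) * (Δ : ℂ) = 8 * γ * (Complex.I * Δ) := by ring
  rw [bCoeff, bRate, norm_gammaBar_sq, gammaBar_eq, map_mul, conj_rateW, Complex.conj_ofNat, e,
    I_mul_delta_eq γ, gamma_eq γ Δ]
  field_simp
  ring

theorem conj_bCoeff {γ : ℝ} (hγ : 0 < γ) (Δ ν g n : ℝ) :
    (starRingEnd ℂ) (bCoeff γ Δ ν g n) = bRate (rateW γ Δ) (rateZ γ Δ) ν g n := by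
  rw [bCoeff_eq hγ]
  simp [bRate, conj_rateW, conj_rateZ]

theorem two_mul_re_bCoeff {γ : ℝ} (hγ : 0 < γ) (Δ ν g n : ℝ) :
    ((2 * (bCoeff γ Δ ν g n).re : ℝ) : ℂ)
      = bRate (rateZ γ Δ) (rateW γ Δ) ν g n + bRate (rateW γ Δ) (rateZ γ Δ) ν g n := by
  rw [← conj_bCoeff hγ, ← bCoeff_eq hγ, Complex.add_conj]

theorem two_I_mul_im_bCoeff {γ : ℝ} (hγ : 0 < γ) (Δ ν g n : ℝ) :
    2 * Complex.I * ((bCoeff γ Δ ν g n).im : ℂ)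
      = bRate (rateZ γ Δ) (rateW γ Δ) ν g n - bRate (rateW γ Δ) (rateZ γ Δ) ν g n := by
  rw [← conj_bCoeff hγ, ← bCoeff_eq hγ, Complex.sub_conj]
  push_cast
  ring

theorem gammaPhi_eq {γ : ℝ} (hγ : 0 < γ) (Δ ν g : ℝ) :
    (gammaPhi γ Δ ν g : ℂ) = -((g : ℂ) ^ 4 * ν * (1 + ν)
      * (3 * (rateZ γ Δ + rateW γ Δ) ^ 4
        + 6 * (rateZ γ Δ + rateW γ Δ) ^ 2 * (rateW γ Δ - rateZ γ Δ) ^ 2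
        - (rateW γ Δ - rateZ γ Δ) ^ 4))
      / (8 * (rateZ γ Δ + rateW γ Δ) * (rateZ γ Δ * rateW γ Δ) ^ 3) := by
  have hz := rateZ_ne_zero hγ Δ
  have hw := rateW_ne_zero hγ Δ
  have hγ' : (γ : ℂ) ≠ 0 := by exact_mod_cast hγ.ne'
  -- Since w - z = 2iΔ and w + z = γ, every real expression in γ and Δ becomes rational in z and w.
  have hx : (2 * (Δ : ℂ) / γ) ^ 2 = -((rateW γ Δ - rateZ γ Δ) / γ) ^ 2 := by
    have : rateW γ Δ - rateZ γ Δ = Complex.I * (2 * Δ) := by simp only [rateZ, rateW]; ring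
    rw [this]
    linear_combination (2 * (Δ : ℂ) / γ) ^ 2 * Complex.I_sq
  have hx4 : (2 * (Δ : ℂ) / γ) ^ 4 = ((rateW γ Δ - rateZ γ Δ) / γ) ^ 4 := by
    rw [show 4 = 2 * 2 from rfl, pow_mul, hx]; ring
  have hd : (γ : ℂ) ^ 2 * (1 + -((rateW γ Δ - rateZ γ Δ) / γ) ^ 2)
      = 4 * (rateZ γ Δ * rateW γ Δ) := by
    have h := gamma_eq γ Δ
    field_simp
    rw [h]
    ring
  have hd' : (1 + -((rateW γ Δ - rateZ γ Δ) / (γ : ℂ)) ^ 2)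
      = 4 * (rateZ γ Δ * rateW γ Δ) / γ ^ 2 := by
    rw [← hd]; field_simp
  rw [gammaPhi]
  push_cast
  rw [hx4, hx, hd']
  rw [← gamma_eq γ Δ]
  field_simp
  ring

section

variable {γ Δ ν κ : ℝ} {K : ℕ → QubitOp →ₗ[ℂ] TotOp} {L : ℕ → QubitSuperOp}

theorem IsAdiabaticElimination.truncated_four (hγ : 0 < γ) (hν : 0 < ν)
    (h : IsAdiabaticElimination γ Δ ν κ (fun _ => 0) K L) (ε : ℝ) :
    truncatedGenerator L 4 ε = (ε : ℂ) ^ 2 • L 2 + (ε : ℂ) ^ 4 • L 4 := by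
  simp [truncatedGenerator, Finset.sum_range_succ, h.L_zero, h.generator_one hν,
    h.generator_three hγ hν]

theorem IsAdiabaticElimination.truncated_four_apply (hγ : 0 < γ) (hν : 0 < ν)
    (h : IsAdiabaticElimination γ Δ ν κ (fun _ => 0) K L) (ε : ℝ) (X : QubitOp) :
    truncatedGenerator L 4 ε X
      = (-Complex.I * ((omegaB γ Δ ν (ε * κ) / 2 : ℝ) : ℂ)) • opComm sigmaZ X
        + ((gammaMinus γ Δ ν (ε * κ) : ℝ) : ℂ) • opDissipator sigmaMinus X
        + ((gammaPlus γ Δ ν (ε * κ) : ℝ) : ℂ) • opDissipator sigmaPlus X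
        + ((gammaPhi γ Δ ν (ε * κ) : ℝ) : ℂ) • opDissipator sigmaZ X := by
  obtain ⟨a, b, c, d, rfl⟩ : ∃ a b c d, X = !![a, b; c, d] :=
    ⟨X 0 0, X 0 1, X 1 0, X 1 1, Matrix.eta_fin_two X⟩
  have hω : Complex.I * (omegaB γ Δ ν (ε * κ) : ℂ)
      = ((bRate (rateZ γ Δ) (rateW γ Δ) ν (ε * κ) (1 + ν)
          - bRate (rateW γ Δ) (rateZ γ Δ) ν (ε * κ) (1 + ν))
        + (bRate (rateZ γ Δ) (rateW γ Δ) ν (ε * κ) ν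
          - bRate (rateW γ Δ) (rateZ γ Δ) ν (ε * κ) ν)) / 2 := by
    rw [← two_I_mul_im_bCoeff hγ, ← two_I_mul_im_bCoeff hγ, omegaB, Complex.add_im]
    push_cast
    ring
  have hI : (-Complex.I * (κ : ℂ)) ^ 2 = -(κ : ℂ) ^ 2 := by
    rw [mul_pow, neg_sq, Complex.I_sq]; ring
  have hI4 : (-Complex.I * (κ : ℂ)) ^ 4 = (κ : ℂ) ^ 4 := by
    rw [show 4 = 2 * 2 from rfl, pow_mul, hI]; ring
  rw [lindbladForm_of, neg_mul, hω, gammaMinus, gammaPlus, two_mul_re_bCoeff hγ,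
    two_mul_re_bCoeff hγ, gammaPhi_eq hγ, h.truncated_four hγ hν, LinearMap.add_apply,
    LinearMap.smul_apply, LinearMap.smul_apply, h.generator_two hγ hν, h.generator_four hγ hν, hI,
    hI4]
  have hz := rateZ_ne_zero hγ Δ
  have hw := rateW_ne_zero hγ Δ
  have hzw := rateZ_add_rateW_ne_zero hγ Δ
  -- Complex conjugation has already been used to exchange z and w; what remains is a rational
  -- identity in independent z and w with nonvanishing denominators.
  generalize rateZ γ Δ = z at *
  generalize rateW γ Δ = w at *
  simp only [secondOrder, mixedOrder, alphaOp_of, betaOp_of, qComm_sigmaMinus_of,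
    qComm_sigmaPlus_of, Matrix.smul_of, Matrix.of_add_of, Matrix.of_sub_of, Matrix.smul_cons,
    Matrix.smul_empty, Matrix.add_cons, Matrix.head_cons, Matrix.tail_cons, Matrix.empty_add_empty,
    Matrix.sub_cons, Matrix.empty_sub_empty, smul_eq_mul, bRate]
  ext i j
  fin_cases i <;> fin_cases j <;>
    simp only [Matrix.of_apply, Matrix.cons_val', Matrix.cons_val_zero, Matrix.cons_val_one,
      Matrix.cons_val_fin_one, Fin.zero_eta, Fin.mk_one, Fin.isValue]
  all_goals
    push_cast
    field_simp
    ring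

end

end AdiabaticElimination

namespace AdiabaticElimination

/-! ### The Bloch representation -/

/-- The coordinates of a qubit operator in the basis of the identity and the Pauli matrices. -/
noncomputable def pauliEquiv : QubitOp ≃ₗ[ℂ] (Unit ⊕ Fin 3 → ℂ) where
  toFun X := Sum.elim (fun _ => (X 0 0 + X 1 1) / 2)
    ![(X 0 1 + X 1 0) / 2, Complex.I * (X 0 1 - X 1 0) / 2, (X 0 0 - X 1 1) / 2]
  invFun v := !![v (.inl ()) + v (.inr 2), v (.inr 0) - Complex.I * v (.inr 1);
    v (.inr 0) + Complex.I * v (.inr 1), v (.inl ()) - v (.inr 2)]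
  map_add' X Y := by
    ext i
    rcases i with i | i
    · simp; ring
    · fin_cases i <;> simp <;> ring
  map_smul' c X := by
    ext i
    rcases i with i | i
    · simp; ring
    · fin_cases i <;> simp <;> ring
  left_inv X := by
    have hI := Complex.I_sq
    ext i j
    fin_cases i <;> fin_cases j <;> simp
    · ring
    · linear_combination (-(X 0 1 - X 1 0) / 2) * hI
    · linear_combination ((X 0 1 - X 1 0) / 2) * hI
    · ring
  right_inv v := by
    have hI := Complex.I_sq
    ext i
    rcases i with i | i
    · simp
    · fin_cases i <;> simp
      linear_combination -(v (.inr 1)) * hI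

/-- A superoperator that preserves hermiticity and multiplies the trace by `c` acts on the Bloch
vectors by a real matrix. -/
theorem exists_blochMatrix (Λ : QubitSuperOp) (c : ℝ) (htr : ∀ X, (Λ X).trace = c * X.trace)
    (hh : ∀ X, Λ X.conjTranspose = (Λ X).conjTranspose) :
    ∃ T : Matrix (Fin 3) (Fin 3) ℝ,
      Λ.charpoly = (Polynomial.X - Polynomial.C (c : ℂ)) * T.charpoly.map Complex.ofRealHom ∧
      ∀ μ : ℝ, T.charpoly.eval μ = 0 →
        ∃ H : QubitOp, H ≠ 0 ∧ H.IsHermitian ∧ H.trace = 0 ∧ Λ H = (μ : ℂ) • H := by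
  let b : Module.Basis (Unit ⊕ Fin 3) ℂ QubitOp := Module.Basis.ofEquivFun pauliEquiv
  let M := LinearMap.toMatrix b b Λ
  have hM : ∀ i j, M i j = pauliEquiv (Λ (b j)) i := fun i j => by
    simp [M, LinearMap.toMatrix_apply, b]
  have hb : ∀ j, b j = pauliEquiv.symm (Pi.single j 1) := fun j => by simp [b]
  have hbh : ∀ j, (b j).conjTranspose = b j := fun j => by
    rw [hb]
    ext s t
    rcases j with j | j
    · fin_cases s <;> fin_cases t <;> simp [pauliEquiv]
    · fin_cases j <;> fin_cases s <;> fin_cases t <;> simp [pauliEquiv]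
  have hinl : ∀ X, pauliEquiv X (.inl ()) = X.trace / 2 := fun X => by
    simp [pauliEquiv, Matrix.trace, Fin.sum_univ_two]
  have hreal : ∀ X : QubitOp, X.conjTranspose = X → ∀ k,
      (((pauliEquiv X (.inr k)).re : ℝ) : ℂ) = pauliEquiv X (.inr k) := by
    intro X hX k
    have h00 := congrFun (congrFun hX 0) 0
    have h01 := congrFun (congrFun hX 0) 1
    have h11 := congrFun (congrFun hX 1) 1
    simp only [Matrix.conjTranspose_apply] at h00 h01 h11
    rw [← Complex.conj_eq_iff_re]
    fin_cases k
    · simp [pauliEquiv, ← h01, Complex.conj_ofNat, add_comm]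
    · simp [pauliEquiv, ← h01, Complex.conj_ofNat]
      ring
    · simp only [RCLike.star_def] at h00 h11
      simp [pauliEquiv, Complex.conj_ofNat, h00, h11]
  let T : Matrix (Fin 3) (Fin 3) ℝ := fun k l => (M (.inr k) (.inr l)).re
  have hT : M.toBlocks₂₂ = T.map Complex.ofRealHom := by
    ext k l
    change M (.inr k) (.inr l) = ((M (.inr k) (.inr l)).re : ℂ)
    rw [hM, hreal]
    rw [← hh, hbh]
  -- Traceless operators stay traceless, so the matrix is block triangular and the characteristic
  -- polynomial splits off the factor X - c.
  have h12 : M.toBlocks₁₂ = 0 := by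
    ext k l
    change M (.inl k) (.inr l) = 0
    rw [hM, hinl, htr]
    have : (b (.inr l)).trace = 0 := by
      rw [hb]
      fin_cases l <;> simp [pauliEquiv, Matrix.trace, Fin.sum_univ_two]
    rw [this]; simp
  have h11 : M.toBlocks₁₁ = Matrix.of fun _ _ => (c : ℂ) := by
    ext k l
    change M (.inl k) (.inl l) = c
    rw [hM, hinl, htr]
    have : (b (.inl l)).trace = 2 := by
      rw [hb]
      simp [pauliEquiv, Matrix.trace, Fin.sum_univ_two]
      norm_num
    rw [this]; simp
  have hfb : M = Matrix.fromBlocks (Matrix.of fun _ _ => (c : ℂ)) 0 M.toBlocks₂₁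
      (T.map Complex.ofRealHom) := by
    rw [← h11, ← h12, ← hT, Matrix.fromBlocks_toBlocks]
  refine ⟨T, ?_, fun μ hμ => ?_⟩
  · rw [← LinearMap.charpoly_toMatrix Λ b]
    change M.charpoly = _
    rw [hfb, Matrix.charpoly_fromBlocks_zero₁₂, Matrix.charpoly_map]
    congr 1
    simp [Matrix.charpoly, Matrix.charmatrix, Matrix.det_unique]
  -- A real root of a real matrix has a real eigenvector, and a real Bloch vector with zero identity
  -- component is a traceless hermitian operator.
  · rw [Matrix.eval_charpoly] at hμ
    obtain ⟨v, hv0, hv⟩ := Matrix.exists_mulVec_eq_zero_iff.mpr hμ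
    have hTv : T.mulVec v = μ • v := by
      rw [Matrix.sub_mulVec, sub_eq_zero] at hv
      rw [← hv]
      simp
    let u : Unit ⊕ Fin 3 → ℂ := Sum.elim 0 (fun k => (v k : ℂ))
    have hu : M.mulVec u = (μ : ℂ) • u := by
      rw [hfb, Matrix.fromBlocks_mulVec]
      ext i
      rcases i with i | i
      · simp [u]
      · have := congrFun hTv i
        simp only [Matrix.mulVec, dotProduct, Pi.smul_apply, smul_eq_mul] at this
        have hc : ((∑ j, T i j * v j : ℝ) : ℂ) = ((μ * v i : ℝ) : ℂ) := by rw [this]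
        push_cast at hc
        simpa [u, Matrix.mulVec, dotProduct] using hc
    refine ⟨pauliEquiv.symm u, ?_, ?_, ?_, ?_⟩
    · intro h0
      have hu0 : u = 0 := by simpa using h0
      apply hv0
      ext k
      simpa [u] using congrFun hu0 (.inr k)
    · ext s t
      fin_cases s <;> fin_cases t <;> simp [pauliEquiv, u, sub_eq_add_neg]
    · simp [pauliEquiv, u, Matrix.trace, Fin.sum_univ_two]
    · apply pauliEquiv.injective
      rw [map_smul, LinearEquiv.apply_symm_apply, ← hu]
      have := LinearMap.toMatrix_mulVec_repr b b Λ (pauliEquiv.symm u)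
      ext i
      have h1 := congrFun this i
      have h2 : ∀ X : QubitOp, ⇑(b.repr X) = pauliEquiv X := fun X => by
        ext i; simp [b]
      rw [h2, h2, LinearEquiv.apply_symm_apply] at h1
      exact h1.symm

/-! ### Change of the orthonormal basis -/

/-- The superoperator `X ↦ U† Λ(U X U†) U`. -/
noncomputable def conjSuper (U : QubitOp) (Λ : QubitSuperOp) : QubitSuperOp where
  toFun X := U.conjTranspose * Λ (U * X * U.conjTranspose) * U
  map_add' X Y := by simp [mul_add, add_mul]
  map_smul' c X := by simp

theorem conjSuper_apply (U : QubitOp) (Λ : QubitSuperOp) (X : QubitOp) :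
    conjSuper U Λ X = U.conjTranspose * Λ (U * X * U.conjTranspose) * U := rfl

/-- A unitary change of basis on the space of qubit operators. -/
noncomputable def conjEquiv {U : QubitOp} (hU : U ∈ Matrix.unitaryGroup (Fin 2) ℂ) :
    QubitOp ≃ₗ[ℂ] QubitOp where
  toFun X := U.conjTranspose * X * U
  invFun X := U * X * U.conjTranspose
  map_add' X Y := by simp [mul_add, add_mul]
  map_smul' c X := by simp
  left_inv X := by
    have h : U * U.conjTranspose = 1 := Matrix.mem_unitaryGroup_iff.mp hU
    simp only [mul_assoc, h, mul_one]
    rw [← mul_assoc, h, one_mul]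
  right_inv X := by
    have h : U.conjTranspose * U = 1 := Matrix.mem_unitaryGroup_iff'.mp hU
    simp only [mul_assoc, h, mul_one]
    rw [← mul_assoc, h, one_mul]

theorem conjSuper_eq_conj {U : QubitOp} (hU : U ∈ Matrix.unitaryGroup (Fin 2) ℂ)
    (Λ : QubitSuperOp) : conjSuper U Λ = (conjEquiv hU).conj Λ := by
  refine LinearMap.ext fun X => ?_
  rfl

theorem trace_conjSuper {U : QubitOp} (hU : U ∈ Matrix.unitaryGroup (Fin 2) ℂ)
    (Λ : QubitSuperOp) :
    LinearMap.trace ℂ QubitOp (conjSuper U Λ) = LinearMap.trace ℂ QubitOp Λ := by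
  rw [conjSuper_eq_conj hU, LinearMap.trace_conj']

theorem det_conjSuper {U : QubitOp} (hU : U ∈ Matrix.unitaryGroup (Fin 2) ℂ)
    (Λ : QubitSuperOp) : LinearMap.det (conjSuper U Λ) = LinearMap.det Λ := by
  rw [conjSuper_eq_conj hU, LinearEquiv.conj_apply]
  exact LinearMap.det_conj Λ (conjEquiv hU)

theorem conjSuper_one {U : QubitOp} (hU : U ∈ Matrix.unitaryGroup (Fin 2) ℂ) :
    conjSuper U 1 = 1 :=
  LinearMap.ext fun X => (conjEquiv hU).apply_symm_apply X

theorem conjSuper_sub (U : QubitOp) (Λ Λ' : QubitSuperOp) :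
    conjSuper U (Λ - Λ') = conjSuper U Λ - conjSuper U Λ' := by
  refine LinearMap.ext fun X => ?_
  simp [conjSuper_apply, mul_sub, sub_mul]

theorem conjSuper_smul (U : QubitOp) (c : ℂ) (Λ : QubitSuperOp) :
    conjSuper U (c • Λ) = c • conjSuper U Λ := by
  refine LinearMap.ext fun X => ?_
  simp [conjSuper_apply]

theorem trace_conjSuper_apply {U : QubitOp} (hU : U ∈ Matrix.unitaryGroup (Fin 2) ℂ) {c : ℂ}
    {Λ : QubitSuperOp} (h : ∀ X, (Λ X).trace = c * X.trace) (X : QubitOp) :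
    (conjSuper U Λ X).trace = c * X.trace := by
  have h1 : U * U.conjTranspose = 1 := Matrix.mem_unitaryGroup_iff.mp hU
  have h2 : U.conjTranspose * U = 1 := Matrix.mem_unitaryGroup_iff'.mp hU
  rw [conjSuper_apply, Matrix.trace_mul_comm, ← mul_assoc, h1, one_mul, h, Matrix.trace_mul_comm,
    ← mul_assoc, h2, one_mul]

theorem conjSuper_conjTranspose (U : QubitOp) {Λ : QubitSuperOp}
    (h : ∀ X, Λ X.conjTranspose = (Λ X).conjTranspose) (X : QubitOp) :
    conjSuper U Λ X.conjTranspose = (conjSuper U Λ X).conjTranspose := by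
  simp only [conjSuper_apply, Matrix.conjTranspose_mul, Matrix.conjTranspose_conjTranspose, ← h,
    mul_assoc]

/-- The two eigenvalues of a traceless hermitian 2 × 2 matrix are opposite, so its diagonal form is
a multiple of σ_z. -/
theorem exists_unitary_diagonalization {H : QubitOp} (hH : H.IsHermitian) (h0 : H ≠ 0)
    (ht : H.trace = 0) : ∃ U ∈ Matrix.unitaryGroup (Fin 2) ℂ, ∃ r : ℂ, r ≠ 0 ∧
      H = U * (r • sigmaZ) * U.conjTranspose := by
  have hs := hH.spectral_theorem
  rw [Unitary.conjStarAlgAut_apply] at hs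
  set U : QubitOp := (hH.eigenvectorUnitary : QubitOp) with hU
  have hmem : U ∈ Matrix.unitaryGroup (Fin 2) ℂ := hH.eigenvectorUnitary.2
  have h2 : U.conjTranspose * U = 1 := Matrix.mem_unitaryGroup_iff'.mp hmem
  have hst : (star hH.eigenvectorUnitary : QubitOp) = U.conjTranspose := rfl
  set d : Fin 2 → ℂ := RCLike.ofReal ∘ hH.eigenvalues with hd
  have ht' : d 0 + d 1 = 0 := by
    have := congrArg Matrix.trace hs
    rw [ht, Matrix.trace_mul_comm, ← mul_assoc] at this
    have h3 : star U * U = 1 := h2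
    rw [h3, one_mul, Matrix.trace_diagonal, Fin.sum_univ_two] at this
    exact this.symm
  have hdz : Matrix.diagonal d = d 0 • sigmaZ := by
    ext i j
    fin_cases i <;> fin_cases j <;> simp [sigmaZ]
    exact eq_neg_of_add_eq_zero_right ht'
  refine ⟨U, hmem, d 0, fun hz => h0 ?_, ?_⟩
  · rw [hs, hdz, hz]; simp
  · rw [← hdz]; exact hs

/-- The coordinates `(tr X, X₀₀, X₀₁, X₁₀)`. -/
noncomputable def traceEquiv : QubitOp ≃ₗ[ℂ] (Fin 4 → ℂ) where
  toFun X := ![X 0 0 + X 1 1, X 0 0, X 0 1, X 1 0]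
  invFun v := !![v 1, v 2; v 3, v 0 - v 1]
  map_add' X Y := by
    ext i
    fin_cases i <;> simp
    ring
  map_smul' c X := by
    ext i
    fin_cases i <;> simp
    ring
  left_inv X := by
    ext i j
    fin_cases i <;> fin_cases j <;> simp
  right_inv v := by
    ext i
    fin_cases i <;> simp

/-- The matrix of a superoperator in the coordinates `(tr X, X₀₀, X₀₁, X₁₀)`. -/
theorem toMatrix_traceEquiv (Λ : QubitSuperOp) (i j : Fin 4) :
    LinearMap.toMatrix (Module.Basis.ofEquivFun traceEquiv) (Module.Basis.ofEquivFun traceEquiv)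
      Λ i j = traceEquiv (Λ (![!![0, 0; 0, 1], sigmaZ, !![0, 1; 0, 0], !![0, 0; 1, 0]] j)) i := by
  have h : Module.Basis.ofEquivFun traceEquiv j
      = ![!![0, 0; 0, 1], sigmaZ, !![0, 1; 0, 0], !![0, 0; 1, 0]] j := by
    rw [Module.Basis.coe_ofEquivFun]
    ext s t
    fin_cases j <;> fin_cases s <;> fin_cases t <;> simp [traceEquiv, sigmaZ]
  rw [LinearMap.toMatrix_apply, h]
  simp

/-- In the coordinates of `traceEquiv` the matrix is block triangular with diagonal entries c, μ and
the block of coherences. With Λ(E₀₁) having off-diagonal entries α, β, hermiticity preservation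
makes this block [[α, β̄], [β, ᾱ]], of trace 2 Re α and determinant |α|² - |β|². -/
theorem trace_det_of_sigmaZ_eigen {Λ : QubitSuperOp} {c μ : ℂ}
    (htr : ∀ X, (Λ X).trace = c * X.trace)
    (hh : ∀ X, Λ X.conjTranspose = (Λ X).conjTranspose) (hz : Λ sigmaZ = μ • sigmaZ) :
    LinearMap.trace ℂ QubitOp Λ = c + μ + 2 * ((Λ !![0, 1; 0, 0] 0 1).re : ℂ) ∧
    LinearMap.det Λ = c * μ * (((‖Λ !![0, 1; 0, 0] 0 1‖ ^ 2
      - ‖Λ !![0, 1; 0, 0] 1 0‖ ^ 2 : ℝ)) : ℂ) := by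
  let b := Module.Basis.ofEquivFun traceEquiv
  have ht : ∀ X, Λ X 0 0 + Λ X 1 1 = c * (X 0 0 + X 1 1) := fun X => by
    simpa [Matrix.trace, Fin.sum_univ_two] using htr X
  have h10 : Λ !![0, 0; 1, 0] = (Λ !![0, 1; 0, 0]).conjTranspose := by
    rw [← hh]
    congr 1
    ext s t
    fin_cases s <;> fin_cases t <;> simp
  constructor
  · rw [LinearMap.trace_eq_matrix_trace ℂ b, Matrix.trace, Fin.sum_univ_four]
    simp only [Matrix.diag_apply, b, toMatrix_traceEquiv]
    simp only [traceEquiv, LinearEquiv.coe_mk, LinearMap.coe_mk, AddHom.coe_mk]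
    simp [hz, h10, ht]
    simp [sigmaZ]
    rw [add_assoc _ (Λ _ 0 1), Complex.add_conj]
    push_cast
    ring
  · rw [← LinearMap.det_toMatrix b]
    have e (w : ℂ) : ((‖w‖ ^ 2 : ℝ) : ℂ) = w * (starRingEnd ℂ) w := by
      rw [Complex.mul_conj']; push_cast; rfl
    have hMat : LinearMap.toMatrix b b Λ = Matrix.of fun i j => traceEquiv (Λ (![!![0, 0; 0, 1], sigmaZ,
        !![0, 1; 0, 0], !![0, 0; 1, 0]] j)) i := by
      ext i j; exact toMatrix_traceEquiv Λ i j
    rw [hMat, Matrix.det_succ_row_zero, Fin.sum_univ_four]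
    simp only [Matrix.det_fin_three, Matrix.submatrix_apply]
    simp only [traceEquiv, LinearEquiv.coe_mk, LinearMap.coe_mk, AddHom.coe_mk]
    simp [hz, h10, ht, Fin.succAbove]
    simp [sigmaZ]
    rw [← Complex.ofReal_pow, ← Complex.ofReal_pow, e, e]
    ring

end AdiabaticElimination

namespace AdiabaticElimination

/-! ### Kraus maps -/

/-- The Choi matrix of a superoperator. -/
def choi (Φ : QubitSuperOp) : Matrix (Fin 2 × Fin 2) (Fin 2 × Fin 2) ℂ :=
  Matrix.of fun i j => Φ (Matrix.single i.1 j.1 1) i.2 j.2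

theorem choi_apply (Φ : QubitSuperOp) (i j s t : Fin 2) :
    choi Φ (i, s) (j, t) = Φ (Matrix.single i j 1) s t := rfl

/-- The blocks of the rank-one matrix built from the entries of U are U Eᵢⱼ U†. Complete positivity
is applied to this matrix, and conjugation by 1 ⊗ U supplies the outer factors. -/
theorem IsCompletelyPositive.choi_conjSuper {Φ : QubitSuperOp} (h : IsCompletelyPositive Φ)
    (U : QubitOp) : (choi (conjSuper U Φ)).PosSemidef := by
  let v : Fin 2 × Fin 2 → ℂ := fun i => U i.2 i.1
  have h1 := h 2 _ (Matrix.posSemidef_vecMulVec_self_star v)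
  have h2 := h1.conjTranspose_mul_mul_same ((1 : QubitOp) ⊗ₖ U)
  convert h2 using 1
  ext ⟨i, s⟩ ⟨j, t⟩
  have h3 : ∀ i j, (Matrix.of fun s t => Matrix.vecMulVec v (star v) (i, s) (j, t))
      = U * Matrix.single i j 1 * U.conjTranspose := by
    intro i j
    ext s t
    fin_cases i <;> fin_cases j <;>
      simp [v, Matrix.vecMulVec_apply, Matrix.mul_apply, Fin.sum_univ_two, Matrix.single]
  rw [choi_apply, conjSuper_apply, ← h3]
  simp only [Matrix.mul_apply, Fintype.sum_prod_type, Fin.sum_univ_two, Matrix.conjTranspose_apply,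
    Matrix.kroneckerMap_apply, Matrix.of_apply]
  revert i j
  simp [Fin.forall_fin_two, Matrix.one_apply]

theorem IsCompletelyPositive.apply_conjTranspose {Φ : QubitSuperOp} (h : IsCompletelyPositive Φ)
    (X : QubitOp) : Φ X.conjTranspose = (Φ X).conjTranspose := by
  have h1 : (choi Φ).PosSemidef := by
    have := h.choi_conjSuper 1
    have e : conjSuper 1 Φ = Φ := LinearMap.ext fun X => by simp [conjSuper_apply]
    rwa [e] at this
  have hs : ∀ i j, Φ (Matrix.single i j 1) = (Φ (Matrix.single j i 1)).conjTranspose := by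
    intro i j
    ext s t
    exact (h1.isHermitian.apply (i, s) (j, t)).symm
  have hX : ∀ Y : QubitOp, Y = ∑ i, ∑ j, Y i j • Matrix.single i j (1 : ℂ) := fun Y => by
    conv_lhs => rw [Matrix.matrix_eq_sum_single Y]
    simp
  rw [hX X.conjTranspose]
  conv_rhs => rw [hX X]
  simp only [map_sum, map_smul, Matrix.conjTranspose_sum, Matrix.conjTranspose_smul, ← hs,
    Matrix.conjTranspose_apply]
  rw [Finset.sum_comm]

theorem IsKrausMap.conjSuper_trace {Φ : QubitSuperOp} (h : IsKrausMap Φ) {U : QubitOp}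
    (hU : U ∈ Matrix.unitaryGroup (Fin 2) ℂ) (X : QubitOp) :
    (conjSuper U Φ X).trace = ((1 : ℝ) : ℂ) * X.trace :=
  trace_conjSuper_apply hU (fun X => by rw [h.2, Complex.ofReal_one, one_mul]) X

theorem single_zero_one : (Matrix.single 0 1 1 : QubitOp) = !![0, 1; 0, 0] := by
  ext i j; fin_cases i <;> fin_cases j <;> simp [Matrix.single]

/-- The diagonal entries of the Choi matrix dominate the entry between them. -/
theorem IsCompletelyPositive.norm_sq_le {Φ : QubitSuperOp} (h : IsCompletelyPositive Φ)
    (U : QubitOp) :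
    0 ≤ (conjSuper U Φ (Matrix.single 0 0 1) 0 0).re ∧
    0 ≤ (conjSuper U Φ (Matrix.single 1 1 1) 1 1).re ∧
    ‖conjSuper U Φ !![0, 1; 0, 0] 0 1‖ ^ 2
      ≤ (conjSuper U Φ (Matrix.single 0 0 1) 0 0).re
        * (conjSuper U Φ (Matrix.single 1 1 1) 1 1).re := by
  have h1 := h.choi_conjSuper U
  have h0 := h1.diag_nonneg (i := (0, 0))
  have h0' := h1.diag_nonneg (i := (1, 1))
  -- The principal minor on the indices (0,0) and (1,1) has as off-diagonal entry the coherence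
  -- Φ(E₀₁)₀₁, in the rotated basis.
  have hd := (h1.submatrix ![((0 : Fin 2), (0 : Fin 2)), (1, 1)]).det_nonneg
  have hh := h1.isHermitian.apply (1, 1) (0, 0)
  rw [Matrix.det_fin_two] at hd
  simp only [Matrix.submatrix_apply, Matrix.cons_val_zero, Matrix.cons_val_one] at hd
  rw [← hh] at hd
  rw [choi_apply] at h0 h0'
  simp only [choi_apply, single_zero_one] at hd
  have hd' := (Complex.le_def.mp hd).1
  have e0 := (Complex.le_def.mp h0).2
  have e1 := (Complex.le_def.mp h0').2
  refine ⟨(Complex.le_def.mp h0).1, (Complex.le_def.mp h0').1, ?_⟩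
  rw [RCLike.star_def, Complex.mul_conj'] at hd'
  rw [← Complex.ofReal_pow, Complex.sub_re, Complex.ofReal_re, Complex.mul_re, ← e0] at hd'
  simp only [Complex.zero_re, Complex.zero_im, zero_mul, sub_zero] at hd'
  linarith

/-! ### Conditional positivity -/

/-- The conditions on the generator of a semigroup of Kraus maps that pass to limits. -/
structure CondPos (L : QubitSuperOp) : Prop where
  trace_eq : ∀ X, (L X).trace = 0
  conjTranspose_eq : ∀ X, L X.conjTranspose = (L X).conjTranspose
  dissipative : ∀ U ∈ Matrix.unitaryGroup (Fin 2) ℂ,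
    2 * (conjSuper U L !![0, 1; 0, 0] 0 1).re
      ≤ (conjSuper U L (Matrix.single 0 0 1) 0 0).re + (conjSuper U L (Matrix.single 1 1 1) 1 1).re

/-- If p, q are the two diagonal entries and α the coherence, then 2 Re α ≤ 2|α| ≤ 2√(pq) ≤ p + q.
Subtracting the identity removes 2 from both ends. -/
theorem IsKrausMap.condPos {Φ : QubitSuperOp} (h : IsKrausMap Φ) {t : ℝ} (ht : 0 < t) :
    CondPos (((t⁻¹ : ℝ) : ℂ) • (Φ - 1)) := by
  refine ⟨fun X => ?_, fun X => ?_, fun U hU => ?_⟩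
  · simp [h.2]
  · simp [h.1.apply_conjTranspose]
  · obtain ⟨hp, hq, hpq⟩ := h.1.norm_sq_le U
    rw [conjSuper_smul, conjSuper_sub, conjSuper_one hU]
    have hz := Complex.re_le_norm (conjSuper U Φ !![0, 1; 0, 0] 0 1)
    have hn := norm_nonneg (conjSuper U Φ !![0, 1; 0, 0] 0 1)
    simp only [LinearMap.smul_apply, LinearMap.sub_apply, Matrix.smul_apply, Matrix.sub_apply,
      Module.End.one_apply, smul_eq_mul, Complex.re_ofReal_mul, Complex.sub_re]
    simp only [Matrix.of_apply, Matrix.cons_val', Matrix.cons_val_zero, Matrix.cons_val_one,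
      Matrix.cons_val_fin_one, Matrix.single_apply_same, Complex.one_re]
    have : 2 * (conjSuper U Φ !![0, 1; 0, 0] 0 1).re
        ≤ (conjSuper U Φ (Matrix.single 0 0 1) 0 0).re
          + (conjSuper U Φ (Matrix.single 1 1 1) 1 1).re := by
      nlinarith [sq_nonneg ((conjSuper U Φ (Matrix.single 0 0 1) 0 0).re
        - (conjSuper U Φ (Matrix.single 1 1 1) 1 1).re)]
    have ht' := inv_pos.mpr ht
    nlinarith

/-- All three conditions are closed in the topology of pointwise convergence. -/
theorem condPos_of_frequently {ι : Type*} {l : Filter ι} {D : ι → QubitSuperOp}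
    {L : QubitSuperOp} (hlim : ∀ X, Filter.Tendsto (fun i => D i X) l (nhds (L X)))
    (h : ∃ᶠ i in l, CondPos (D i)) : CondPos L := by
  have hconj : ∀ U X, Filter.Tendsto (fun i => conjSuper U (D i) X) l (nhds (conjSuper U L X)) := by
    intro U X
    simp only [conjSuper_apply]
    exact ((hlim _).const_mul _).mul_const _
  have hentry : ∀ U X s t, Filter.Tendsto (fun i => (conjSuper U (D i) X s t).re) l
      (nhds (conjSuper U L X s t).re) := by
    intro U X s t
    have h1 : Continuous fun Y : QubitOp => (Y s t).re :=
      Complex.continuous_re.comp (continuous_id.matrix_elem s t)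
    exact (h1.tendsto _).comp (hconj U X)
  refine ⟨fun X => ?_, fun X => ?_, fun U hU => ?_⟩
  · have h1 : Continuous fun Y : QubitOp => Y.trace := continuous_id.matrix_trace
    exact isClosed_singleton.mem_of_frequently_of_tendsto (s := {(0 : ℂ)})
      (h.mono fun i hi => hi.trace_eq X) ((h1.tendsto _).comp (hlim X))
  · have h1 : Continuous fun Y : QubitOp => Y.conjTranspose := continuous_id.matrix_conjTranspose
    have h2 : Filter.Tendsto (fun i => D i X.conjTranspose - (D i X).conjTranspose) l
        (nhds (L X.conjTranspose - (L X).conjTranspose)) :=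
      (hlim _).sub ((h1.tendsto _).comp (hlim X))
    exact sub_eq_zero.mp (isClosed_singleton.mem_of_frequently_of_tendsto (s := {(0 : QubitOp)})
      (h.mono fun i hi => sub_eq_zero.mpr (hi.conjTranspose_eq X)) h2)
  · have h1 := ((hentry U (Matrix.single 0 0 1) 0 0).add (hentry U (Matrix.single 1 1 1) 1 1)).sub
      ((hentry U !![0, 1; 0, 0] 0 1).const_mul 2)
    exact sub_nonneg.mp (isClosed_Ici.mem_of_frequently_of_tendsto (s := Set.Ici (0 : ℝ))
      (h.mono fun i hi => sub_nonneg.mpr (hi.dissipative U hU)) h1)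

theorem IsLindbladian.conjSuper {L : QubitSuperOp} (h : IsLindbladian L) {U : QubitOp}
    (hU : U ∈ Matrix.unitaryGroup (Fin 2) ℂ) : IsLindbladian (conjSuper U L) := by
  obtain ⟨H, hH, r, J, hL⟩ := h
  have h1 : U * U.conjTranspose = 1 := Matrix.mem_unitaryGroup_iff.mp hU
  have h2 : U.conjTranspose * U = 1 := Matrix.mem_unitaryGroup_iff'.mp hU
  have h1' (Y : QubitOp) : U * (U.conjTranspose * Y) = Y := by rw [← mul_assoc, h1, one_mul]
  have h2' (Y : QubitOp) : U.conjTranspose * (U * Y) = Y := by rw [← mul_assoc, h2, one_mul]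
  refine ⟨U.conjTranspose * H * U, ?_, r, fun k => U.conjTranspose * J k * U, fun X => ?_⟩
  · exact Matrix.isHermitian_conjTranspose_mul_mul U hH
  · rw [conjSuper_apply, hL]
    simp only [opComm, opDissipator, opMul_eq_mul, mul_add, add_mul, Finset.mul_sum,
      Finset.sum_mul, mul_sub, sub_mul, mul_smul_comm, smul_mul_assoc, Matrix.conjTranspose_mul,
      Matrix.conjTranspose_conjTranspose, mul_assoc, h1', h2', h2, mul_one]

/-- In the dissipativity inequality the anticommutator terms cancel and each jump operator J leaves
|J₀₀ - J₁₁|² ≥ 0. Rotated bases reduce to this one, since the Lindblad form is invariant under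
`conjSuper`. -/
theorem IsLindbladian.condPos {L : QubitSuperOp} (h : IsLindbladian L) : CondPos L := by
  refine ⟨fun X => ?_, fun X => ?_, fun U hU => ?_⟩
  · obtain ⟨H, hH, r, J, hL⟩ := h
    simp only [hL, opComm, opDissipator, opMul_eq_mul, Matrix.trace_add, Matrix.trace_smul,
      Matrix.trace_sub, Matrix.trace_sum]
    rw [Matrix.trace_mul_comm H X, sub_self, smul_zero, zero_add]
    refine Finset.sum_eq_zero fun k _ => ?_
    rw [Matrix.trace_mul_cycle, Matrix.trace_mul_comm X]
    simp only [smul_eq_mul]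
    ring
  · obtain ⟨H, hH, r, J, hL⟩ := h
    simp only [hL, opComm, opDissipator, opMul_eq_mul, Matrix.conjTranspose_add,
      Matrix.conjTranspose_smul, Matrix.conjTranspose_sub, Matrix.conjTranspose_sum,
      Matrix.conjTranspose_mul, Matrix.conjTranspose_conjTranspose, hH.eq, mul_assoc]
    congr 1
    · simp only [star_neg, RCLike.star_def, Complex.conj_I, neg_neg]
      rw [← neg_sub, smul_neg, neg_smul, neg_neg]
    · refine Finset.sum_congr rfl fun k _ => ?_
      have : star (1 / 2 : ℂ) = 1 / 2 := by
        simp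
      rw [this, add_comm (X.conjTranspose * _)]
  · obtain ⟨H, hH, r, J, hL⟩ := h.conjSuper hU
    have hH00 := hH.apply 0 0
    have hH11 := hH.apply 1 1
    have i0 : (H 0 0).im = 0 := by rw [← Complex.conj_eq_iff_im]; exact hH00
    have i1 : (H 1 1).im = 0 := by rw [← Complex.conj_eq_iff_im]; exact hH11
    simp only [hL, opComm, opDissipator, opMul_eq_mul, Matrix.add_apply, Matrix.sum_apply,
      Matrix.smul_apply, Matrix.sub_apply, Complex.add_re, Complex.re_sum, ← single_zero_one]
    -- The Hamiltonian multiplies Eᵢⱼ in its own entry by -i(Hᵢᵢ - Hⱼⱼ), which is imaginary.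
    have hham : ∀ i j : Fin 2, ((-Complex.I) • ((H * Matrix.single i j 1 : QubitOp) i j
        - ((Matrix.single i j 1 : QubitOp) * H) i j)).re = 0 := by
      intro i j
      fin_cases i <;> fin_cases j <;> simp [i0, i1]
    have e01 := hham 0 1
    have e00 := hham 0 0
    have e11 := hham 1 1
    rw [e01, e00, e11, zero_add, zero_add, zero_add, ← Finset.sum_add_distrib, Finset.mul_sum]
    refine Finset.sum_le_sum fun k _ => ?_
    simp [Matrix.mul_apply, Fin.sum_univ_two, Matrix.single]
    nlinarith [sq_nonneg ((J k 0 0).re - (J k 1 1).re), sq_nonneg ((J k 0 0).im - (J k 1 1).im)]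

/-! ### Spectral consequences -/

theorem single_sub_single : (Matrix.single 0 0 1 - Matrix.single 1 1 1 : QubitOp) = sigmaZ := by
  ext i j; fin_cases i <;> fin_cases j <;> simp [Matrix.single, sigmaZ]

/-- Diagonalization of a traceless hermitian eigenvector. -/
theorem exists_conjSuper_sigmaZ {Λ : QubitSuperOp} {μ : ℂ} {H : QubitOp} (h0 : H ≠ 0)
    (hH : H.IsHermitian) (ht : H.trace = 0) (hΛ : Λ H = μ • H) :
    ∃ U ∈ Matrix.unitaryGroup (Fin 2) ℂ, conjSuper U Λ sigmaZ = μ • sigmaZ := by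
  obtain ⟨U, hU, r, hr, e⟩ := exists_unitary_diagonalization hH h0 ht
  refine ⟨U, hU, ?_⟩
  have h2 : U.conjTranspose * U = 1 := Matrix.mem_unitaryGroup_iff'.mp hU
  apply smul_right_injective QubitOp hr
  change r • conjSuper U Λ sigmaZ = r • (μ • sigmaZ)
  rw [← map_smul, conjSuper_apply, ← e, hΛ, e]
  simp only [mul_smul_comm, smul_mul_assoc, mul_assoc, h2, mul_one]
  rw [← mul_assoc, h2, one_mul, smul_comm]

/-- The diagonal entries when `σ_z` is an eigenvector. -/
theorem re_add_re_of_sigmaZ_eigen {Λ : QubitSuperOp} {c μ : ℝ}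
    (htr : ∀ X, (Λ X).trace = (c : ℂ) * X.trace) (hz : Λ sigmaZ = (μ : ℂ) • sigmaZ) :
    (Λ (Matrix.single 0 0 1) 0 0).re + (Λ (Matrix.single 1 1 1) 1 1).re = c + μ := by
  have h1 := htr (Matrix.single 1 1 1)
  rw [← single_sub_single, map_sub] at hz
  have h2 := congrFun (congrFun hz 0) 0
  rw [Matrix.trace, Fin.sum_univ_two, Matrix.trace, Fin.sum_univ_two] at h1
  simp [Matrix.single] at h1 h2
  have h1' := congrArg Complex.re h1
  have h2' := congrArg Complex.re h2
  simp at h1' h2'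
  simp only [Matrix.single]
  linarith

/-- With the eigenvector rotated to σ_z, tr L = μ + 2 Re α, while dissipativity gives 2 Re α ≤ μ.
This is the inequality 1/T₂ ≥ 1/(2T₁) in a form invariant under similarity. -/
theorem CondPos.trace_le {L : QubitSuperOp} (h : CondPos L) {μ : ℝ} {H : QubitOp} (h0 : H ≠ 0)
    (hH : H.IsHermitian) (ht : H.trace = 0) (hL : L H = (μ : ℂ) • H) :
    (LinearMap.trace ℂ QubitOp L).re ≤ 2 * μ := by
  obtain ⟨U, hU, hz⟩ := exists_conjSuper_sigmaZ h0 hH ht hL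
  have htr : ∀ X, (L X).trace = ((0 : ℝ) : ℂ) * X.trace := fun X => by simp [h.trace_eq]
  have htr' := trace_conjSuper_apply hU htr
  have h1 := (trace_det_of_sigmaZ_eigen htr' (conjSuper_conjTranspose U h.conjTranspose_eq) hz).1
  have h2 := re_add_re_of_sigmaZ_eigen htr' hz
  have h3 := h.dissipative U hU
  rw [trace_conjSuper hU] at h1
  rw [h1]
  simp
  linarith

theorem CondPos.exists_charpoly_trace_le {L : QubitSuperOp} (h : CondPos L) :
    ∃ T : Matrix (Fin 3) (Fin 3) ℝ,
      L.charpoly = Polynomial.X * T.charpoly.map Complex.ofRealHom ∧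
      ∀ μ : ℝ, T.charpoly.eval μ = 0 → (LinearMap.trace ℂ QubitOp L).re ≤ 2 * μ := by
  obtain ⟨T, hT, hT'⟩ := exists_blochMatrix L 0 (fun X => by simp [h.trace_eq])
    h.conjTranspose_eq
  refine ⟨T, by simpa using hT, fun μ hμ => ?_⟩
  obtain ⟨H, h0, hH, ht, hL⟩ := hT' μ hμ
  exact h.trace_le h0 hH ht hL

/-- The characteristic polynomial at half the trace. -/
theorem CondPos.charpoly_nonneg {L : QubitSuperOp} (h : CondPos L) {s : ℝ}
    (hs : (LinearMap.trace ℂ QubitOp L) = ((2 * s : ℝ) : ℂ)) (hs0 : s < 0) :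
    0 ≤ (L.charpoly.eval (s : ℂ)).re := by
  obtain ⟨T, hT, hT'⟩ := h.exists_charpoly_trace_le
  have e : (L.charpoly.eval (s : ℂ)).re = s * T.charpoly.eval s := by
    rw [hT, Polynomial.eval_mul, Polynomial.eval_X]
    have : (T.charpoly.map Complex.ofRealHom).eval (s : ℂ) = ((T.charpoly.eval s : ℝ) : ℂ) := by
      rw [Polynomial.eval_map]
      exact Polynomial.eval₂_at_apply Complex.ofRealHom s
    rw [this, ← Complex.ofReal_mul, Complex.ofReal_re]
  rw [e]
  -- As s < 0, the cubic would be positive at s. It tends to -∞ on the left, so it has a root at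
  -- most s and in fact below s, contradicting tr L = 2s ≤ 2μ.
  by_contra! hneg
  have hpos : 0 < T.charpoly.eval s := by nlinarith
  obtain ⟨x, hx, hxs⟩ : ∃ x, x < s ∧ T.charpoly.eval x < 0 := by
    have hmon := T.charpoly_monic
    have hdeg : T.charpoly.natDegree = 3 := by simp [Matrix.charpoly_natDegree_eq_dim]
    have hlim : Filter.Tendsto (fun x => (-(T.charpoly.comp (-Polynomial.X))).eval x)
        Filter.atTop Filter.atTop := by
      apply Polynomial.tendsto_atTop_of_leadingCoeff_nonneg
      · rw [Polynomial.degree_neg]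
        apply Polynomial.natDegree_pos_iff_degree_pos.mp
        rw [Polynomial.natDegree_comp, hdeg]
        simp
      · rw [Polynomial.leadingCoeff_neg, Polynomial.leadingCoeff_comp (by simp), hmon, hdeg]
        simp
        norm_num
    obtain ⟨y, hy1, hy2⟩ := ((hlim.eventually_gt_atTop 0).and
      (Filter.eventually_gt_atTop (-s))).exists
    refine ⟨-y, by linarith, ?_⟩
    simp at hy1
    exact hy1
  obtain ⟨μ, hμ, hμ0⟩ := intermediate_value_Icc hx.le
    (T.charpoly.continuous.continuousOn) (Set.mem_Icc.mpr ⟨hxs.le, hpos.le⟩)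
  have h1 := hT' μ hμ0
  rw [hs, Complex.ofReal_re] at h1
  have h2 : μ = s := le_antisymm hμ.2 (by linarith)
  rw [h2] at hμ0
  exact hpos.ne' hμ0

/-- The spectrum of a Kraus map. -/
theorem IsKrausMap.norm_eigenvalue_le {Φ : QubitSuperOp} (h : IsKrausMap Φ) {z : ℂ} {μ : ℝ}
    (hμ : 0 < μ) (hc : Φ.charpoly = (Polynomial.X - Polynomial.C 1) * (Polynomial.X - Polynomial.C z)
      * (Polynomial.X - Polynomial.C ((starRingEnd ℂ) z))
      * (Polynomial.X - Polynomial.C (μ : ℂ))) : 2 * ‖z‖ ≤ 1 + μ := by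
  obtain ⟨T, hT, hT'⟩ := exists_blochMatrix Φ 1 (fun X => by simp [h.2]) h.1.apply_conjTranspose
  have hroot : T.charpoly.eval μ = 0 := by
    rw [hc, Complex.ofReal_one, mul_assoc, mul_assoc] at hT
    have := mul_left_cancel₀ (Polynomial.X_sub_C_ne_zero (1 : ℂ)) hT
    have h1 := congrArg (Polynomial.eval (μ : ℂ)) this
    rw [Polynomial.eval_map] at h1
    have h2 := Polynomial.eval₂_at_apply (p := T.charpoly) Complex.ofRealHom μ
    change Polynomial.eval₂ Complex.ofRealHom (μ : ℂ) _ = _ at h2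
    rw [h2] at h1
    simp at h1
    exact_mod_cast h1.symm
  obtain ⟨H, h0, hH, ht, hL⟩ := hT' μ hroot
  obtain ⟨U, hU, hz⟩ := exists_conjSuper_sigmaZ h0 hH ht hL
  have htr' := h.conjSuper_trace hU
  have h1 := (trace_det_of_sigmaZ_eigen htr'
    (conjSuper_conjTranspose U h.1.apply_conjTranspose) hz).2
  have h2 := re_add_re_of_sigmaZ_eigen htr' hz
  obtain ⟨hp, hq, hpq⟩ := h.1.norm_sq_le U
  rw [det_conjSuper hU, LinearMap.det_eq_sign_charpoly_coeff, Polynomial.coeff_zero_eq_eval_zero,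
    hc] at h1
  have hfr : Module.finrank ℂ QubitOp = 4 := by simp [Module.finrank_matrix]
  rw [hfr] at h1
  have hzz := Complex.mul_conj' z
  -- The determinant computed in two ways: from the spectrum, and from the rotated map. Cancelling μ
  -- > 0 gives |z| ≤ |α|, which positivity of the Choi matrix bounds by (1 + μ)/2.
  have h3 : ((‖z‖ ^ 2 * μ : ℝ) : ℂ) = ((μ * (‖conjSuper U Φ !![0, 1; 0, 0] 0 1‖ ^ 2
      - ‖conjSuper U Φ !![0, 1; 0, 0] 1 0‖ ^ 2) : ℝ) : ℂ) := by
    push_cast at h1 ⊢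
    simp at h1
    rw [← hzz, ← h1]
    ring
  have h4 := Complex.ofReal_injective h3
  have h5 : ‖z‖ ^ 2 ≤ ‖conjSuper U Φ !![0, 1; 0, 0] 0 1‖ ^ 2 := by
    have : ‖z‖ ^ 2 = ‖conjSuper U Φ !![0, 1; 0, 0] 0 1‖ ^ 2
        - ‖conjSuper U Φ !![0, 1; 0, 0] 1 0‖ ^ 2 := by
      apply mul_left_cancel₀ hμ.ne'
      linarith
    nlinarith [sq_nonneg ‖conjSuper U Φ !![0, 1; 0, 0] 1 0‖]
  have h6 : (2 * ‖z‖) ^ 2 ≤ (1 + μ) ^ 2 := by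
    rw [← h2]
    nlinarith [sq_nonneg ((conjSuper U Φ (Matrix.single 0 0 1) 0 0).re
      - (conjSuper U Φ (Matrix.single 1 1 1) 1 1).re)]
  exact abs_le_of_sq_le_sq' h6 (by positivity) |>.2

end AdiabaticElimination

namespace AdiabaticElimination

/-! ### Exponentials of superoperators -/

section Exponential

attribute [local instance] Matrix.linftyOpNormedRing Matrix.linftyOpNormedAlgebra

/-- The exponential series, evaluated at an operator. -/
theorem hasSum_expSuper (L : QubitSuperOp) (t : ℝ) (X : QubitOp) :
    HasSum (fun n : ℕ => (((n.factorial : ℂ))⁻¹ * (t : ℂ) ^ n) • (L ^ n) X)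
      (expSuper L t X) := by
  let b := Matrix.stdBasis ℂ (Fin 2) (Fin 2)
  let ev : Matrix (Fin 2 × Fin 2) (Fin 2 × Fin 2) ℂ →ₗ[ℂ] QubitOp :=
    (LinearMap.applyₗ X) ∘ₗ (Matrix.toLin b b).toLinearMap
  have hev : Continuous ev := ev.continuous_of_finiteDimensional
  have h1 := (NormedSpace.exp_series_hasSum_exp' (𝕂 := ℂ)
    ((t : ℂ) • LinearMap.toMatrix b b L)).map ev.toAddMonoidHom hev
  have h2 : (⇑ev.toAddMonoidHom ∘ fun n : ℕ =>
      ((n.factorial : ℂ)⁻¹ • ((t : ℂ) • LinearMap.toMatrix b b L) ^ n))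
      = fun n : ℕ => (((n.factorial : ℂ))⁻¹ * (t : ℂ) ^ n) • (L ^ n) X := by
    funext n
    simp only [Function.comp_apply, LinearMap.toAddMonoidHom_coe, map_smul, smul_pow,
      smul_smul]
    simp [ev]
  rw [h2] at h1
  exact h1

theorem tendsto_expSuper (L : QubitSuperOp) (X : QubitOp) :
    Filter.Tendsto (fun t : ℝ => (((t⁻¹ : ℝ) : ℂ) • (expSuper L t - 1)) X)
      (nhdsWithin 0 (Set.Ioi 0)) (nhds (L X)) := by
  let b := Matrix.stdBasis ℂ (Fin 2) (Fin 2)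
  let ev : Matrix (Fin 2 × Fin 2) (Fin 2 × Fin 2) ℂ →ₗ[ℂ] QubitOp :=
    (LinearMap.applyₗ X) ∘ₗ (Matrix.toLin b b).toLinearMap
  have hev : Continuous ev := ev.continuous_of_finiteDimensional
  have h1 := hasDerivAt_exp_smul_const (𝕂 := ℝ) (LinearMap.toMatrix b b L) 0
  rw [zero_smul, NormedSpace.exp_zero, one_mul] at h1
  have h2 := (hev.tendsto _).comp h1.tendsto_slope_zero_right
  have h3 : ev (LinearMap.toMatrix b b L) = L X := by simp [ev]
  rw [h3] at h2
  refine h2.congr fun t => ?_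
  simp only [Function.comp_apply, zero_add, zero_smul, NormedSpace.exp_zero]
  have h4 (Y : Matrix (Fin 2 × Fin 2) (Fin 2 × Fin 2) ℂ) :
      ev (t⁻¹ • Y) = ((t⁻¹ : ℝ) : ℂ) • ev Y := by
    rw [← map_smul, Complex.coe_smul]
  rw [h4, map_sub]
  simp only [ev, expSuper, LinearMap.smul_apply, LinearMap.sub_apply, LinearMap.coe_comp,
    Function.comp_apply, LinearMap.applyₗ_apply_apply, LinearEquiv.coe_coe, Matrix.toLin_one,
    LinearMap.id_apply, Module.End.one_apply, Complex.coe_smul]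
  rfl

end Exponential

theorem expSuper_apply_eigen {L : QubitSuperOp} {μ : ℂ} {X : QubitOp} (h : L X = μ • X) (t : ℝ) :
    expSuper L t X = Complex.exp ((t : ℂ) * μ) • X := by
  have hp : ∀ n : ℕ, (L ^ n) X = μ ^ n • X := by
    intro n
    induction n with
    | zero => simp
    | succ n ih => rw [pow_succ, Module.End.mul_apply, h, map_smul, ih, smul_smul, pow_succ']
  have h1 := hasSum_expSuper L t X
  have h2 : HasSum (fun n : ℕ => ((t : ℂ) * μ) ^ n / (n.factorial : ℂ))
      (Complex.exp ((t : ℂ) * μ)) := by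
    rw [Complex.exp_eq_exp_ℂ]
    exact NormedSpace.expSeries_div_hasSum_exp _
  refine h1.unique ((h2.smul_const X).congr_fun fun n => ?_)
  rw [hp, smul_smul, mul_pow]
  congr 1
  ring

theorem trace_expSuper {L : QubitSuperOp} (h : ∀ X, (L X).trace = 0) (t : ℝ) (X : QubitOp) :
    (expSuper L t X).trace = X.trace := by
  have h1 := (hasSum_expSuper L t X).map (Matrix.traceAddMonoidHom (Fin 2) ℂ)
    (continuous_id.matrix_trace)
  refine h1.unique ?_
  convert hasSum_single (f := (⇑(Matrix.traceAddMonoidHom (Fin 2) ℂ) ∘ fun n : ℕ =>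
    (((n.factorial : ℂ))⁻¹ * (t : ℂ) ^ n) • (L ^ n) X)) 0 fun n hn => ?_ using 1
  · simp
  · obtain ⟨m, rfl⟩ := Nat.exists_eq_succ_of_ne_zero hn
    simp [pow_succ', Module.End.mul_apply, h]

theorem gaugeTransform_pow {G : QubitSuperOp} (hG : IsUnit (1 + G)) (L : QubitSuperOp) (n : ℕ) :
    gaugeTransform G L ^ n = gaugeTransform G (L ^ n) := by
  induction n with
  | zero => simp [gaugeTransform, Ring.inverse_mul_cancel _ hG]
  | succ n ih =>
    rw [pow_succ, ih, pow_succ]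
    simp only [gaugeTransform, mul_assoc]
    rw [Ring.mul_inverse_cancel_left _ _ hG]

/-- The similarity is multiplicative on powers, so it passes through the exponential series by
continuity. -/
theorem expSuper_gaugeTransform {G : QubitSuperOp} (hG : IsUnit (1 + G)) (L : QubitSuperOp)
    (t : ℝ) : expSuper (gaugeTransform G L) t = gaugeTransform G (expSuper L t) := by
  refine LinearMap.ext fun X => ?_
  have h1 := (hasSum_expSuper L t ((1 + G) X)).map (Ring.inverse (1 + G)).toAddMonoidHom
    ((Ring.inverse (1 + G)).continuous_of_finiteDimensional)
  refine (hasSum_expSuper (gaugeTransform G L) t X).unique (h1.congr_fun fun n => ?_)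
  rw [gaugeTransform_pow hG]
  simp [gaugeTransform, Module.End.mul_apply]

theorem charpoly_gaugeTransform {G : QubitSuperOp} (hG : IsUnit (1 + G)) (L : QubitSuperOp) :
    (gaugeTransform G L).charpoly = L.charpoly := by
  obtain ⟨u, hu⟩ := hG
  let e : QubitOp ≃ₗ[ℂ] QubitOp := LinearMap.GeneralLinearGroup.toLinearEquiv u
  have : gaugeTransform G L = e.symm.conj L := by
    rw [gaugeTransform, ← hu, Ring.inverse_unit]
    rfl
  rw [this, LinearEquiv.charpoly_conj]

theorem trace_gaugeTransform {G : QubitSuperOp} (hG : IsUnit (1 + G)) (L : QubitSuperOp) :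
    LinearMap.trace ℂ QubitOp (gaugeTransform G L) = LinearMap.trace ℂ QubitOp L := by
  rw [gaugeTransform, mul_assoc, LinearMap.trace_mul_comm, mul_assoc, Ring.mul_inverse_cancel _ hG,
    mul_one]

/-! ### Superoperators that are diagonal in `σ_z`, `σ₊`, `σ₋` -/

/-- In the basis E₁₁, σ_z, σ₊, σ₋ the last three vectors are eigenvectors and the trace condition
determines the top row. The matrix is lower triangular, so the image of E₁₁ need not be known. -/
theorem charpoly_of_eigen {Λ : QubitSuperOp} {c a b d : ℂ}
    (htr : ∀ X, (Λ X).trace = c * X.trace) (hz : Λ sigmaZ = a • sigmaZ)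
    (hp : Λ sigmaPlus = b • sigmaPlus) (hm : Λ sigmaMinus = d • sigmaMinus) :
    Λ.charpoly = (Polynomial.X - Polynomial.C c) * (Polynomial.X - Polynomial.C a)
      * (Polynomial.X - Polynomial.C b) * (Polynomial.X - Polynomial.C d) ∧
    LinearMap.trace ℂ QubitOp Λ = c + a + b + d := by
  let B := Module.Basis.ofEquivFun traceEquiv
  have ht : ∀ X, Λ X 0 0 + Λ X 1 1 = c * (X 0 0 + X 1 1) := fun X => by
    simpa [Matrix.trace, Fin.sum_univ_two] using htr X
  change Λ !![0, 1; 0, 0] = b • !![0, 1; 0, 0] at hp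
  change Λ !![0, 0; 1, 0] = d • !![0, 0; 1, 0] at hm
  have hdiag : ∀ i, LinearMap.toMatrix B B Λ i i = ![c, a, b, d] i := by
    intro i
    rw [toMatrix_traceEquiv]
    fin_cases i <;> simp [traceEquiv, hz, hp, hm, ht]
    simp [sigmaZ]
  constructor
  · have hup : (LinearMap.toMatrix B B Λ).transpose.IsUpperTriangular := by
      intro i j hij
      rw [Matrix.transpose_apply, toMatrix_traceEquiv]
      fin_cases i <;> fin_cases j <;> simp at hij <;> simp [traceEquiv, hp, hm, ht, sigmaZ]
    rw [← LinearMap.charpoly_toMatrix Λ B, ← Matrix.charpoly_transpose,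
      Matrix.charpoly_of_isUpperTriangular _ hup, Fin.prod_univ_four]
    simp only [Matrix.transpose_apply, hdiag]
    rfl
  · rw [LinearMap.trace_eq_matrix_trace ℂ B, Matrix.trace, Fin.sum_univ_four]
    simp only [Matrix.diag_apply, hdiag]
    rfl

section

variable {γ Δ ν κ : ℝ} {K : ℕ → QubitOp →ₗ[ℂ] TotOp} {L : ℕ → QubitSuperOp}

theorem IsAdiabaticElimination.truncated_four_eigen (hγ : 0 < γ) (hν : 0 < ν)
    (h : IsAdiabaticElimination γ Δ ν κ (fun _ => 0) K L) (ε : ℝ) :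
    (∀ X, (truncatedGenerator L 4 ε X).trace = 0) ∧
    truncatedGenerator L 4 ε sigmaZ = (-(rateOne γ Δ ν (ε * κ) : ℂ)) • sigmaZ ∧
    truncatedGenerator L 4 ε sigmaPlus = (-(rateTwo γ Δ ν (ε * κ) : ℂ)
      - Complex.I * (omegaB γ Δ ν (ε * κ) : ℂ)) • sigmaPlus ∧
    truncatedGenerator L 4 ε sigmaMinus = (-(rateTwo γ Δ ν (ε * κ) : ℂ)
      + Complex.I * (omegaB γ Δ ν (ε * κ) : ℂ)) • sigmaMinus := by
  have hX (a b c d : ℂ) := (h.truncated_four_apply hγ hν ε !![a, b; c, d]).trans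
    (lindbladForm_of _ _ _ _ a b c d)
  refine ⟨fun X => ?_, (hX 1 0 0 (-1)).trans ?_, (hX 0 1 0 0).trans ?_, (hX 0 0 1 0).trans ?_⟩
  · rw [Matrix.eta_fin_two X, hX, Matrix.trace_fin_two]
    simp
  all_goals
    ext i j
    fin_cases i <;> fin_cases j <;> simp [sigmaZ, sigmaPlus, sigmaMinus, rateOne, rateTwo]
    all_goals ring

theorem IsAdiabaticElimination.charpoly_truncated_four (hγ : 0 < γ) (hν : 0 < ν)
    (h : IsAdiabaticElimination γ Δ ν κ (fun _ => 0) K L) (ε : ℝ) :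
    (truncatedGenerator L 4 ε).charpoly = Polynomial.X
        * (Polynomial.X - Polynomial.C (-(rateOne γ Δ ν (ε * κ) : ℂ)))
        * (Polynomial.X - Polynomial.C (-(rateTwo γ Δ ν (ε * κ) : ℂ)
          - Complex.I * (omegaB γ Δ ν (ε * κ) : ℂ)))
        * (Polynomial.X - Polynomial.C (-(rateTwo γ Δ ν (ε * κ) : ℂ)
          + Complex.I * (omegaB γ Δ ν (ε * κ) : ℂ))) ∧
    LinearMap.trace ℂ QubitOp (truncatedGenerator L 4 ε)
      = ((-rateOne γ Δ ν (ε * κ) - 2 * rateTwo γ Δ ν (ε * κ) : ℝ) : ℂ) := by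
  obtain ⟨ht, hz, hp, hm⟩ := h.truncated_four_eigen hγ hν ε
  obtain ⟨h1, h2⟩ := charpoly_of_eigen (c := 0) (fun X => by rw [ht, zero_mul]) hz hp hm
  refine ⟨by rw [h1, Polynomial.C_0, sub_zero], h2.trans ?_⟩
  push_cast
  ring

theorem IsAdiabaticElimination.charpoly_expSuper_truncated_four (hγ : 0 < γ) (hν : 0 < ν)
    (h : IsAdiabaticElimination γ Δ ν κ (fun _ => 0) K L) (ε t : ℝ) :
    (expSuper (truncatedGenerator L 4 ε) t).charpoly = spectrumPoly γ Δ ν (ε * κ) t := by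
  obtain ⟨ht, hz, hp, hm⟩ := h.truncated_four_eigen hγ hν ε
  rw [(charpoly_of_eigen (c := 1) (fun X => by rw [trace_expSuper ht, one_mul])
    (expSuper_apply_eigen hz t) (expSuper_apply_eigen hp t) (expSuper_apply_eigen hm t)).1,
    spectrumPoly]
  have e1 (x y : ℂ) : (t : ℂ) * (-x - Complex.I * y) = -(t : ℂ) * x - Complex.I * y * t := by ring
  have e2 (x y : ℂ) : (t : ℂ) * (-x + Complex.I * y) = -(t : ℂ) * x + Complex.I * y * t := by ring
  have e3 (x : ℂ) : (t : ℂ) * (-x) = -(t : ℂ) * x := by ring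
  rw [e1, e2, e3]
  ring

/-- The polynomial `3 - 6 x - x²` in `x = (2Δ/γ)²` is positive below its root `2√3 - 3`. -/
theorem gammaPhi_neg (hγ : 0 < γ) (hν : 0 < ν)
    (hΔ : |Δ| / γ < Real.sqrt (2 * Real.sqrt 3 - 3) / 2) {g : ℝ} (hg : g ≠ 0) :
    gammaPhi γ Δ ν g < 0 := by
  have h3 : Real.sqrt 3 ^ 2 = 3 := Real.sq_sqrt (by norm_num)
  have h30 := Real.sqrt_nonneg 3
  have h3' : 0 ≤ 2 * Real.sqrt 3 - 3 := by nlinarith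
  have hx : (2 * Δ / γ) ^ 2 < 2 * Real.sqrt 3 - 3 := by
    have h1 : |2 * Δ / γ| < Real.sqrt (2 * Real.sqrt 3 - 3) := by
      rw [abs_div, abs_mul, abs_of_pos hγ, abs_two, mul_div_assoc]
      linarith
    have h2 := pow_lt_pow_left₀ h1 (abs_nonneg _) two_ne_zero
    rwa [sq_abs, Real.sq_sqrt h3'] at h2
  -- The roots of 3 - 6x - x² are ±2√3 - 3, and x = (2Δ/γ)² lies between 0 and the positive one.
  have hq : 0 < 3 - 6 * (2 * Δ / γ) ^ 2 - (2 * Δ / γ) ^ 4 := by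
    rw [show (2 * Δ / γ) ^ 4 = ((2 * Δ / γ) ^ 2) ^ 2 by ring]
    nlinarith [sq_nonneg (2 * Δ / γ)]
  have hg4 : 0 < g ^ 4 := by positivity
  rw [gammaPhi, neg_div, neg_lt_zero]
  positivity

theorem spectrumPoly_eq (γ Δ ν g t : ℝ) : ∃ z : ℂ,
    ‖z‖ = Real.exp (-t * rateTwo γ Δ ν g) ∧
    spectrumPoly γ Δ ν g t = (Polynomial.X - Polynomial.C 1) * (Polynomial.X - Polynomial.C z)
      * (Polynomial.X - Polynomial.C ((starRingEnd ℂ) z))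
      * (Polynomial.X - Polynomial.C ((Real.exp (-t * rateOne γ Δ ν g) : ℝ) : ℂ)) := by
  refine ⟨Complex.exp (-(t : ℂ) * (rateTwo γ Δ ν g : ℂ)
          + Complex.I * (omegaB γ Δ ν g : ℂ) * (t : ℂ)), ?_, ?_⟩
  · rw [Complex.norm_exp]
    simp
  · rw [← Complex.exp_conj, spectrumPoly]
    simp [sub_eq_add_neg]

/-- At t = 0 the difference 2e^(-tb) - e^(-ta) equals 1 and has derivative a - 2b > 0. -/
theorem exists_time_lt {a b : ℝ} (hab : 2 * b < a) :
    ∃ t₀ : ℝ, 0 < t₀ ∧ ∀ t : ℝ, 0 < t → t < t₀ →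
      1 + Real.exp (-t * a) < 2 * Real.exp (-t * b) := by
  have h1 (c : ℝ) : HasDerivAt (fun t : ℝ => Real.exp (-t * c)) (-c) 0 := by
    simpa using (((hasDerivAt_id (0 : ℝ)).neg.mul_const c).exp)
  have h2 : HasDerivAt (fun t : ℝ => 2 * Real.exp (-t * b) - Real.exp (-t * a))
      (2 * -b - -a) 0 := ((h1 b).const_mul 2).sub (h1 a)
  have h3 := (hasDerivAt_iff_tendsto_slope_zero.mp h2).mono_left
    (nhdsWithin_mono 0 (fun t (ht : t ∈ Set.Ioi (0 : ℝ)) => ne_of_gt ht))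
  have h4 := h3.eventually_const_lt (show (0 : ℝ) < 2 * -b - -a by linarith)
  obtain ⟨t₀, ht₀, h5⟩ := mem_nhdsGT_iff_exists_Ioo_subset.mp h4
  refine ⟨t₀, ht₀, fun t ht htt => ?_⟩
  have h6 := h5 ⟨ht, htt⟩
  simp only [Set.mem_ofPred_eq, zero_add, smul_eq_mul, neg_zero, zero_mul, Real.exp_zero] at h6
  have h7 := (mul_pos_iff_of_pos_left (inv_pos.mpr ht)).mp h6
  linarith

/-- A generator whose spectrum violates the bound on the relaxation times. -/
theorem not_condPos_of_charpoly {L : QubitSuperOp} {r s ω φ : ℝ} (hφ : φ < 0)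
    (hs : s = r / 2 + 2 * φ) (hc : L.charpoly = Polynomial.X
      * (Polynomial.X - Polynomial.C (-(r : ℂ)))
      * (Polynomial.X - Polynomial.C (-(s : ℂ) - Complex.I * (ω : ℂ)))
      * (Polynomial.X - Polynomial.C (-(s : ℂ) + Complex.I * (ω : ℂ))))
    (ht : LinearMap.trace ℂ QubitOp L = ((-r - 2 * s : ℝ) : ℂ)) : ¬ CondPos L := by
  intro h
  obtain ⟨T, hT, hT'⟩ := h.exists_charpoly_trace_le
  -- The trace bound at the longitudinal eigenvalue -r reads -r - 2s ≤ -2r, that is φ ≥ 0.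
  have hroot : T.charpoly.eval (-r) = 0 := by
    rw [hc, mul_assoc, mul_assoc] at hT
    have h1 := congrArg (Polynomial.eval ((-r : ℝ) : ℂ)) (mul_left_cancel₀ Polynomial.X_ne_zero hT)
    rw [Polynomial.eval_map] at h1
    have h2 := Polynomial.eval₂_at_apply (p := T.charpoly) Complex.ofRealHom (-r)
    change Polynomial.eval₂ Complex.ofRealHom ((-r : ℝ) : ℂ) _ = _ at h2
    rw [h2] at h1
    simp at h1
    exact_mod_cast h1.symm
  have h1 := hT' _ hroot
  rw [ht, Complex.ofReal_re] at h1
  linarith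

end

end AdiabaticElimination

namespace AdiabaticElimination

/-! ### Perturbation of similarity invariants -/

section Perturbation

variable {ι : Type*} [Fintype ι] [DecidableEq ι]

/-- The characteristic polynomial of a matrix, evaluated at half its trace. -/
noncomputable def detHalfTrace (M : Matrix ι ι ℂ) : ℂ :=
  M.charpoly.eval (M.trace / 2)

theorem detHalfTrace_eq (M : Matrix ι ι ℂ) :
    detHalfTrace M = ((M.trace / 2) • (1 : Matrix ι ι ℂ) - M).det := by
  rw [detHalfTrace, Matrix.eval_charpoly]
  congr 2
  rw [Matrix.scalar_apply, Matrix.smul_one_eq_diagonal]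

theorem detHalfTrace_smul (c : ℂ) (M : Matrix ι ι ℂ) :
    detHalfTrace (c • M) = c ^ Fintype.card ι * detHalfTrace M := by
  rw [detHalfTrace_eq, detHalfTrace_eq, ← Matrix.det_smul, smul_sub, smul_smul, Matrix.trace_smul,
    smul_eq_mul, mul_div_assoc]

/-- Similarity invariance, together with smoothness in the entries, is the reason for using this
quantity instead of individual eigenvalues, which need not be differentiable. -/
theorem detHalfTrace_conj {P Q : Matrix ι ι ℂ} (h : Q * P = 1) (M : Matrix ι ι ℂ) :
    detHalfTrace (P * M * Q) = detHalfTrace M := by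
  have h' : P * Q = 1 := mul_eq_one_comm.mp h
  let u : (Matrix ι ι ℂ)ˣ := ⟨P, Q, h', h⟩
  have hu : (u : Matrix ι ι ℂ)⁻¹ = Q := Matrix.inv_eq_right_inv h'
  have h1 : (P * M * Q).charpoly = M.charpoly := by
    rw [← Matrix.charpoly_units_conj u M, hu]
  have h2 : (P * M * Q).trace = M.trace := by rw [Matrix.trace_mul_cycle, h, one_mul]
  rw [detHalfTrace, h1, h2, detHalfTrace]

attribute [local instance] Matrix.linftyOpNormedRing Matrix.linftyOpNormedAlgebra

theorem contDiff_entry (i j : ι) : ContDiff ℝ 1 fun M : Matrix ι ι ℂ => M i j :=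
  ((Matrix.entryLinearMap ℝ ℂ i j).toContinuousLinearMap).contDiff

theorem contDiff_trace : ContDiff ℝ 1 fun M : Matrix ι ι ℂ => M.trace :=
  ContDiff.sum fun i _ => contDiff_entry i i

theorem contDiff_detHalfTrace : ContDiff ℝ 1 (detHalfTrace : Matrix ι ι ℂ → ℂ) := by
  have h : (detHalfTrace : Matrix ι ι ℂ → ℂ)
      = fun M => ((M.trace / 2) • (1 : Matrix ι ι ℂ) - M).det := funext detHalfTrace_eq
  rw [h]
  simp only [Matrix.det_apply]
  refine ContDiff.sum fun σ _ => ContDiff.const_smul _ (contDiff_prod fun i _ => ?_)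
  exact (((contDiff_trace (ι := ι)).div_const 2).mul contDiff_const).sub (contDiff_entry _ _)

/-- Generators that are similar up to third order have the same invariants up to third order. -/
theorem exists_invariant_bound {f : Matrix ι ι ℂ → ℂ} (hf : ContDiff ℝ 1 f)
    (hconj : ∀ P Q M : Matrix ι ι ℂ, Q * P = 1 → f (P * M * Q) = f M)
    {A B P R : ℝ → Matrix ι ι ℂ} (hA : Continuous A) (hP : Continuous P) (hR : Continuous R)
    (hP0 : P 0 = 1)
    (h : ∀ ε, 0 < ε → P ε * B ε = A ε * P ε + ε ^ 3 • R ε) :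
    ∃ C : ℝ, ∀ᶠ ε in nhdsWithin (0 : ℝ) (Set.Ioi 0), ‖f (B ε) - f (A ε)‖ ≤ C * ε ^ 3 := by
  have hQ : ContinuousAt (fun ε => Ring.inverse (P ε)) 0 := by
    have h1 := NormedRing.inverse_continuousAt (1 : (Matrix ι ι ℂ)ˣ)
    rw [Units.val_one, ← hP0] at h1
    exact ContinuousAt.comp (f := P) (x := (0 : ℝ)) h1 hP.continuousAt
  have hunit : ∀ᶠ ε in nhds (0 : ℝ), IsUnit (P ε) := by
    have h1 : {x : Matrix ι ι ℂ | IsUnit x} ∈ nhds (P 0) :=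
      Units.isOpen.mem_nhds (by rw [hP0]; exact isUnit_one)
    exact hP.continuousAt h1
  have hE : ContinuousAt (fun ε => R ε * Ring.inverse (P ε)) 0 := hR.continuousAt.mul hQ
  -- Near A 0 the function f is Lipschitz, and P B P⁻¹ = A + ε³ R P⁻¹ with R P⁻¹ bounded for small
  -- ε.
  obtain ⟨κ, s, hs, hlip⟩ := (hf.contDiffAt (x := A 0)).exists_lipschitzOnWith
  have hA' : ∀ᶠ ε in nhds (0 : ℝ), A ε ∈ s := hA.continuousAt hs
  have hAE : ContinuousAt (fun ε => A ε + ε ^ 3 • (R ε * Ring.inverse (P ε))) 0 :=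
    hA.continuousAt.add ((continuousAt_id.pow 3).smul hE)
  have hAE' : ∀ᶠ ε in nhds (0 : ℝ), A ε + ε ^ 3 • (R ε * Ring.inverse (P ε)) ∈ s := by
    have e : A 0 + (0 : ℝ) ^ 3 • (R 0 * Ring.inverse (P 0)) = A 0 := by simp
    exact hAE.tendsto.eventually_mem (by rw [e]; exact hs)
  set c := ‖R 0 * Ring.inverse (P 0)‖ + 1 with hc
  have hbd : ∀ᶠ ε in nhds (0 : ℝ), ‖R ε * Ring.inverse (P ε)‖ < c :=
    hE.norm.eventually_lt_const (by rw [hc]; exact lt_add_one _)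
  refine ⟨κ * c, ?_⟩
  filter_upwards [nhdsWithin_le_nhds (hunit.and (hA'.and (hAE'.and hbd))), self_mem_nhdsWithin]
    with ε ⟨h1, h2, h3, h4⟩ (hε : 0 < ε)
  have h5 : P ε * B ε * Ring.inverse (P ε) = A ε + ε ^ 3 • (R ε * Ring.inverse (P ε)) := by
    rw [h ε hε, add_mul, mul_assoc, Ring.mul_inverse_cancel _ h1, mul_one, smul_mul_assoc]
  rw [← hconj (P ε) (Ring.inverse (P ε)) (B ε) (Ring.inverse_mul_cancel _ h1), h5]
  refine (hlip.norm_sub_le h3 h2).trans ?_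
  rw [add_sub_cancel_left, norm_smul, Real.norm_eq_abs, abs_of_pos (pow_pos hε 3), mul_assoc]
  have : ε ^ 3 * ‖R ε * Ring.inverse (P ε)‖ ≤ c * ε ^ 3 := by
    rw [mul_comm]
    exact mul_le_mul_of_nonneg_right h4.le (pow_pos hε 3).le
  exact mul_le_mul_of_nonneg_left this κ.2

end Perturbation

/-! ### The invariants of a generator -/

/-- The matrix of a superoperator. -/
noncomputable def superMatrix : QubitSuperOp ≃ₐ[ℂ] Matrix (Fin 2 × Fin 2) (Fin 2 × Fin 2) ℂ :=
  LinearMap.toMatrixAlgEquiv (Matrix.stdBasis ℂ (Fin 2) (Fin 2))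

theorem charpoly_superMatrix (L : QubitSuperOp) : (superMatrix L).charpoly = L.charpoly :=
  LinearMap.charpoly_toMatrix L (Matrix.stdBasis ℂ (Fin 2) (Fin 2))

theorem trace_superMatrix (L : QubitSuperOp) :
    (superMatrix L).trace = LinearMap.trace ℂ QubitOp L :=
  (LinearMap.trace_eq_matrix_trace ℂ (Matrix.stdBasis ℂ (Fin 2) (Fin 2)) L).symm

theorem CondPos.trace_im {L : QubitSuperOp} (h : CondPos L) :
    (LinearMap.trace ℂ QubitOp L).im = 0 := by
  obtain ⟨T, hT, -⟩ := h.exists_charpoly_trace_le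
  rw [← trace_superMatrix, Matrix.trace_eq_neg_charpoly_coeff, charpoly_superMatrix, hT]
  simp

theorem CondPos.detHalfTrace_nonneg {L : QubitSuperOp} (h : CondPos L)
    (ht : (superMatrix L).trace.re < 0) : 0 ≤ (detHalfTrace (superMatrix L)).re := by
  rw [trace_superMatrix] at ht
  have h1 : LinearMap.trace ℂ QubitOp L
      = ((2 * ((LinearMap.trace ℂ QubitOp L).re / 2) : ℝ) : ℂ) := by
    rw [mul_div_cancel₀ _ two_ne_zero]
    exact Complex.ext (by simp) (by simp [h.trace_im])
  have h2 := h.charpoly_nonneg h1 (by linarith)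
  rw [detHalfTrace, charpoly_superMatrix, trace_superMatrix, h1]
  convert h2 using 3
  push_cast
  ring

/-- Half the trace is -r - 2φ; its distances to the eigenvalues are -r - 2φ, -2φ and -r/2 ± iω. As
long as r + 2φ > 0 and r ≠ 0 the product has the sign of φ. -/
theorem detHalfTrace_of_charpoly {L : QubitSuperOp} {r s ω φ : ℝ}
    (hs : s = r / 2 + 2 * φ) (hc : L.charpoly = Polynomial.X
      * (Polynomial.X - Polynomial.C (-(r : ℂ)))
      * (Polynomial.X - Polynomial.C (-(s : ℂ) - Complex.I * (ω : ℂ)))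
      * (Polynomial.X - Polynomial.C (-(s : ℂ) + Complex.I * (ω : ℂ))))
    (ht : LinearMap.trace ℂ QubitOp L = ((-r - 2 * s : ℝ) : ℂ)) :
    detHalfTrace (superMatrix L) = ((2 * φ * (r + 2 * φ) * (r ^ 2 / 4 + ω ^ 2) : ℝ) : ℂ) := by
  rw [detHalfTrace, charpoly_superMatrix, trace_superMatrix, hc, ht, hs]
  simp only [Polynomial.eval_mul, Polynomial.eval_sub, Polynomial.eval_X, Polynomial.eval_C]
  push_cast
  ring_nf
  simp only [Complex.I_sq]
  ring

section

variable {γ Δ ν κ : ℝ} {K K₀ : ℕ → QubitOp →ₗ[ℂ] TotOp} {L L₀ : ℕ → QubitSuperOp}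
  {G : ℕ → QubitSuperOp}

theorem gammaPhi_mul (γ Δ ν κ ε : ℝ) :
    gammaPhi γ Δ ν (ε * κ) = ε ^ 4 * gammaPhi γ Δ ν κ := by
  simp only [gammaPhi]; ring

theorem exists_rateOne_expansion (hγ : 0 < γ) (hν : 0 < ν) (hκ : κ ≠ 0) :
    ∃ ρ₀ ρ₁ : ℝ, 0 < ρ₀ ∧ ∀ ε, rateOne γ Δ ν (ε * κ) = ε ^ 2 * ρ₀ + ε ^ 4 * ρ₁ := by
  have hb : ∀ n : ℝ, ∃ b₁ : ℂ, ∀ ε : ℝ, bCoeff γ Δ ν (ε * κ) n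
      = ((ε ^ 2 * (2 * κ ^ 2 * n) : ℝ) : ℂ) * (gammaBar γ Δ)⁻¹ + ((ε ^ 4 : ℝ) : ℂ) * b₁ := by
    intro n
    refine ⟨bCoeff γ Δ ν κ n - ((2 * κ ^ 2 * n : ℝ) : ℂ) * (gammaBar γ Δ)⁻¹, fun ε => ?_⟩
    simp only [bCoeff]
    push_cast
    ring
  obtain ⟨b₁, h1⟩ := hb (1 + ν)
  obtain ⟨b₂, h2⟩ := hb ν
  have hre : 0 < ((gammaBar γ Δ)⁻¹).re := by
    have hg : (gammaBar γ Δ).re = γ := by simp [gammaBar]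
    rw [Complex.inv_re, hg]
    refine div_pos hγ (Complex.normSq_pos.mpr fun h0 => ?_)
    rw [h0] at hg
    exact hγ.ne hg
  refine ⟨2 * (2 * κ ^ 2 * (1 + 2 * ν)) * ((gammaBar γ Δ)⁻¹).re, 2 * (b₁ + b₂).re, by positivity,
    fun ε => ?_⟩
  rw [rateOne, gammaMinus, gammaPlus, h1, h2]
  simp only [Complex.add_re, Complex.re_ofReal_mul]
  ring

/-- The invariants of the fourth-order partial-trace generator, rescaled by `ε²`. -/
theorem IsAdiabaticElimination.eventually_invariants (hγ : 0 < γ) (hν : 0 < ν) (hκ : κ ≠ 0)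
    (hφ : gammaPhi γ Δ ν κ < 0) (h : IsAdiabaticElimination γ Δ ν κ (fun _ => 0) K L) :
    ∃ k : ℝ, 0 < k ∧ ∀ᶠ ε : ℝ in nhdsWithin (0 : ℝ) (Set.Ioi 0),
      (superMatrix (L 2 + (ε : ℂ) ^ 2 • L 4)).trace.re ≤ -k ∧
      (detHalfTrace (superMatrix (L 2 + (ε : ℂ) ^ 2 • L 4))).re ≤ -k * ε ^ 2 := by
  obtain ⟨ρ₀, ρ₁, hρ, hr⟩ := exists_rateOne_expansion (Δ := Δ) hγ hν hκ
  set c := -gammaPhi γ Δ ν κ with hc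
  have hc0 : 0 < c := by rw [hc]; linarith
  have hcφ : gammaPhi γ Δ ν κ = -c := by rw [hc, neg_neg]
  -- Both brackets ρ₀ + O(ε²) are eventually at least ρ₀/2, so the rescaled trace is at most -ρ₀. In
  -- the invariant, 2c · (ρ₀/2) · (ρ₀²/16) = cρ₀³/16.
  refine ⟨min ρ₀ (c * ρ₀ ^ 3 / 16), by positivity, ?_⟩
  have hlim (x : ℝ) : ∀ᶠ ε in nhdsWithin (0 : ℝ) (Set.Ioi 0), ρ₀ / 2 < ρ₀ + ε ^ 2 * x := by
    have : Continuous fun ε : ℝ => ρ₀ + ε ^ 2 * x := by fun_prop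
    exact nhdsWithin_le_nhds (this.continuousAt.eventually_const_lt (by simp; linarith))
  have hpos : ∀ᶠ ε in nhdsWithin (0 : ℝ) (Set.Ioi 0), 0 < ε := eventually_mem_nhdsWithin
  filter_upwards [hlim ρ₁, hlim (ρ₁ - 2 * c), hpos] with ε h1 h2 hε
  obtain ⟨hchar, htr⟩ := h.charpoly_truncated_four hγ hν ε
  have hdet := detHalfTrace_of_charpoly rfl hchar htr
  have hT : truncatedGenerator L 4 ε = ((ε ^ 2 : ℝ) : ℂ) • (L 2 + (ε : ℂ) ^ 2 • L 4) := by
    rw [h.truncated_four hγ hν, smul_add, smul_smul]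
    push_cast
    ring_nf
  rw [← trace_superMatrix, hT, map_smul, Matrix.trace_smul, smul_eq_mul] at htr
  rw [hT, map_smul, detHalfTrace_smul] at hdet
  have htr' := congrArg Complex.re htr
  have hdet' := congrArg Complex.re hdet
  rw [Complex.re_ofReal_mul, Complex.ofReal_re, rateTwo, gammaPhi_mul, hr, hcφ] at htr'
  rw [← Complex.ofReal_pow, Complex.re_ofReal_mul, Complex.ofReal_re, gammaPhi_mul, hr, hcφ]
    at hdet'
  have hcard : Fintype.card (Fin 2 × Fin 2) = 4 := by simp
  rw [hcard] at hdet'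
  have hε2 : 0 < ε ^ 2 := by positivity
  generalize (superMatrix (L 2 + (ε : ℂ) ^ 2 • L 4)).trace.re = x at *
  generalize (detHalfTrace (superMatrix (L 2 + (ε : ℂ) ^ 2 • L 4))).re = y at *
  generalize omegaB γ Δ ν (ε * κ) = ω at *
  constructor
  · have hx : x = -2 * (ρ₀ + ε ^ 2 * (ρ₁ - 2 * c)) := by
      apply mul_left_cancel₀ hε2.ne'
      rw [htr']
      ring
    have := min_le_left ρ₀ (c * ρ₀ ^ 3 / 16)
    linarith
  -- The invariant is homogeneous of degree 4, so rescaling by ε² gives ε⁸. The right-hand side is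
  -- of order at least ε¹⁰, because the leading second-order part vanishes: half its trace is its
  -- longitudinal eigenvalue.
  · have hy : y * ε ^ 8 = -(2 * c * ε ^ 6 * (ρ₀ + ε ^ 2 * (ρ₁ - 2 * c)))
        * ((ε ^ 2 * (ρ₀ + ε ^ 2 * ρ₁)) ^ 2 / 4 + ω ^ 2) := by
      rw [← show (ε ^ 2) ^ 4 * y = y * ε ^ 8 by ring, hdet']
      ring
    have h3 : ε ^ 4 * (ρ₀ ^ 2 / 16)
        ≤ (ε ^ 2 * (ρ₀ + ε ^ 2 * ρ₁)) ^ 2 / 4 + ω ^ 2 := by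
      have : (ρ₀ / 2) ^ 2 ≤ (ρ₀ + ε ^ 2 * ρ₁) ^ 2 := pow_le_pow_left₀ (by linarith) h1.le 2
      have h4 := mul_le_mul_of_nonneg_left this (by positivity : 0 ≤ ε ^ 4 / 4)
      nlinarith [sq_nonneg ω]
    have h5 : 2 * c * ε ^ 6 * (ρ₀ / 2) * (ε ^ 4 * (ρ₀ ^ 2 / 16))
        ≤ (2 * c * ε ^ 6 * (ρ₀ + ε ^ 2 * (ρ₁ - 2 * c)))
          * ((ε ^ 2 * (ρ₀ + ε ^ 2 * ρ₁)) ^ 2 / 4 + ω ^ 2) :=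
      mul_le_mul (mul_le_mul_of_nonneg_left h2.le (by positivity)) h3 (by positivity)
        (mul_nonneg (by positivity) (by linarith))
    have h6 : y * ε ^ 8 ≤ (-(c * ρ₀ ^ 3 / 16) * ε ^ 2) * ε ^ 8 := by
      rw [hy, neg_mul]
      linarith
    have h7 := le_of_mul_le_mul_right h6 (by positivity)
    have := mul_le_mul_of_nonneg_right (min_le_right ρ₀ (c * ρ₀ ^ 3 / 16)) hε2.le
    linarith

theorem IsAdiabaticElimination.eventually_not_condPos (hγ : 0 < γ) (hν : 0 < ν) (hκ : κ ≠ 0)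
    (hφ : gammaPhi γ Δ ν κ < 0) (h₀ : IsAdiabaticElimination γ Δ ν κ (fun _ => 0) K₀ L₀)
    (h : IsAdiabaticElimination γ Δ ν κ G K L) {N : ℕ} (hN : 4 ≤ N) :
    ∀ᶠ ε in nhdsWithin (0 : ℝ) (Set.Ioi 0), ¬ CondPos (truncatedGenerator L N ε) := by
  obtain ⟨M, rfl⟩ := Nat.exists_eq_add_of_le hN
  have hg (n : ℕ) : ∑ k ∈ Finset.range (n + 1), onePlusGauge G k * L (n - k)
      = ∑ k ∈ Finset.range (n + 1), L₀ k * onePlusGauge G (n - k) := by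
    have := (gauge_change hγ hν h₀ h n).2
    rwa [Finset.Nat.sum_antidiagonal_eq_sum_range_succ (fun i j => onePlusGauge G i * L j),
      Finset.Nat.sum_antidiagonal_eq_sum_range_succ (fun i j => L₀ i * onePlusGauge G j)] at this
  have o0 : onePlusGauge G 0 = 1 := rfl
  have o1 : onePlusGauge G 1 = G 1 := rfl
  have o2 : onePlusGauge G 2 = G 2 := rfl
  have hL1 := hg 1
  have hL2 := hg 2
  have hL3 := hg 3
  have hL4 := hg 4
  simp only [Finset.sum_range_succ, Finset.sum_range_zero, zero_add, h.L_zero, h₀.L_zero,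
    h₀.generator_one hν, h₀.generator_three hγ hν, zero_mul, mul_zero, add_zero, Nat.sub_self,
    Nat.sub_zero, o0, o1, o2, one_mul, mul_one, Nat.reduceSub] at hL1 hL2 hL3 hL4
  simp only [hL1, mul_zero, add_zero] at hL2 hL3 hL4
  let φ := superMatrix
  let A : ℝ → Matrix (Fin 2 × Fin 2) (Fin 2 × Fin 2) ℂ := fun ε =>
    φ (L₀ 2) + (ε : ℂ) ^ 2 • φ (L₀ 4)
  let C : ℝ → Matrix (Fin 2 × Fin 2) (Fin 2 × Fin 2) ℂ := fun ε =>
    ∑ i ∈ Finset.range M, (ε : ℂ) ^ i • φ (L (5 + i))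
  let B : ℝ → Matrix (Fin 2 × Fin 2) (Fin 2 × Fin 2) ℂ := fun ε =>
    φ (L 2) + (ε : ℂ) • φ (L 3) + (ε : ℂ) ^ 2 • φ (L 4) + (ε : ℂ) ^ 3 • C ε
  -- With A and B the generators divided by ε², the gauge relations of orders 2, 3, 4 match the
  -- powers 1, ε, ε² of P B and A P. The gauge terms G 1 and G 2 suffice, and R collects everything
  -- else.
  let P : ℝ → Matrix (Fin 2 × Fin 2) (Fin 2 × Fin 2) ℂ := fun ε =>
    1 + (ε : ℂ) • φ (G 1) + (ε : ℂ) ^ 2 • φ (G 2)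
  let R : ℝ → Matrix (Fin 2 × Fin 2) (Fin 2 × Fin 2) ℂ := fun ε =>
    P ε * C ε + φ (G 1) * φ (L 4) + φ (G 2) * φ (L 3) + (ε : ℂ) • (φ (G 2) * φ (L 4))
      - φ (L₀ 4) * φ (G 1) - (ε : ℂ) • (φ (L₀ 4) * φ (G 2))
  have hL2' : φ (L 2) = φ (L₀ 2) := congrArg φ hL2
  have hL3' : φ (L 3) = φ (L₀ 2) * φ (G 1) - φ (G 1) * φ (L 2) := by
    rw [← map_mul, ← map_mul, ← map_sub, ← hL3, add_sub_cancel_right]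
  have hL4' : φ (L 4) = φ (L₀ 2) * φ (G 2) + φ (L₀ 4) - φ (G 1) * φ (L 3) - φ (G 2) * φ (L 2) := by
    simp only [← map_mul, ← map_add, ← map_sub]
    rw [← hL4]
    abel_nf
  have hPB : ∀ ε : ℝ, P ε * B ε = A ε * P ε + ε ^ 3 • R ε := by
    intro ε
    have e : ε ^ 3 • R ε = (ε : ℂ) ^ 3 • R ε := by
      rw [← Complex.ofReal_pow, Complex.coe_smul]
    rw [e]
    simp only [R, B, A, P]
    generalize C ε = c
    rw [hL4', hL3', hL2']
    simp only [mul_add, add_mul, mul_sub, smul_add, smul_sub, smul_mul_assoc,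
      mul_smul_comm, smul_smul, one_mul, mul_one]
    module
  have hCc : Continuous C := by fun_prop
  have hAc : Continuous A := by fun_prop
  have hPc : Continuous P := by fun_prop
  have hRc : Continuous R := by fun_prop
  have hP0 : P 0 = 1 := by simp [P]
  obtain ⟨C₁, h1⟩ := exists_invariant_bound contDiff_trace
    (fun P Q M hQ => by rw [Matrix.trace_mul_cycle, hQ, one_mul]) hAc hPc hRc hP0
    (fun ε _ => hPB ε)
  obtain ⟨C₂, h2⟩ := exists_invariant_bound contDiff_detHalfTrace
    (fun P Q M hQ => detHalfTrace_conj hQ M) hAc hPc hRc hP0 (fun ε _ => hPB ε)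
  obtain ⟨k, hk, h3⟩ := h₀.eventually_invariants hγ hν hκ hφ
  have hpos : ∀ᶠ ε in nhdsWithin (0 : ℝ) (Set.Ioi 0), 0 < ε := eventually_mem_nhdsWithin
  have hlim (c : ℝ) (n : ℕ) :
      ∀ᶠ ε in nhdsWithin (0 : ℝ) (Set.Ioi 0), c * ε ^ (n + 1) < k := by
    have : Continuous fun ε : ℝ => c * ε ^ (n + 1) := by fun_prop
    exact nhdsWithin_le_nhds (this.continuousAt.eventually_lt_const (by simpa using hk))
  filter_upwards [h1, h2, h3, hpos, hlim C₁ 2, hlim C₂ 0] with ε h1 h2 ⟨h3, h4⟩ hε h5 h6 hcp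
  have hAε : superMatrix (L₀ 2 + (ε : ℂ) ^ 2 • L₀ 4) = A ε := by
    simp [A, φ]
  have hBε : superMatrix (truncatedGenerator L (4 + M) ε) = ((ε ^ 2 : ℝ) : ℂ) • B ε := by
    simp only [truncatedGenerator, B, C]
    rw [show 4 + M + 1 = 5 + M by ring, Finset.sum_range_add]
    simp only [Finset.sum_range_succ (n := 4), Finset.sum_range_succ (n := 3),
      Finset.sum_range_succ (n := 2), Finset.sum_range_succ (n := 1),
      Finset.sum_range_succ (n := 0), Finset.sum_range_zero, h.L_zero, hL1, smul_zero, zero_add,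
      map_add, map_smul, map_sum, smul_add, Finset.smul_sum, smul_smul]
    push_cast
    congr 1
    · module
    · refine Finset.sum_congr rfl fun i _ => ?_
      congr 1
      ring
  rw [hAε] at h3 h4
  have hre (x y : ℂ) : x.re ≤ y.re + ‖x - y‖ := by
    have := Complex.re_le_norm (x - y)
    rw [Complex.sub_re] at this
    linarith
  have h7 : (B ε).trace.re < 0 := by
    have h5' := h1.trans_lt h5
    have := hre (B ε).trace (A ε).trace
    linarith
  have h8 := hre (detHalfTrace (B ε)) (detHalfTrace (A ε))
  have hε2 : 0 < ε ^ 2 := by positivity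
  have h9 := hcp.detHalfTrace_nonneg (by
    rw [hBε, Matrix.trace_smul, smul_eq_mul, Complex.re_ofReal_mul]
    exact mul_neg_of_pos_of_neg hε2 h7)
  rw [hBε, detHalfTrace_smul, ← Complex.ofReal_pow, Complex.re_ofReal_mul] at h9
  have h10 : 0 ≤ (detHalfTrace (B ε)).re := nonneg_of_mul_nonneg_right h9 (by positivity)
  -- The error of order ε³ is beaten by the negative value -kε² of the invariant of A.
  have h11 : C₂ * ε ^ 3 < k * ε ^ 2 := by
    have := mul_lt_mul_of_pos_right h6 hε2
    calc C₂ * ε ^ 3 = C₂ * ε ^ (0 + 1) * ε ^ 2 := by ring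
      _ < k * ε ^ 2 := this
  linarith

theorem exists_pos_of_eventually {p : ℝ → Prop}
    (h : ∀ᶠ ε in nhdsWithin (0 : ℝ) (Set.Ioi 0), p ε) :
    ∃ ε₀ : ℝ, 0 < ε₀ ∧ ∀ ε : ℝ, 0 < ε → ε < ε₀ → p ε := by
  obtain ⟨ε₀, h0, h1⟩ := mem_nhdsGT_iff_exists_Ioo_subset.mp h
  exact ⟨ε₀, h0, fun ε h2 h3 => h1 ⟨h2, h3⟩⟩

/-- If the exponential is a Kraus map for arbitrarily small times, the generator is conditionally
positive. -/
theorem exists_not_isKrausMap {L : QubitSuperOp} (h : ¬ CondPos L) :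
    ∃ t₀ : ℝ, 0 < t₀ ∧ ∀ t : ℝ, 0 < t → t < t₀ → ¬ IsKrausMap (expSuper L t) := by
  apply exists_pos_of_eventually
  by_contra hf
  have hpos : ∀ᶠ ε in nhdsWithin (0 : ℝ) (Set.Ioi 0), 0 < ε := eventually_mem_nhdsWithin
  refine h (condPos_of_frequently (tendsto_expSuper L) ?_)
  rw [Filter.not_eventually] at hf
  exact (hf.and_eventually hpos).mono fun t ht => (not_not.mp ht.1).condPos ht.2

end

end AdiabaticElimination

/-! ### Assembly of the four claims -/

open AdiabaticElimination in
theorem mainTheorem1 (γ Δ nth κ : ℝ) (hγ : 0 < γ) (hnth : 0 < nth)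
    (hΔ : |Δ| / γ < Real.sqrt (2 * Real.sqrt 3 - 3) / 2) (hκ : κ ≠ 0) :
    -- in every gauge the elimination exists and is unique, to all orders
    (∀ G : ℕ → QubitSuperOp,
      ∃! p : (ℕ → QubitOp →ₗ[ℂ] TotOp) × (ℕ → QubitSuperOp),
        IsAdiabaticElimination γ Δ nth κ G p.1 p.2) ∧
    -- a change of gauge acts by composition and similarity
    (∀ K₀ L₀, IsAdiabaticElimination γ Δ nth κ (fun _ => 0) K₀ L₀ →
      ∀ G K L, IsAdiabaticElimination γ Δ nth κ G K L → ∀ n : ℕ,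
        K n = ∑ p ∈ Finset.HasAntidiagonal.antidiagonal n, K₀ p.1 ∘ₗ onePlusGauge G p.2 ∧
        ∑ p ∈ Finset.HasAntidiagonal.antidiagonal n, onePlusGauge G p.1 * L p.2
          = ∑ p ∈ Finset.HasAntidiagonal.antidiagonal n, L₀ p.1 * onePlusGauge G p.2) ∧
    -- the fourth-order generator for the partial trace, coupling constant `g = ε κ`
    (∀ K₀ L₀, IsAdiabaticElimination γ Δ nth κ (fun _ => 0) K₀ L₀ →
      ∀ ε : ℝ, 0 < ε →
        (∀ X : QubitOp, truncatedGenerator L₀ 4 ε X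
          = (-Complex.I * ((omegaB γ Δ nth (ε * κ) / 2 : ℝ) : ℂ)) • opComm sigmaZ X
            + ((gammaMinus γ Δ nth (ε * κ) : ℝ) : ℂ) • opDissipator sigmaMinus X
            + ((gammaPlus γ Δ nth (ε * κ) : ℝ) : ℂ) • opDissipator sigmaPlus X
            + ((gammaPhi γ Δ nth (ε * κ) : ℝ) : ℂ) • opDissipator sigmaZ X) ∧
        gammaPhi γ Δ nth (ε * κ) < 0 ∧
        (∀ G : QubitSuperOp, IsUnit (1 + G) →
          ¬ IsLindbladian (gaugeTransform G (truncatedGenerator L₀ 4 ε)) ∧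
          ∀ t : ℝ,
            LinearMap.charpoly (expSuper (gaugeTransform G (truncatedGenerator L₀ 4 ε)) t)
              = spectrumPoly γ Δ nth (ε * κ) t) ∧
        ∃ t₀ : ℝ, 0 < t₀ ∧ ∀ t : ℝ, 0 < t → t < t₀ →
          1 + Real.exp (-t * rateOne γ Δ nth (ε * κ))
            < 2 * Real.exp (-t * rateTwo γ Δ nth (ε * κ)) ∧
          (∀ Φ : QubitSuperOp, LinearMap.charpoly Φ = spectrumPoly γ Δ nth (ε * κ) t →
            ¬ IsKrausMap Φ) ∧
          ∀ G : QubitSuperOp, IsUnit (1 + G) →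
            ¬ IsKrausMap (expSuper (gaugeTransform G (truncatedGenerator L₀ 4 ε)) t)) ∧
    -- in no gauge are the truncated expansions of order four and higher of Lindblad form
    (∀ G K L, IsAdiabaticElimination γ Δ nth κ G K L → ∀ N : ℕ, 4 ≤ N →
      ∃ ε₀ : ℝ, 0 < ε₀ ∧ ∀ ε : ℝ, 0 < ε → ε < ε₀ →
        ¬ IsLindbladian (truncatedGenerator L N ε) ∧
        ∃ t₀ : ℝ, 0 < t₀ ∧ ∀ t : ℝ, 0 < t → t < t₀ →
          ¬ IsKrausMap (expSuper (truncatedGenerator L N ε) t)) := by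
  have hφ : ∀ {g : ℝ}, g ≠ 0 → gammaPhi γ Δ nth g < 0 := fun hg => gammaPhi_neg hγ hnth hΔ hg
  refine ⟨fun G => existsUnique_elimination hγ hnth κ G,
    fun K₀ L₀ h₀ G K L h n => gauge_change hγ hnth h₀ h n, fun K₀ L₀ h ε hε => ?_,
    fun G K L h N hN => ?_⟩
  · have hφε := hφ (mul_ne_zero hε.ne' hκ)
    -- Here 2/T₂ - 1/T₁ = 4γ_φ < 0 supplies the hypothesis. The time t₀ is chosen before any map Φ
    -- or gauge G, so it serves all of them.
    obtain ⟨t₀, ht₀, hlt⟩ := exists_time_lt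
      (a := rateOne γ Δ nth (ε * κ)) (b := rateTwo γ Δ nth (ε * κ)) (by rw [rateTwo]; linarith)
    have hchar : ∀ G : QubitSuperOp, IsUnit (1 + G) → ∀ t : ℝ,
        LinearMap.charpoly (expSuper (gaugeTransform G (truncatedGenerator L₀ 4 ε)) t)
          = spectrumPoly γ Δ nth (ε * κ) t := fun G hG t => by
      rw [expSuper_gaugeTransform hG, charpoly_gaugeTransform hG,
        h.charpoly_expSuper_truncated_four hγ hnth]
    have hkraus : ∀ t : ℝ, 0 < t → t < t₀ → ∀ Φ : QubitSuperOp,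
        LinearMap.charpoly Φ = spectrumPoly γ Δ nth (ε * κ) t → ¬ IsKrausMap Φ := by
      intro t h0 h1 Φ hc hΦ
      obtain ⟨z, hz, hs⟩ := spectrumPoly_eq γ Δ nth (ε * κ) t
      have h2 := hΦ.norm_eigenvalue_le (Real.exp_pos _) (hc.trans hs)
      have h3 := hlt t h0 h1
      rw [hz] at h2
      linarith
    refine ⟨h.truncated_four_apply hγ hnth ε, hφε, fun G hG => ⟨fun hL => ?_, hchar G hG⟩, t₀, ht₀,
      fun t h0 h1 => ⟨hlt t h0 h1, hkraus t h0 h1,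
        fun G hG => hkraus t h0 h1 _ (hchar G hG t)⟩⟩
    obtain ⟨h1, h2⟩ := h.charpoly_truncated_four hγ hnth ε
    exact not_condPos_of_charpoly hφε rfl ((charpoly_gaugeTransform hG _).trans h1)
      ((trace_gaugeTransform hG _).trans h2) hL.condPos
  · obtain ⟨⟨K₀, L₀⟩, h₀, -⟩ := existsUnique_elimination (Δ := Δ) hγ hnth κ fun _ => 0
    obtain ⟨ε₀, hε₀, hε⟩ :=
      exists_pos_of_eventually (h₀.eventually_not_condPos hγ hnth hκ (hφ hκ) h hN)
    exact ⟨ε₀, hε₀, fun ε h0 h1 => ⟨fun hL => hε ε h0 h1 hL.condPos,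
      exists_not_isKrausMap (hε ε h0 h1)⟩⟩
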